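/- **Setting.** Let $\mathbb R^{3,3}=E\oplus F$, $E=\mathbb R^3$, $F=(\mathbb R^3)^*$, carry the split form $h=\begin{pmatrix}0&I_3\\ I_3&0\end{pmatrix}$, and let $\tilde G=\mathrm{Spin}(3,3)$ (the connected spin group) with Lie algebra $\tilde{\mathfrak g}=\mathfrak{so}(3,3)$. Let $G\cong \mathrm{SL}(3)$ be the subgroup of $\tilde G$ fixing two pure spinors $s_E,s_F$ with kernels $E,F$; its Lie algebra is $\mathfrak g=\{\mathrm{diag}(A,-A^t): A\in\mathfrak{sl}(3)\}\subset\tilde{\mathfrak g}$. Let $P\subset G$ be the stabiliser of the ray through $v_+=e_1\in E$, let $\tilde P\subset\tilde G$ be the stabiliser of the ray through the null vector $\tilde v_+=(1,0,0,0,0,1)^t$, and let $Q=G\cap\tilde P$, which is contained in $P$. A Cartan geometry of type $(G,P)$ is a smooth principal $P$-bundle $\mathcal G\to M$ with a Cartan connection $\omega\in\Omega^1(\mathcal G,\mathfrak g)$ (smooth, $P$-equivariant, reproducing the generators of fundamental vector fields, a linear isomorphism on each tangent space); similarly for $(\tilde G,\tilde P)$. It is normal if its curvature function $\kappa$, given by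 $K=d\omega+\frac12[\omega,\omega]$, i.e. $K(\xi,\eta)=d\omega(\xi,\eta)+[\omega(\xi),\omega(\eta)]$, satisfies $\partial^*\kappa=0$, where $\partial^*\kappa(X)=2\sum_i[\kappa(X_i,X),Z_i]+\sum_i\kappa(X_i,[Z_i,X])$ is the Kostant codifferential; here $X_i\in\mathfrak g$ induce a basis of $\mathfrak g/\mathfrak p$ and $Z_i\in\mathfrak p_+=\mathfrak p^\perp$ is the dual basis with respect to the Killing form. Normal geometries of type $(G,P)$ over surfaces encode oriented two-dimensional projective structures; geometries of type $(\tilde G,\tilde P)$ induce conformal spin structures of signature $(2,2)$. Given a geometry $(\mathcal G\to M,\omega)$ of type $(G,P)$ over a surface $M$, put $\tilde M=\mathcal G/Q$ and $\tilde{\mathcal G}=\mathcal G\times_Q\tilde P$, with their canonical smooth structures, so that $\tilde{\mathcal G}\to\tilde M$ is a principal $\tilde P$-bundle containing $\mathcal G$. **Proposition.** Let $(\mathcal G\to M,\omega)$ be a normal parabolic geometry of type $(G,P)$ on a two-dimensional manifold $M$, i.e. one encoding a two-dimensional (oriented) projective structure. 1. There is a unique Cartan connection $\tilde\omega\in\Omega^1(\tilde{\mathcal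 G},\tilde{\mathfrak g})$ of type $(\tilde G,\tilde P)$ that restricts to $\omega$ on $\mathcal G$. 2. The conformal parabolic geometry $(\tilde{\mathcal G},\tilde\omega)$ is normal. 3. Consequently the induced tractor connections are the normal ones: if $\tilde\omega^{nor}$ is any normal Cartan connection on $\tilde{\mathcal G}$ inducing the same conformal structure as $\tilde\omega$ (i.e. $\tilde\omega^{nor}-\tilde\omega$ has values in $\tilde{\mathfrak p}$), then there is a smooth automorphism $\Phi$ of the principal bundle $\tilde{\mathcal G}$ over the identity of $\tilde M$ with $\Phi^*\tilde\omega^{nor}=\tilde\omega$. For every finite-dimensional smooth representation $\mathbb V$ of $\tilde G$, the automorphism of the tractor bundle $\tilde{\mathcal V}=\tilde{\mathcal G}\times_{\tilde P}\mathbb V$ given by $\Phi$ identifies the tractor connection $\nabla^{\tilde{\mathcal V}}$ induced by $\tilde\omega$ with the tractor connection $\nabla^{\tilde{\mathcal V},nor}$ induced by $\tilde\omega^{nor}$. -/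

import Mathlib

open scoped Manifold ContDiff Matrix

noncomputable section

attribute [local instance] LieRing.ofAssociativeRing

namespace Fefferman

/-! ### The split quadratic space, its spin group and its spin representation -/

/-- The vector space of `ℝ^{3,3} = E ⊕ F`, with `E = ℝ³` (left) and `F = (ℝ³)*` (right). -/
abbrev Vec33 : Type := Fin 3 ⊕ Fin 3 → ℝ

/-- `6 × 6` matrices, in blocks of size `3`. -/
abbrev Mat33 : Type := Matrix (Fin 3 ⊕ Fin 3) (Fin 3 ⊕ Fin 3) ℝ

/-- The `E`-component of a vector. -/
def eComp : Vec33 →ₗ[ℝ] (Fin 3 → ℝ) := LinearMap.funLeft ℝ ℝ Sum.inl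

/-- The `F`-component of a vector. -/
def fComp : Vec33 →ₗ[ℝ] (Fin 3 → ℝ) := LinearMap.funLeft ℝ ℝ Sum.inr

/-- The bilinear form `(v, w) ↦ ∑ v_F w_E`, whose symmetrisation is the split signature form
`h` with matrix `[[0, 1], [1, 0]]`. -/
def halfForm : LinearMap.BilinMap ℝ Vec33 ℝ :=
  LinearMap.mk₂ ℝ (fun v w => fComp v ⬝ᵥ eComp w)
    (by intros; simp [add_dotProduct]) (by intros; simp)
    (by intros; simp) (by intros; simp)

/-- The split quadratic form of signature `(3,3)`, half the square of `h`, so that in its Clifford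
algebra `v w + w v = h(v, w)`. -/
def Q33 : QuadraticForm ℝ Vec33 := halfForm.toQuadraticMap

/-- The Clifford algebra of `ℝ^{3,3}`. -/
abbrev Cl33 : Type := CliffordAlgebra Q33

/-- The (connected) group `Spin(3,3)`. -/
abbrev Spin33 : Type := spinGroup Q33

/-- The space of spinors `Δ = Λ E`. -/
abbrev Spinor : Type := ExteriorAlgebra ℝ (Fin 3 → ℝ)

/-- Clifford multiplication of vectors on spinors: `E` acts by exterior multiplication and
`F = E*` by contraction. -/
def cliffordMul : Vec33 →ₗ[ℝ] Module.End ℝ Spinor :=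
  (LinearMap.mul ℝ Spinor).comp ((ExteriorAlgebra.ι ℝ).comp eComp) +
    (CliffordAlgebra.contractLeft (Q := (0 : QuadraticForm ℝ (Fin 3 → ℝ)))).comp
      ((dotProductBilin ℝ ℝ).comp fComp)

lemma cliffordMul_apply (v : Vec33) (s : Spinor) :
    cliffordMul v s = ExteriorAlgebra.ι ℝ (eComp v) * s +
      CliffordAlgebra.contractLeft (Q := (0 : QuadraticForm ℝ (Fin 3 → ℝ)))
        (dotProductBilin ℝ ℝ (fComp v)) s := rfl

lemma cliffordMul_sq (v : Vec33) :
    cliffordMul v * cliffordMul v = algebraMap ℝ (Module.End ℝ Spinor) (Q33 v) := by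
  refine LinearMap.ext fun s => ?_
  have h1 : ∀ t : Spinor, ExteriorAlgebra.ι ℝ (eComp v) * (ExteriorAlgebra.ι ℝ (eComp v) * t) = 0 := by
    intro t
    rw [← mul_assoc, ExteriorAlgebra.ι_sq_zero, zero_mul]
  have h2 : Q33 v = fComp v ⬝ᵥ eComp v := rfl
  rw [Module.End.mul_apply, cliffordMul_apply v (cliffordMul v s), cliffordMul_apply v s]
  have h3 := CliffordAlgebra.contractLeft_ι_mul (Q := (0 : QuadraticForm ℝ (Fin 3 → ℝ)))
    (dotProductBilin ℝ ℝ (fComp v)) (eComp v) s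
  have h4 := CliffordAlgebra.contractLeft_contractLeft (Q := (0 : QuadraticForm ℝ (Fin 3 → ℝ)))
    (dotProductBilin ℝ ℝ (fComp v)) s
  simp only [mul_add, h1, map_add, h4]
  erw [h3]
  rw [Module.algebraMap_end_apply, h2]
  simp [ExteriorAlgebra.ι]

/-- The spin representation of the Clifford algebra on `Δ = Λ E`. -/
def spinRep : Cl33 →ₐ[ℝ] Module.End ℝ Spinor :=
  CliffordAlgebra.lift Q33 ⟨cliffordMul, cliffordMul_sq⟩

lemma spinRep_ι (v : Vec33) : spinRep (CliffordAlgebra.ι Q33 v) = cliffordMul v := by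
  simp [spinRep]

/-- The pure spinor `s_F = 1 ∈ Λ⁰ E`, with kernel `F`. -/
def spinorF : Spinor := 1

/-- The pure spinor `s_E = e₁ ∧ e₂ ∧ e₃ ∈ Λ³ E`, with kernel `E`. -/
def spinorE : Spinor :=
  ExteriorAlgebra.ι ℝ (Pi.single 0 1) * ExteriorAlgebra.ι ℝ (Pi.single 1 1) *
    ExteriorAlgebra.ι ℝ (Pi.single 2 1)

lemma ι33_injective : Function.Injective (CliffordAlgebra.ι Q33) := by
  rw [injective_iff_map_eq_zero]
  intro v hv
  have h0 : ∀ s, cliffordMul v s = 0 := by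
    intro s
    rw [← spinRep_ι, hv]; simp
  have h1 : eComp v = 0 := by
    have := h0 1
    rw [cliffordMul_apply, CliffordAlgebra.contractLeft_one, mul_one, add_zero] at this
    exact ExteriorAlgebra.ι_eq_zero_iff (R := ℝ) _ |>.1 this
  have h2 : ∀ w, fComp v ⬝ᵥ w = 0 := by
    intro w
    have := h0 (ExteriorAlgebra.ι ℝ w)
    rw [cliffordMul_apply, h1, map_zero, zero_mul, zero_add] at this
    erw [CliffordAlgebra.contractLeft_ι] at this
    exact (FaithfulSMul.algebraMap_eq_zero_iff ℝ _).1 this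
  have h3 : fComp v = 0 := by
    ext i
    simpa using h2 (Pi.single i 1)
  ext i
  rcases i with i | i
  · exact congrFun h1 i
  · exact congrFun h3 i

lemma conj_mem (g : Spin33) (v : Vec33) :
    (g : Cl33) * CliffordAlgebra.ι Q33 v * ((g⁻¹ : Spin33) : Cl33) ∈
      LinearMap.range (CliffordAlgebra.ι Q33) := by
  have := spinGroup.conjAct_smul_ι_mem_range_ι (x := spinGroup.toUnits g) (by exact g.2) v
  rwa [ConjAct.units_smul_def] at this

/-- The action of `Spin(3,3)` on `ℝ^{3,3}` by conjugation in the Clifford algebra. -/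
def vectorAct (g : Spin33) : Vec33 →ₗ[ℝ] Vec33 :=
  (LinearEquiv.ofInjective _ ι33_injective).symm.toLinearMap ∘ₗ
    LinearMap.codRestrict (LinearMap.range (CliffordAlgebra.ι Q33))
      (LinearMap.mulRight ℝ ((g⁻¹ : Spin33) : Cl33) ∘ₗ LinearMap.mulLeft ℝ (g : Cl33) ∘ₗ
        CliffordAlgebra.ι Q33) (conj_mem g)

lemma ι_vectorAct (g : Spin33) (v : Vec33) :
    CliffordAlgebra.ι Q33 (vectorAct g v) =
      (g : Cl33) * CliffordAlgebra.ι Q33 v * ((g⁻¹ : Spin33) : Cl33) := by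
  change ((LinearEquiv.ofInjective _ ι33_injective (vectorAct g v) :
    LinearMap.range (CliffordAlgebra.ι Q33)) : Cl33) = _
  rw [vectorAct, LinearMap.comp_apply, LinearEquiv.coe_coe, LinearEquiv.apply_symm_apply]
  rfl

lemma vectorAct_one : vectorAct 1 = LinearMap.id := by
  refine LinearMap.ext fun w => ι33_injective ?_
  simp [ι_vectorAct]

lemma vectorAct_mul (g k : Spin33) : vectorAct (g * k) = vectorAct g * vectorAct k := by
  refine LinearMap.ext fun w => ι33_injective ?_
  simp [ι_vectorAct, mul_assoc]

/-- The double covering `Spin(3,3) → SO(3,3)`, in matrices. -/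
def rho : Spin33 →* Mat33 where
  toFun g := LinearMap.toMatrix' (vectorAct g)
  map_one' := by rw [vectorAct_one, LinearMap.toMatrix'_id]
  map_mul' g k := by rw [vectorAct_mul, LinearMap.toMatrix'_mul]

lemma rho_mulVec (g : Spin33) (v : Vec33) : rho g *ᵥ v = vectorAct g v :=
  LinearMap.toMatrix'_mulVec _ _

/-! ### The groups and Lie algebras of the two models -/

/-- The subgroup `G ≅ SL(3)` of all elements of `Spin(3,3)` which fix the two pure spinors. -/
def groupG : Subgroup Spin33 where
  carrier := {g | spinRep (g : Cl33) spinorE = spinorE ∧ spinRep (g : Cl33) spinorF = spinorF}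
  one_mem' := by simp
  mul_mem' := by
    rintro a b ⟨ha, ha'⟩ ⟨hb, hb'⟩
    simp [ha, ha', hb, hb']
  inv_mem' := by
    intro a ha
    have key : ∀ s : Spinor, spinRep (a : Cl33) s = s →
        spinRep ((a⁻¹ : Spin33) : Cl33) s = s := by
      intro s hs
      have h1 : ((a⁻¹ : Spin33) : Cl33) * (a : Cl33) = 1 :=
        congrArg Subtype.val (inv_mul_cancel a)
      have h2 : spinRep ((a⁻¹ : Spin33) : Cl33) (spinRep (a : Cl33) s) = s := by
        rw [← Module.End.mul_apply, ← map_mul, h1]; simp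
      rwa [hs] at h2
    exact ⟨key _ ha.1, key _ ha.2⟩

/-- The stabiliser in `Spin(3,3)` of the ray spanned by `v`. -/
def rayStabilizer (v : Vec33) : Subgroup Spin33 where
  carrier := {g | ∃ c : ℝ, 0 < c ∧ rho g *ᵥ v = c • v}
  one_mem' := ⟨1, one_pos, by simp⟩
  mul_mem' := by
    rintro a b ⟨c, hc, ha⟩ ⟨d, hd, hb⟩
    refine ⟨c * d, mul_pos hc hd, ?_⟩
    rw [map_mul, ← Matrix.mulVec_mulVec, hb, Matrix.mulVec_smul, ha, smul_smul, mul_comm]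
  inv_mem' := by
    rintro a ⟨c, hc, ha⟩
    refine ⟨c⁻¹, inv_pos.2 hc, ?_⟩
    have h : rho a⁻¹ *ᵥ (rho a *ᵥ v) = v := by
      rw [Matrix.mulVec_mulVec, ← map_mul]; simp
    rw [ha, Matrix.mulVec_smul] at h
    rw [← h, smul_smul, inv_mul_cancel₀ hc.ne', one_smul, h]

/-- The embedding `sl(3) → so(3,3)`, `A ↦ diag(A, -Aᵗ)`. -/
def slEmbedding : LieAlgebra.SpecialLinear.sl (Fin 3) ℝ →ₗ⁅ℝ⁆ Mat33 where
  toFun A := Matrix.fromBlocks A.1 0 0 (-A.1ᵀ)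
  map_add' A B := by
    ext (i | i) (j | j) <;> simp [add_comm]
  map_smul' c A := by
    ext (i | i) (j | j) <;> simp
  map_lie' := by
    intro A B
    simp only [LieSubalgebra.coe_bracket, Ring.lie_def, Matrix.fromBlocks_multiply]
    ext (i | i) (j | j) <;> simp [Matrix.transpose_mul]

/-- The data of a model: a subgroup of `Spin(3,3)`, its Lie algebra (realised in the vector
representation `ℝ^{3,3}`), and a vector, the stabiliser of whose ray is the parabolic subgroup. -/
structure Model where
  group : Subgroup Spin33
  alg : LieSubalgebra ℝ Mat33
  vec : Vec33

namespace Model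

/-- The parabolic subgroup of a model. -/
def parabolic (𝔪 : Model) : Subgroup Spin33 := 𝔪.group ⊓ rayStabilizer 𝔪.vec

/-- The parabolic subalgebra of a model: the matrices that preserve the line of the vector. -/
def parabolicAlg (𝔪 : Model) : Submodule ℝ 𝔪.alg where
  carrier := {X | ∃ c : ℝ, (X : Mat33) *ᵥ 𝔪.vec = c • 𝔪.vec}
  zero_mem' := ⟨0, by simp⟩
  add_mem' := by
    rintro X Y ⟨c, hX⟩ ⟨d, hY⟩
    exact ⟨c + d, by simp [Matrix.add_mulVec, hX, hY, add_smul]⟩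
  smul_mem' := by
    rintro a X ⟨c, hX⟩
    exact ⟨a * c, by simp [Matrix.smul_mulVec, hX, mul_smul]⟩

end Model

/-- The vector `v₊ = e₁` of `E = ℝ³`. -/
def vPlus : Vec33 := Sum.elim ![1, 0, 0] 0

/-- The null vector `ṽ₊ = (1,0,0,0,0,1)` of `ℝ^{3,3}`. -/
def vTilde : Vec33 := Sum.elim ![1, 0, 0] ![0, 0, 1]

/-- The model `(SL(3), P)` of oriented two-dimensional projective structures. -/
def projective : Model := ⟨groupG, slEmbedding.range, vPlus⟩

/-- The model `(Spin(3,3), P̃)` of conformal spin structures of signature `(2,2)`; its Lie algebra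
is the Lie algebra `so(3,3)` of the form with matrix `[[0, 1], [1, 0]]`. -/
def conformal : Model := ⟨⊤, LieAlgebra.Orthogonal.typeD (Fin 3) ℝ, vTilde⟩

/-- The group `Q = G ∩ P̃`. -/
def groupQ : Subgroup Spin33 := projective.group ⊓ conformal.parabolic
lemma spinRep_mul_ι (g : Spin33) (v : Vec33) (s : Spinor) (hs : spinRep (g : Cl33) s = s) :
    cliffordMul (vectorAct g v) s = spinRep (g : Cl33) (cliffordMul v s) := by
  have h1 : (CliffordAlgebra.ι Q33 (vectorAct g v)) * (g : Cl33) =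
      (g : Cl33) * CliffordAlgebra.ι Q33 v := by
    have h2 : ((g⁻¹ : Spin33) : Cl33) * (g : Cl33) = 1 := congrArg Subtype.val (inv_mul_cancel g)
    rw [ι_vectorAct, mul_assoc, h2, mul_one]
  have h3 := congrArg (fun x => spinRep x s) h1
  simpa [spinRep_ι, hs] using h3

lemma spinorE_ne_zero : spinorE ≠ 0 := by
  intro h
  have key : ∀ (d v : Fin 3 → ℝ) (x : Spinor),
      CliffordAlgebra.contractLeft (Q := (0 : QuadraticForm ℝ (Fin 3 → ℝ)))
        (dotProductBilin ℝ ℝ d) (ExteriorAlgebra.ι ℝ v * x) =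
      (d ⬝ᵥ v) • x - ExteriorAlgebra.ι ℝ v *
        CliffordAlgebra.contractLeft (Q := (0 : QuadraticForm ℝ (Fin 3 → ℝ)))
        (dotProductBilin ℝ ℝ d) x := fun d v x =>
    CliffordAlgebra.contractLeft_ι_mul (Q := (0 : QuadraticForm ℝ (Fin 3 → ℝ)))
      (dotProductBilin ℝ ℝ d) v x
  have key1 : ∀ (d v : Fin 3 → ℝ),
      CliffordAlgebra.contractLeft (Q := (0 : QuadraticForm ℝ (Fin 3 → ℝ)))
        (dotProductBilin ℝ ℝ d) (ExteriorAlgebra.ι ℝ v) = algebraMap ℝ Spinor (d ⬝ᵥ v) :=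
    fun d v => CliffordAlgebra.contractLeft_ι (Q := (0 : QuadraticForm ℝ (Fin 3 → ℝ)))
      (dotProductBilin ℝ ℝ d) v
  rw [spinorE, mul_assoc] at h
  have h1 := congrArg (CliffordAlgebra.contractLeft (Q := (0 : QuadraticForm ℝ (Fin 3 → ℝ)))
        (dotProductBilin ℝ ℝ (Pi.single 0 1))) h
  rw [key, key, key1] at h1
  simp at h1
  have h2 := congrArg (CliffordAlgebra.contractLeft (Q := (0 : QuadraticForm ℝ (Fin 3 → ℝ)))
        (dotProductBilin ℝ ℝ (Pi.single 1 1))) h1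
  rw [key, key1] at h2
  simp at h2

lemma cliffordMul_spinorF (v : Vec33) (h : cliffordMul v spinorF = 0) : eComp v = 0 := by
  rw [cliffordMul_apply, spinorF, CliffordAlgebra.contractLeft_one, mul_one, add_zero] at h
  exact ExteriorAlgebra.ι_eq_zero_iff (R := ℝ) _ |>.1 h

lemma spinorF_of_eComp (v : Vec33) (h : eComp v = 0) : cliffordMul v spinorF = 0 := by
  rw [cliffordMul_apply, spinorF, CliffordAlgebra.contractLeft_one, h]
  simp

lemma spinorE_of_fComp (v : Vec33) (h : fComp v = 0) : cliffordMul v spinorE = 0 := by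
  have hv : eComp v = eComp v 0 • Pi.single 0 1 + eComp v 1 • Pi.single 1 1 +
      eComp v 2 • Pi.single 2 1 := by
    ext i
    fin_cases i <;> simp
  have hd : dotProductBilin ℝ ℝ (0 : Fin 3 → ℝ) = (0 : Module.Dual ℝ (Fin 3 → ℝ)) := map_zero _
  have sw : ∀ a b : Fin 3 → ℝ, ExteriorAlgebra.ι ℝ a * ExteriorAlgebra.ι ℝ b =
      -(ExteriorAlgebra.ι ℝ b * ExteriorAlgebra.ι ℝ a) := fun a b =>
    eq_neg_of_add_eq_zero_left (ExteriorAlgebra.ι_add_mul_swap a b)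
  have sq : ∀ a : Fin 3 → ℝ, ExteriorAlgebra.ι ℝ a * ExteriorAlgebra.ι ℝ a = 0 :=
    fun a => ExteriorAlgebra.ι_sq_zero a
  have sq2 : ∀ (a : Fin 3 → ℝ) (x : Spinor),
      ExteriorAlgebra.ι ℝ a * (ExteriorAlgebra.ι ℝ a * x) = 0 := by
    intro a x
    rw [← mul_assoc, sq, zero_mul]
  have sw2 : ∀ (a b : Fin 3 → ℝ) (x : Spinor),
      ExteriorAlgebra.ι ℝ a * (ExteriorAlgebra.ι ℝ b * x) =
      -(ExteriorAlgebra.ι ℝ b * (ExteriorAlgebra.ι ℝ a * x)) := by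
    intro a b x
    rw [← mul_assoc, sw, neg_mul, mul_assoc]
  have h0 : ExteriorAlgebra.ι ℝ (Pi.single (0 : Fin 3) (1 : ℝ)) * spinorE = 0 := by
    rw [spinorE, mul_assoc, sq2]
  have h1 : ExteriorAlgebra.ι ℝ (Pi.single (1 : Fin 3) (1 : ℝ)) * spinorE = 0 := by
    rw [spinorE, mul_assoc, sw2, sq2, mul_zero, neg_zero]
  have h2 : ExteriorAlgebra.ι ℝ (Pi.single (2 : Fin 3) (1 : ℝ)) * spinorE = 0 := by
    rw [spinorE, mul_assoc, sw2, sw2 (Pi.single 2 1) (Pi.single 1 1), sq]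
    simp
  rw [cliffordMul_apply, h, hd, map_zero, LinearMap.zero_apply, add_zero, hv]
  simp [add_mul, h0, h1, h2]

lemma cliffordMul_spinorE (v : Vec33) (h : cliffordMul v spinorE = 0) : fComp v = 0 := by
  ext i
  let e : Vec33 := Pi.single (Sum.inl i) 1
  have he : fComp e = 0 := by
    ext j; simp [e, fComp, LinearMap.funLeft]
  have h1 : cliffordMul e spinorE = 0 := spinorE_of_fComp e he
  have h2 : cliffordMul (v + e) (cliffordMul (v + e) spinorE) = Q33 (v + e) • spinorE := by
    rw [← Module.End.mul_apply, cliffordMul_sq]; rfl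
  have h3 : cliffordMul v (cliffordMul v spinorE) = Q33 v • spinorE := by
    rw [← Module.End.mul_apply, cliffordMul_sq]; rfl
  rw [h, map_zero] at h3
  have h4 : Q33 v = 0 := (smul_eq_zero.1 h3.symm).resolve_right spinorE_ne_zero
  have h7 : cliffordMul (v + e) spinorE = 0 := by
    rw [map_add, LinearMap.add_apply, h, h1, add_zero]
  rw [h7, map_zero] at h2
  have h5 : Q33 (v + e) = 0 := (smul_eq_zero.1 h2.symm).resolve_right spinorE_ne_zero
  have h6 : Q33 (v + e) = Q33 v + fComp v i := by
    change fComp (v + e) ⬝ᵥ eComp (v + e) = fComp v ⬝ᵥ eComp v + fComp v i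
    have : eComp e = Pi.single i 1 := by
      ext j
      simp [e, eComp, LinearMap.funLeft, Pi.single_apply]
    rw [map_add, map_add, he, add_zero, dotProduct_add, this, dotProduct_single_one]
  rw [h5, h4, zero_add] at h6
  exact h6.symm

lemma groupQ_le : groupQ ≤ projective.parabolic := by
  intro g hg
  refine ⟨hg.1, ?_⟩
  obtain ⟨hE, hF⟩ := hg.1
  obtain ⟨-, -, c, hc, h⟩ := hg
  refine ⟨c, hc, ?_⟩
  let w : Vec33 := Sum.elim 0 ![0, 0, 1]
  have hs : vTilde = vPlus + w := by
    ext (i | i) <;> simp [vTilde, vPlus, w]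
  have h1 : fComp (vectorAct g vPlus) = 0 := by
    apply cliffordMul_spinorE
    rw [spinRep_mul_ι g _ _ hE, spinorE_of_fComp _ (by ext j; rfl), map_zero]
  have h2 : eComp (vectorAct g w) = 0 := by
    apply cliffordMul_spinorF
    rw [spinRep_mul_ι g _ _ hF, spinorF_of_eComp _ (by ext j; rfl), map_zero]
  change rho g *ᵥ vTilde = c • vTilde at h
  change rho g *ᵥ vPlus = c • vPlus
  rw [rho_mulVec] at h ⊢
  rw [hs, map_add] at h
  ext (i | i)
  · have h3 := congrFun h (Sum.inl i)
    have h4 : vectorAct g w (Sum.inl i) = 0 := congrFun h2 i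
    simpa [h4, w] using h3
  · have h3 : vectorAct g vPlus (Sum.inr i) = 0 := congrFun h1 i
    rw [h3]
    simp [vPlus]
/-! ### Smooth principal bundles -/

section Bundles

variable {d m : ℕ} {X M : Type*}
  [TopologicalSpace X] [ChartedSpace (EuclideanSpace ℝ (Fin d)) X]
  [TopologicalSpace M] [ChartedSpace (EuclideanSpace ℝ (Fin m)) M]

/-- Smoothness on a set `s` of a map from a manifold to `Spin(3,3)`, a closed subgroup of the group
of units of the finite-dimensional algebra `Cl33`: all linear functionals of the map are smooth. -/
def SmoothIntoSpinOn {E : Type*} [NormedAddCommGroup E] [NormedSpace ℝ E] {H N : Type*}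
    [TopologicalSpace H] (I : ModelWithCorners ℝ E H) [TopologicalSpace N] [ChartedSpace H N]
    (f : N → Spin33) (s : Set N) : Prop :=
  ∀ φ : Module.Dual ℝ Cl33, ContMDiffOn I 𝓘(ℝ, ℝ) ∞ (fun x => φ (f x : Cl33)) s

/-- `π : X → M` is a smooth principal bundle with structure group the closed subgroup `H` of
`Spin(3,3)`, acting on `X` from the right by `act`. Smoothness of the action `X × H → X` is tested
on smoothly parametrised families of points of `X` and elements of `H`. -/
structure IsPrincipalBundle (H : Subgroup Spin33) (act : X → H → X) (π : X → M) : Prop where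
  act_one : ∀ u, act u 1 = u
  act_mul : ∀ u h k, act u (h * k) = act (act u h) k
  smooth_act : ∀ (k : ℕ) (s : Set (EuclideanSpace ℝ (Fin k))) (c : EuclideanSpace ℝ (Fin k) → X)
    (γ : EuclideanSpace ℝ (Fin k) → H), IsOpen s → ContMDiffOn (𝓡 k) (𝓡 d) ∞ c s →
    SmoothIntoSpinOn (𝓡 k) (fun t => (γ t : Spin33)) s →
    ContMDiffOn (𝓡 k) (𝓡 d) ∞ (fun t => act (c t) (γ t)) s
  smooth_proj : ContMDiff (𝓡 d) (𝓡 m) ∞ π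
  proj_act : ∀ u h, π (act u h) = π u
  simply_transitive : ∀ u u', π u = π u' → ∃! h : H, u' = act u h
  locally_trivial : ∀ x : M, ∃ (U : Set M) (σ : M → X) (δ : X → H), IsOpen U ∧ x ∈ U ∧
    ContMDiffOn (𝓡 m) (𝓡 d) ∞ σ U ∧ (∀ y ∈ U, π (σ y) = y) ∧
    SmoothIntoSpinOn (𝓡 d) (fun u => (δ u : Spin33)) (π ⁻¹' U) ∧
    ∀ u ∈ π ⁻¹' U, u = act (σ (π u)) (δ u)

/-! ### Cartan connections, curvature, normality -/

variable (X) in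
/-- Fields of linear maps on the tangent spaces of `X` with values in the Lie algebra `𝔤`. -/
abbrev OneForm (d : ℕ) [ChartedSpace (EuclideanSpace ℝ (Fin d)) X]
    (𝔤 : LieSubalgebra ℝ Mat33) : Type _ :=
  ∀ u : X, TangentSpace (𝓡 d) u →ₗ[ℝ] 𝔤

/-- `θ` is a Cartan connection of the type given by the model, on the space `X` with the right
action `act` of the parabolic subgroup. -/
structure IsCartanConnection [IsManifold (𝓡 d) ∞ X] (𝔪 : Model) (act : X → 𝔪.parabolic → X)
    (θ : OneForm X d 𝔪.alg) : Prop where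
  /-- `θ` is smooth. -/
  smooth : ∀ i j, ContMDiff (𝓡 d).tangent 𝓘(ℝ, ℝ) ∞
    (fun p : TangentBundle (𝓡 d) X => (θ p.1 p.2 : Mat33) i j)
  /-- `(rʰ)^* θ = Ad(h⁻¹) ∘ θ`. -/
  equivariant : ∀ (h : 𝔪.parabolic) (u : X) (v : TangentSpace (𝓡 d) u),
    (θ (act u h) (mfderiv (𝓡 d) (𝓡 d) (fun x => act x h) u v) : Mat33) =
      rho (h : Spin33)⁻¹ * (θ u v : Mat33) * rho (h : Spin33)
  /-- `θ` maps each fundamental vector field to its generator: the velocity of `t ↦ u · γ(t)` at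
  `t = 0` is mapped to the velocity of `γ`. -/
  fundamental : ∀ γ : ℝ → 𝔪.parabolic, SmoothIntoSpinOn 𝓘(ℝ, ℝ) (fun t => (γ t : Spin33)) Set.univ →
    γ 0 = 1 → ∀ (u : X) i j, HasDerivAt (fun t => rho (γ t : Spin33) i j)
      ((θ (act u (γ 0))
        (mfderiv 𝓘(ℝ, ℝ) (𝓡 d) (fun t => act u (γ t)) 0 (1 : ℝ)) : Mat33) i j) 0
  /-- `θ` is a linear isomorphism on each tangent space. -/
  bijective : ∀ u : X, Function.Bijective (θ u)

/-- The exterior derivative `dα(v, w)` at `u` of a real-valued one-form, computed in the chart of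
`X` at `u`, in which tangent vectors at `u` are their own coordinate vectors. -/
def dOneForm (α : ∀ u : X, TangentSpace (𝓡 d) u → ℝ) (u : X) (v w : TangentSpace (𝓡 d) u) : ℝ :=
  let φ := extChartAt (𝓡 d) u
  let α' : EuclideanSpace ℝ (Fin d) → EuclideanSpace ℝ (Fin d) → ℝ := fun y z =>
    α (φ.symm y) (mfderiv 𝓘(ℝ, EuclideanSpace ℝ (Fin d)) (𝓡 d) φ.symm y z)
  fderiv ℝ (fun y => α' y w) (φ u) v - fderiv ℝ (fun y => α' y v) (φ u) w

/-- The curvature two-form `K(v, w) = dθ(v, w) + [θ(v), θ(w)]`. -/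
def curvature {𝔤 : LieSubalgebra ℝ Mat33} (θ : OneForm X d 𝔤) (u : X)
    (v w : TangentSpace (𝓡 d) u) : Mat33 :=
  Matrix.of (fun i j => dOneForm (fun x z => (θ x z : Mat33) i j) u v w) +
    ⁅(θ u v : Mat33), (θ u w : Mat33)⁆

/-- The curvature function `κ(u)(A, B) = K(θ_u⁻¹ A, θ_u⁻¹ B)`. -/
def curvatureFunction {𝔤 : LieSubalgebra ℝ Mat33} (θ : OneForm X d 𝔤) (u : X) (A B : 𝔤) : Mat33 :=
  curvature θ u (Function.invFun (θ u) A) (Function.invFun (θ u) B)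

/-- `A₁, …, Aₙ ∈ 𝔤` induce a basis of `𝔤/𝔭`, and `Z₁, …, Zₙ ∈ 𝔭₊ = 𝔭^⊥ ≅ (𝔤/𝔭)*` are the dual
basis, with respect to the Killing form. -/
structure IsDualFrame (𝔪 : Model) {n : ℕ} (A Z : Fin n → 𝔪.alg) : Prop where
  linearIndependent : LinearIndependent ℝ (fun i => 𝔪.parabolicAlg.mkQ (A i))
  span_eq_top : Submodule.span ℝ (Set.range fun i => 𝔪.parabolicAlg.mkQ (A i)) = ⊤
  mem_nilradical : ∀ i, ∀ Y ∈ 𝔪.parabolicAlg, killingForm ℝ 𝔪.alg Y (Z i) = 0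
  dual : ∀ i j, killingForm ℝ 𝔪.alg (A i) (Z j) = if i = j then 1 else 0

/-- The Kostant codifferential
`(∂* κ)(B) = 2 ∑ᵢ [κ(Aᵢ, B), Zᵢ] + ∑ᵢ κ(Aᵢ, [Zᵢ, B])` of a two-cochain `κ`. -/
def codifferential {𝔤 : LieSubalgebra ℝ Mat33} {n : ℕ} (A Z : Fin n → 𝔤) (κ : 𝔤 → 𝔤 → Mat33)
    (B : 𝔤) : Mat33 :=
  (2 : ℝ) • ∑ i, ⁅κ (A i) B, (Z i : Mat33)⁆ + ∑ i, κ (A i) ⁅Z i, B⁆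

/-- Normality: `∂* κ = 0`. The codifferential does not depend on the pair of dual bases. -/
def IsNormal (𝔪 : Model) (θ : OneForm X d 𝔪.alg) : Prop :=
  ∀ (n : ℕ) (A Z : Fin n → 𝔪.alg), IsDualFrame 𝔪 A Z →
    ∀ (u : X) (B : 𝔪.alg), codifferential A Z (curvatureFunction θ u) B = 0

/-! ### Tractor connections -/

/-- A smooth representation of `Spin(3,3)` on `V`, with its derivative, a representation of
`so(3,3)`. -/
structure SmoothRep (V : Type*) [NormedAddCommGroup V] [NormedSpace ℝ V] where
  toHom : Spin33 →* Module.End ℝ V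
  deriv : conformal.alg →ₗ[ℝ] Module.End ℝ V
  smooth : ∀ (k : ℕ) (γ : EuclideanSpace ℝ (Fin k) → Spin33),
    SmoothIntoSpinOn (𝓡 k) γ Set.univ → ∀ x, ContDiff ℝ ∞ (fun t => toHom (γ t) x)
  hasDerivAt : ∀ γ : ℝ → Spin33, SmoothIntoSpinOn 𝓘(ℝ, ℝ) γ Set.univ → γ 0 = 1 →
    ∀ Y : conformal.alg, (∀ i j, HasDerivAt (fun t => rho (γ t) i j) ((Y : Mat33) i j) 0) →
      ∀ x, HasDerivAt (fun t => toHom (γ t) x) (deriv Y x) 0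

variable {V : Type*} [NormedAddCommGroup V] [NormedSpace ℝ V]

/-- Smooth sections of the tractor bundle `X ×_{P̃} V`, as smooth equivariant functions. -/
structure IsTractorSection (act : X → conformal.parabolic → X) (τ : SmoothRep V)
    (s : X → V) : Prop where
  smooth : ContMDiff (𝓡 d) 𝓘(ℝ, V) ∞ s
  equivariant : ∀ u p, s (act u p) = τ.toHom (p : Spin33)⁻¹ (s u)

/-- The tractor connection induced by `θ`: for a section `s`, viewed as an equivariant function,
and a tangent vector `v` of `X` at `u`, the value at `u` of the covariant derivative of `s` in the
direction of the projection of `v` to the base is `ds(v) + θ(v) · s(u)`. -/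
def tractorConnection (τ : SmoothRep V) (θ : OneForm X d conformal.alg) (s : X → V)
    (u : X) (v : TangentSpace (𝓡 d) u) : V :=
  let ds : V := mfderiv (𝓡 d) 𝓘(ℝ, V) s u v
  ds + τ.deriv (θ u v) (s u)

/-- Smooth automorphisms of a principal bundle that cover the identity of the base. -/
structure IsGaugeTransformation {H : Subgroup Spin33} (act : X → H → X) (π : X → M)
    (Φ : X → X) : Prop where
  smooth : ContMDiff (𝓡 d) (𝓡 d) ∞ Φ
  equivariant : ∀ u h, Φ (act u h) = act (Φ u) h
  proj : ∀ u, π (Φ u) = π u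

end Bundles

/-! ### The Fefferman-type construction -/

section Construction

variable {𝒢 : Type*} (act : 𝒢 → projective.parabolic → 𝒢)

/-- The restriction to `Q` of a right action of `P`. -/
def actQ (u : 𝒢) (q : groupQ) : 𝒢 := act u (Subgroup.inclusion groupQ_le q)

/-- The correspondence space `M̃ = 𝒢 / Q`. -/
def FeffSpace : Type _ := Quot fun u u' : 𝒢 => ∃ q : groupQ, u' = actQ act u q

/-- The inclusion of `Q` in `P̃`. -/
def inclQ : groupQ →* conformal.parabolic := Subgroup.inclusion inf_le_right

/-- The extended bundle `𝒢̃ = 𝒢 ×_Q P̃`: the quotient of `𝒢 × P̃` by `(u, p) ∼ (u q, q⁻¹ p)`. -/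
def FeffBundle : Type _ :=
  Quot fun a b : 𝒢 × conformal.parabolic =>
    ∃ q : groupQ, b = (actQ act a.1 q, (inclQ q)⁻¹ * a.2)

/-- The projection `𝒢 → M̃`. -/
def toFeffSpace (u : 𝒢) : FeffSpace act := Quot.mk _ u

/-- The projection `𝒢̃ → M̃`. -/
def feffProj : FeffBundle act → FeffSpace act :=
  Quot.lift (fun a => toFeffSpace act a.1) (by
    rintro a b ⟨q, rfl⟩
    exact Quot.sound ⟨q, rfl⟩)

/-- The right action of `P̃` on `𝒢̃`. -/
def feffAct (x : FeffBundle act) (p : conformal.parabolic) : FeffBundle act :=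
  Quot.map (fun a => (a.1, a.2 * p)) (by
    rintro a b ⟨q, rfl⟩
    exact ⟨q, by rw [mul_assoc]⟩) x

/-- The canonical map `𝒢 → 𝒢̃`, `u ↦ [u, 1]`. -/
def feffIncl (u : 𝒢) : FeffBundle act := Quot.mk _ (u, 1)

variable [TopologicalSpace 𝒢] [ChartedSpace (EuclideanSpace ℝ (Fin 8)) 𝒢]
  [TopologicalSpace (FeffSpace act)] [ChartedSpace (EuclideanSpace ℝ (Fin 4)) (FeffSpace act)]
  [TopologicalSpace (FeffBundle act)] [ChartedSpace (EuclideanSpace ℝ (Fin 15)) (FeffBundle act)]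

/-- The given manifold structures on the quotients `M̃ = 𝒢 / Q` and `𝒢̃ = 𝒢 ×_Q P̃` are the
canonical ones: the unique manifold structures for which `𝒢 → M̃` is a smooth principal `Q`-bundle,
`𝒢̃ → M̃` is a smooth principal `P̃`-bundle and `𝒢 → 𝒢̃` is smooth. -/
structure IsCanonicalStructure : Prop where
  base : IsPrincipalBundle (d := 8) (m := 4) groupQ (actQ act) (toFeffSpace act)
  bundle : IsPrincipalBundle (d := 15) (m := 4) conformal.parabolic (feffAct act) (feffProj act)
  smooth_incl : ContMDiff (𝓡 8) (𝓡 15) ∞ (feffIncl act)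

/-- `θ̃` is a Cartan connection on `𝒢̃` that restricts to `θ` on `𝒢`. -/
structure IsExtension [IsManifold (𝓡 15) ∞ (FeffBundle act)] (θ : OneForm 𝒢 8 projective.alg)
    (θ' : OneForm (FeffBundle act) 15 conformal.alg) : Prop where
  cartan : IsCartanConnection conformal (feffAct act) θ'
  restrict : ∀ (u : 𝒢) (v : TangentSpace (𝓡 8) u),
    (θ' (feffIncl act u) (mfderiv (𝓡 8) (𝓡 15) (feffIncl act) u v) : Mat33) = (θ u v : Mat33)

end Construction

end Fefferman

/-!
# The Fefferman-type extension of two-dimensional projective structures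

Write `[u, p]` for the points of `𝒢̃ = 𝒢 ×_Q P̃`. The argument has three parts.

*Extension.* Locally, a smooth family in `𝒢̃` is of the form `[c, h]` with smooth families `c` in `𝒢`
and `h` in `P̃`. Equivariance and the reproduction of fundamental vector fields combine to the
Leibniz rule `θ̃(d[c, h]) = Ad(h⁻¹) θ(dc) + h⁻¹ dh` (`IsCartanConnection.leibniz`), which determines
`θ̃` (`IsExtension.isLiftForm`). Conversely, the right-hand side defines a Cartan connection: two
representatives of a family differ by a family in `Q ⊆ P`, to which the Leibniz rule for `θ` applies
(`IsLocalLift.liftForm_eq`), and the form is an isomorphism on each tangent space because it is onto,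
by `so(3,3) = sl(3) + 𝔭̃`, and `dim 𝒢̃ = 15` (`IsLiftForm.surjective`, `IsLiftForm.isExtension`).

*Normality of the extension.* The curvature of a Cartan connection is horizontal
(`IsCartanConnection.curvMat_vertical`). Hence the codifferential reduces to the contraction
`2 ∑ᵢ [κ(Aᵢ, B), Zᵢ]`, as `[𝔭̃₊, so(3,3)] ⊆ 𝔭̃`, and this contraction may be computed in any frame
(`IsDualFrame.codifferential_eq`) and, by equivariance, at any point of each fibre
(`IsCartanConnection.isNormal_of_section`). At a point of `𝒢` a frame in `sl(3)` is used, on which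
the curvature is that of `θ` by naturality of the exterior derivative. Over a surface, normality of
`θ` says that the curvature commutes with `𝔭₊`, so that it has values in `𝔭₊`
(`IsCartanConnection.curv_projA_mulVec`); these values commute with the elements of `𝔭̃₊` that they
are contracted with (`IsExtension.isNormal`).

*Uniqueness of normal connections.* Let `θ'` be another normal connection with `θ' - θ̃` in `𝔭̃`.
Its soldering form `θ' ṽ₊` modulo multiples of `ṽ₊` is that of `θ̃`. Let `w(x) ∈ ṽ₊^⊥` be the vector
with `(θ' - θ̃)(v) ṽ₊ = h(w, θ̃(v) ṽ₊) ṽ₊`. The gauge transformation `x ↦ x · (1 + ṽ₊ w(x))`, with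
values in the unipotent radical of `P̃`, turns `θ'` into a normal connection for which the difference
to `θ̃` kills `ṽ₊`. Two such normal connections are equal (`IsCartanConnection.eq_of_isNormal`):

* normality forces the torsion to vanish (`mulVec_vTilde_of_sum_lie_eq_zero`);
* torsion-freeness makes the difference symmetric in two arguments, and it is skew in two arguments,
  so that it has values in `𝔭̃₊` (`eq_zero_of_symm_of_skew`);
* the difference of the two normality conditions is then an algebraic equation of Ricci type for a
  `4 × 4` matrix `R`, which has only the trivial solution (`wedge_eq_zero_of_sum_lie_eq_zero`).

The gauge transformation identifies the tractor connections by the chain rule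
(`tractorConnection_gauge`).
-/

namespace Fefferman

/-! ### The spin group and the double covering -/

instance finite_cl33 : Module.Finite ℝ Cl33 := by
  have : Module.Finite ℝ (ExteriorAlgebra ℝ Vec33) :=
    Module.Finite.of_basis (Pi.basisFun ℝ (Fin 3 ⊕ₗ Fin 3)).ExteriorAlgebra
  exact Module.Finite.equiv (CliffordAlgebra.equivExterior Q33).symm

/-- The bilinear form `h` of signature `(3,3)`, for which `v w + w v = h(v, w)` in `Cl33`. -/
def hForm (v w : Vec33) : ℝ := fComp v ⬝ᵥ eComp w + fComp w ⬝ᵥ eComp v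

lemma hForm_comm (v w : Vec33) : hForm v w = hForm w v := add_comm _ _

lemma hForm_add_left (u v w : Vec33) : hForm (u + v) w = hForm u w + hForm v w := by
  simp [hForm]; ring

lemma hForm_smul_left (c : ℝ) (v w : Vec33) : hForm (c • v) w = c * hForm v w := by
  simp [hForm]; ring

lemma hForm_add_right (u v w : Vec33) : hForm u (v + w) = hForm u v + hForm u w := by
  simp [hForm]; ring

lemma hForm_smul_right (c : ℝ) (v w : Vec33) : hForm v (c • w) = c * hForm v w := by
  simp [hForm]; ring

/-- The form `h` as a bilinear map. -/
def hBilin : Vec33 →ₗ[ℝ] Vec33 →ₗ[ℝ] ℝ :=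
  LinearMap.mk₂ ℝ hForm hForm_add_left hForm_smul_left hForm_add_right hForm_smul_right

lemma hForm_sub_left (u v w : Vec33) : hForm (u - v) w = hForm u w - hForm v w :=
  LinearMap.map_sub₂ hBilin u v w

lemma hForm_sub_right (u v w : Vec33) : hForm u (v - w) = hForm u v - hForm u w :=
  (hBilin u).map_sub v w

lemma hForm_zero_left (w : Vec33) : hForm 0 w = 0 := LinearMap.map_zero₂ hBilin w

lemma hForm_zero_right (w : Vec33) : hForm w 0 = 0 := (hBilin w).map_zero

lemma hForm_sum_left {ι : Type*} (s : Finset ι) (f : ι → Vec33) (w : Vec33) :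
    hForm (∑ i ∈ s, f i) w = ∑ i ∈ s, hForm (f i) w := LinearMap.map_sum₂ hBilin s f w

lemma hForm_sum_right {ι : Type*} (s : Finset ι) (f : ι → Vec33) (w : Vec33) :
    hForm w (∑ i ∈ s, f i) = ∑ i ∈ s, hForm w (f i) := map_sum (hBilin w) f s

lemma Q33_apply (v : Vec33) : Q33 v = fComp v ⬝ᵥ eComp v := rfl

lemma hForm_self (v : Vec33) : hForm v v = 2 * Q33 v := by
  rw [Q33_apply, hForm]; ring

lemma polar_Q33 (v w : Vec33) : QuadraticMap.polar Q33 v w = hForm v w := by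
  simp only [QuadraticMap.polar, Q33_apply, hForm, map_add, add_dotProduct, dotProduct_add]
  ring

lemma ι_mul_ι (v w : Vec33) :
    CliffordAlgebra.ι Q33 v * CliffordAlgebra.ι Q33 w =
      algebraMap ℝ Cl33 (hForm v w) - CliffordAlgebra.ι Q33 w * CliffordAlgebra.ι Q33 v := by
  rw [eq_sub_iff_add_eq, CliffordAlgebra.ι_mul_ι_add_swap, polar_Q33]

lemma eComp_apply (v : Vec33) (i : Fin 3) : eComp v i = v (Sum.inl i) := rfl

lemma fComp_apply (v : Vec33) (i : Fin 3) : fComp v i = v (Sum.inr i) := rfl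

lemma hForm_eq_zero_left {v : Vec33} (h : ∀ w, hForm v w = 0) : v = 0 := by
  ext (i | i)
  · have := h (Pi.single (Sum.inr i) 1)
    simpa [hForm, dotProduct, eComp_apply, fComp_apply, Pi.single_apply] using this
  · have := h (Pi.single (Sum.inl i) 1)
    simpa [hForm, dotProduct, eComp_apply, fComp_apply, Pi.single_apply] using this

lemma coe_inv_spin (g : Spin33) : ((g⁻¹ : Spin33) : Cl33) = star (g : Cl33) := rfl

lemma hForm_vectorAct (g : Spin33) (v w : Vec33) :
    hForm (vectorAct g v) (vectorAct g w) = hForm v w := by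
  have h1 := CliffordAlgebra.ι_mul_ι_add_swap (Q := Q33) (vectorAct g v) (vectorAct g w)
  have h2 := CliffordAlgebra.ι_mul_ι_add_swap (Q := Q33) v w
  have hi : ((g⁻¹ : Spin33) : Cl33) * (g : Cl33) = 1 := congrArg Subtype.val (inv_mul_cancel g)
  have hi' : (g : Cl33) * ((g⁻¹ : Spin33) : Cl33) = 1 := congrArg Subtype.val (mul_inv_cancel g)
  have key : ∀ x y : Cl33, (g : Cl33) * x * ((g⁻¹ : Spin33) : Cl33) *
      ((g : Cl33) * y * ((g⁻¹ : Spin33) : Cl33)) = g * (x * y) * ((g⁻¹ : Spin33) : Cl33) := by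
    intro x y
    calc _ = (g : Cl33) * x * (((g⁻¹ : Spin33) : Cl33) * g) * y * ((g⁻¹ : Spin33) : Cl33) := by
          simp only [mul_assoc]
      _ = _ := by rw [hi]; simp only [mul_assoc, one_mul]
  rw [ι_vectorAct, ι_vectorAct, key, key, ← add_mul, ← mul_add, h2, ← Algebra.commutes, mul_assoc,
    hi', mul_one, polar_Q33, polar_Q33] at h1
  exact ((algebraMap ℝ Cl33).injective h1).symm

lemma rho_inv_mul (g : Spin33) : rho g⁻¹ * rho g = 1 := by rw [← map_mul]; simp

lemma rho_mul_inv (g : Spin33) : rho g * rho g⁻¹ = 1 := by rw [← map_mul]; simp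

lemma rho_inv_mulVec_mulVec (g : Spin33) (v : Vec33) : rho g⁻¹ *ᵥ (rho g *ᵥ v) = v := by
  rw [Matrix.mulVec_mulVec, rho_inv_mul, Matrix.one_mulVec]

lemma rho_mulVec_inv_mulVec (g : Spin33) (v : Vec33) : rho g *ᵥ (rho g⁻¹ *ᵥ v) = v := by
  rw [Matrix.mulVec_mulVec, rho_mul_inv, Matrix.one_mulVec]

lemma hForm_rho (g : Spin33) (v w : Vec33) : hForm (rho g *ᵥ v) (rho g *ᵥ w) = hForm v w := by
  rw [rho_mulVec, rho_mulVec, hForm_vectorAct]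

lemma hForm_rho_inv (g : Spin33) (v w : Vec33) :
    hForm (rho g⁻¹ *ᵥ v) w = hForm v (rho g *ᵥ w) := by
  rw [← hForm_rho g, rho_mulVec_inv_mulVec]

/-! ### Smooth maps into the spin group -/

section SmoothMaps

variable {E : Type*} [NormedAddCommGroup E] [NormedSpace ℝ E] {H N : Type*}
    [TopologicalSpace H] {I : ModelWithCorners ℝ E H} [TopologicalSpace N] [ChartedSpace H N]
    {s : Set N}

/-- Smoothness on `s` of a map into the finite-dimensional space `Cl33`, tested on functionals. -/
def SmoothClOn (I : ModelWithCorners ℝ E H) (f : N → Cl33) (s : Set N) : Prop :=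
  ∀ φ : Module.Dual ℝ Cl33, ContMDiffOn I 𝓘(ℝ, ℝ) ∞ (fun x => φ (f x)) s

lemma SmoothClOn.bilin {f g : N → Cl33} (hf : SmoothClOn I f s) (hg : SmoothClOn I g s)
    (B : Cl33 →ₗ[ℝ] Cl33 →ₗ[ℝ] ℝ) : ContMDiffOn I 𝓘(ℝ, ℝ) ∞ (fun x => B (f x) (g x)) s := by
  let b := Module.finBasis ℝ Cl33
  have h : ∀ x, B (f x) (g x) = ∑ i, b.coord i (f x) * ∑ j, b.coord j (g x) * B (b i) (b j) := by
    intro x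
    conv_lhs => rw [← b.sum_repr (f x), ← b.sum_repr (g x)]
    simp only [map_sum, map_smul, LinearMap.sum_apply, LinearMap.smul_apply, smul_eq_mul,
      Module.Basis.coord_apply, Finset.mul_sum]
    rw [Finset.sum_comm]
    refine Finset.sum_congr rfl fun i _ => Finset.sum_congr rfl fun j _ => by ring
  simp only [h]
  refine contMDiffOn_finsetSum fun i _ => (hf _).mul
    (contMDiffOn_finsetSum fun j _ => (hg _).mul ?_)
  exact contMDiffOn_const

lemma SmoothClOn.mul {f g : N → Cl33} (hf : SmoothClOn I f s) (hg : SmoothClOn I g s) :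
    SmoothClOn I (fun x => f x * g x) s := fun φ =>
  hf.bilin hg ((LinearMap.mul ℝ Cl33).compr₂ φ)

lemma SmoothClOn.star {f : N → Cl33} (hf : SmoothClOn I f s) :
    SmoothClOn I (fun x => star (f x)) s := fun φ =>
  hf (φ ∘ₗ CliffordAlgebra.reverse ∘ₗ CliffordAlgebra.involute.toLinearMap)

lemma smoothClOn_const (x : Cl33) : SmoothClOn I (fun _ : N => x) s := fun _ => contMDiffOn_const

lemma SmoothIntoSpinOn.mul {f g : N → Spin33} (hf : SmoothIntoSpinOn I f s)
    (hg : SmoothIntoSpinOn I g s) : SmoothIntoSpinOn I (fun x => f x * g x) s :=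
  SmoothClOn.mul (f := fun x => (f x : Cl33)) hf hg

lemma SmoothIntoSpinOn.inv {f : N → Spin33} (hf : SmoothIntoSpinOn I f s) :
    SmoothIntoSpinOn I (fun x => (f x)⁻¹) s :=
  SmoothClOn.star (f := fun x => (f x : Cl33)) hf

lemma smoothIntoSpinOn_const (g : Spin33) : SmoothIntoSpinOn I (fun _ : N => g) s :=
  fun _ => contMDiffOn_const

lemma SmoothIntoSpinOn.mono {f : N → Spin33} (hf : SmoothIntoSpinOn I f s) {t : Set N}
    (h : t ⊆ s) : SmoothIntoSpinOn I f t := fun φ => (hf φ).mono h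

lemma SmoothIntoSpinOn.congr {f g : N → Spin33} (hf : SmoothIntoSpinOn I f s)
    (h : ∀ x ∈ s, g x = f x) : SmoothIntoSpinOn I g s :=
  fun φ => (hf φ).congr fun x hx => by rw [h x hx]

lemma SmoothIntoSpinOn.comp {E' : Type*} [NormedAddCommGroup E'] [NormedSpace ℝ E'] {H' N' : Type*}
    [TopologicalSpace H'] {I' : ModelWithCorners ℝ E' H'} [TopologicalSpace N']
    [ChartedSpace H' N'] {t : Set N'} {f : N → Spin33} (hf : SmoothIntoSpinOn I f s) {c : N' → N}
    (hc : ContMDiffOn I' I ∞ c t) (h : Set.MapsTo c t s) :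
    SmoothIntoSpinOn I' (fun x => f (c x)) t := fun φ => (hf φ).comp hc h

/-- The entries of the vector representation of a smooth map into the spin group are smooth. -/
lemma SmoothIntoSpinOn.rho_apply {f : N → Spin33} (hf : SmoothIntoSpinOn I f s)
    (i j : Fin 3 ⊕ Fin 3) : ContMDiffOn I 𝓘(ℝ, ℝ) ∞ (fun x => rho (f x) i j) s := by
  -- A linear functional on `Cl33` that reads off the `i`-th coordinate of a vector.
  obtain ⟨r, hr⟩ := (CliffordAlgebra.ι Q33).exists_leftInverse_of_injective
    (LinearMap.ker_eq_bot.2 ι33_injective)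
  have h : ∀ x, rho (f x) i j = (LinearMap.proj i ∘ₗ r : Module.Dual ℝ Cl33)
      ((f x : Cl33) * CliffordAlgebra.ι Q33 (Pi.single j 1) * ((f x)⁻¹ : Spin33)) := by
    intro x
    have hr' : ∀ v, r (CliffordAlgebra.ι Q33 v) = v := LinearMap.congr_fun hr
    rw [← ι_vectorAct, LinearMap.comp_apply, hr', ← rho_mulVec]
    simp
  simp only [h]
  exact ((SmoothClOn.mul (f := fun x => (f x : Cl33)) hf (smoothClOn_const _)).mul hf.inv) _

end SmoothMaps

/-! ### Derivatives of maps between manifolds, in coordinates -/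

section Derivatives

variable {E E' E'' : Type*} [NormedAddCommGroup E] [NormedSpace ℝ E]
  [NormedAddCommGroup E'] [NormedSpace ℝ E'] [NormedAddCommGroup E''] [NormedSpace ℝ E'']
  {N N' N'' : Type*} [TopologicalSpace N] [ChartedSpace E N] [TopologicalSpace N']
  [ChartedSpace E' N'] [TopologicalSpace N''] [ChartedSpace E'' N'']

variable (E E') in
/-- The manifold derivative, with the tangent spaces identified with the model spaces (as they are
by definition), which keeps base points out of the types. -/
def mD (f : N → N') (n : N) : E →L[ℝ] E' := mfderiv 𝓘(ℝ, E) 𝓘(ℝ, E') f n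

lemma mD_congr {f g : N → N'} {n : N} (h : f =ᶠ[nhds n] g) : mD E E' f n = mD E E' g n :=
  h.mfderiv_eq

lemma mD_congr_on {f g : N → N'} {n : N} {U : Set N} (hU : IsOpen U) (hn : n ∈ U)
    (h : ∀ y ∈ U, f y = g y) : mD E E' f n = mD E E' g n :=
  mD_congr (Filter.eventuallyEq_of_mem (hU.mem_nhds hn) h)

lemma mdiffAt_of_on {f : N → N'} {U : Set N} (hf : ContMDiffOn 𝓘(ℝ, E) 𝓘(ℝ, E') ∞ f U)
    (hU : IsOpen U) {n : N} (hn : n ∈ U) : MDifferentiableAt 𝓘(ℝ, E) 𝓘(ℝ, E') f n :=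
  (hf.contMDiffAt (hU.mem_nhds hn)).mdifferentiableAt (by simp)

lemma mD_comp {f : N → N'} {g : N' → N''} {n : N}
    (hg : MDifferentiableAt 𝓘(ℝ, E') 𝓘(ℝ, E'') g (f n))
    (hf : MDifferentiableAt 𝓘(ℝ, E) 𝓘(ℝ, E') f n) (v : E) :
    mD E E'' (fun y => g (f y)) n v = mD E' E'' g (f n) (mD E E' f n v) :=
  mfderiv_comp_apply n hg hf v

lemma mD_const (n : N) (x : N') (v : E) : mD E E' (fun _ : N => x) n v = 0 := by
  unfold mD
  rw [mfderiv_const]; rfl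

lemma mD_id (n : N) (v : E) : mD E E (fun y : N => y) n v = v := by
  unfold mD
  change mfderiv 𝓘(ℝ, E) 𝓘(ℝ, E) id n v = v
  rw [mfderiv_id]; rfl

lemma mD_eq_fderiv (f : E → E') (x : E) : mD E E' f x = fderiv ℝ f x := mfderiv_eq_fderiv

lemma mD_mul {f g : N → ℝ} {n : N} (hf : MDifferentiableAt 𝓘(ℝ, E) 𝓘(ℝ, ℝ) f n)
    (hg : MDifferentiableAt 𝓘(ℝ, E) 𝓘(ℝ, ℝ) g n) (v : E) :
    mD E ℝ (fun y => f y * g y) n v = f n * mD E ℝ g n v + mD E ℝ f n v * g n := by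
  have := (hf.hasMFDerivAt.mul' hg.hasMFDerivAt).mfderiv
  unfold mD
  change mfderiv 𝓘(ℝ, E) 𝓘(ℝ, ℝ) (f * g) n v = _
  rw [this]
  rfl

lemma mD_sum {ι : Type*} {s : Finset ι} {f : ι → N → ℝ} {n : N}
    (hf : ∀ i ∈ s, MDifferentiableAt 𝓘(ℝ, E) 𝓘(ℝ, ℝ) (f i) n) (v : E) :
    mD E ℝ (fun y => ∑ i ∈ s, f i y) n v = ∑ i ∈ s, mD E ℝ (f i) n v := by
  classical
  have key : MDifferentiableAt 𝓘(ℝ, E) 𝓘(ℝ, ℝ) (fun y => ∑ i ∈ s, f i y) n ∧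
      mD E ℝ (fun y => ∑ i ∈ s, f i y) n v = ∑ i ∈ s, mD E ℝ (f i) n v := by
    induction s using Finset.induction_on with
    | empty => simpa using ⟨mdifferentiableAt_const, mD_const (E' := ℝ) n (0 : ℝ) v⟩
    | insert a s ha ih =>
      obtain ⟨h1, h2⟩ := ih fun i hi => hf i (Finset.mem_insert_of_mem hi)
      have h3 := hf a (Finset.mem_insert_self a s)
      simp only [Finset.sum_insert ha]
      refine ⟨h3.add h1, ?_⟩
      rw [← h2]
      have := (h3.hasMFDerivAt.add h1.hasMFDerivAt).mfderiv
      unfold mD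
      change mfderiv 𝓘(ℝ, E) 𝓘(ℝ, ℝ) (f a + fun y => ∑ i ∈ s, f i y) n v = _
      rw [this]
      rfl
  exact key.2

variable (E) in
/-- The entrywise derivative of a matrix-valued map. -/
def mDMat (F : N → Mat33) (n : N) (v : E) : Mat33 :=
  Matrix.of fun i j => mD E ℝ (fun y => F y i j) n v

variable (E) in
/-- Entrywise smoothness of a matrix-valued map. -/
def SmoothMatOn (F : N → Mat33) (U : Set N) : Prop :=
  ∀ i j, ContMDiffOn 𝓘(ℝ, E) 𝓘(ℝ, ℝ) ∞ (fun y => F y i j) U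

variable (E) in
/-- Entrywise differentiability of a matrix-valued map. -/
def DiffMatAt (F : N → Mat33) (n : N) : Prop :=
  ∀ i j, MDifferentiableAt 𝓘(ℝ, E) 𝓘(ℝ, ℝ) (fun y => F y i j) n

lemma SmoothMatOn.diffMatAt {F : N → Mat33} {U : Set N} (hF : SmoothMatOn E F U)
    (hU : IsOpen U) {n : N} (hn : n ∈ U) : DiffMatAt E F n :=
  fun i j => mdiffAt_of_on (hF i j) hU hn

lemma mDMat_mul {F G : N → Mat33} {n : N} (hF : DiffMatAt E F n)
    (hG : DiffMatAt E G n) (v : E) :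
    mDMat E (fun y => F y * G y) n v = F n * mDMat E G n v + mDMat E F n v * G n := by
  ext i j
  simp only [mDMat, Matrix.of_apply, Matrix.mul_apply, Matrix.add_apply]
  rw [mD_sum (f := fun k y => F y i k * G y k j) (fun k _ => (hF i k).mul (hG k j)),
    ← Finset.sum_add_distrib]
  exact Finset.sum_congr rfl fun k _ => mD_mul (hF i k) (hG k j) v

lemma DiffMatAt.mul {F G : N → Mat33} {n : N} (hF : DiffMatAt E F n)
    (hG : DiffMatAt E G n) : DiffMatAt E (fun y => F y * G y) n := by
  intro i j
  simp only [Matrix.mul_apply]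
  have : ∀ s : Finset (Fin 3 ⊕ Fin 3), MDifferentiableAt 𝓘(ℝ, E) 𝓘(ℝ, ℝ)
      (fun y => ∑ k ∈ s, F y i k * G y k j) n := by
    classical
    intro s
    induction s using Finset.induction_on with
    | empty => simpa using mdifferentiableAt_const
    | insert a s ha ih =>
      simp only [Finset.sum_insert ha]
      exact ((hF i a).mul (hG a j)).add ih
  exact this _

lemma diffMatAt_const (A : Mat33) (n : N) : DiffMatAt E (fun _ : N => A) n :=
  fun _ _ => mdifferentiableAt_const

lemma mDMat_const (A : Mat33) (n : N) (v : E) : mDMat E (fun _ : N => A) n v = 0 := by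
  ext i j
  exact mD_const n _ v

lemma mDMat_congr_on {F G : N → Mat33} {n : N} {U : Set N} (hU : IsOpen U) (hn : n ∈ U)
    (h : ∀ y ∈ U, F y = G y) (v : E) : mDMat E F n v = mDMat E G n v := by
  ext i j
  simp only [mDMat, Matrix.of_apply]
  rw [mD_congr_on hU hn fun y hy => by rw [h y hy]]

lemma mDMat_comp {F : N' → Mat33} {f : N → N'} {n : N} (hF : DiffMatAt E' F (f n))
    (hf : MDifferentiableAt 𝓘(ℝ, E) 𝓘(ℝ, E') f n) (v : E) :
    mDMat E (fun y => F (f y)) n v = mDMat E' F (f n) (mD E E' f n v) := by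
  ext i j
  exact mD_comp (hF i j) hf v

lemma mDMat_add (F : N → Mat33) (n : N) (v w : E) :
    mDMat E F n (v + w) = mDMat E F n v + mDMat E F n w := by
  ext i j; simp [mDMat]

lemma mDMat_smul (F : N → Mat33) (n : N) (c : ℝ) (v : E) :
    mDMat E F n (c • v) = c • mDMat E F n v := by
  ext i j; simp [mDMat]

/-- The derivative of the vector-valued map `y ↦ F(y) a`. -/
lemma mDMat_mulVec {F : N → Mat33} {n : N} (hF : DiffMatAt E F n) (a : Vec33) (v : E)
    (i : Fin 3 ⊕ Fin 3) : (mDMat E F n v *ᵥ a) i = mD E ℝ (fun y => (F y *ᵥ a) i) n v := by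
  simp only [Matrix.mulVec, dotProduct]
  rw [mD_sum (f := fun k y => F y i k * a k) fun k _ => (hF i k).mul mdifferentiableAt_const]
  refine Finset.sum_congr rfl fun k _ => ?_
  rw [mD_mul (hF i k) mdifferentiableAt_const, mD_const]
  simp [mDMat]

end Derivatives

/-! ### Curves and charts -/

section Curves

variable {E : Type*} [NormedAddCommGroup E] [NormedSpace ℝ E]
  {N : Type*} [TopologicalSpace N] [ChartedSpace E N]

lemma isOpen_chart_preimage {U : Set N} (hU : IsOpen U) (n : N) :
    IsOpen ((extChartAt 𝓘(ℝ, E) n).target ∩ (extChartAt 𝓘(ℝ, E) n).symm ⁻¹' U) :=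
  (continuousOn_extChartAt_symm n).isOpen_inter_preimage (isOpen_extChartAt_target n) hU

variable [IsManifold 𝓘(ℝ, E) ∞ N]

lemma mD_chart_symm (n : N) (v : E) :
    mD E E (extChartAt 𝓘(ℝ, E) n).symm (extChartAt 𝓘(ℝ, E) n n) v = v := by
  have : IsManifold 𝓘(ℝ, E) 1 N := IsManifold.of_le (n := ∞) (by simp)
  have h := mfderivWithin_range_extChartAt_symm (I := 𝓘(ℝ, E)) (x := n)
  simp only [ModelWithCorners.range_eq_univ, mfderivWithin_univ] at h
  unfold mD
  rw [h]
  rfl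

/-- Every tangent vector at a point of an open set is the velocity of a smooth curve that is defined
on all of `ℝ` and stays in the open set. -/
lemma exists_curve {U : Set N} (hU : IsOpen U) {n : N} (hn : n ∈ U) (v : E) :
    ∃ η : ℝ → N, ContMDiff 𝓘(ℝ, ℝ) 𝓘(ℝ, E) ∞ η ∧ (∀ t, η t ∈ U) ∧ η 0 = n ∧
      mD ℝ E η 0 (1 : ℝ) = v := by
  set φ := extChartAt 𝓘(ℝ, E) n with hφ
  have hs := isOpen_chart_preimage (E := E) hU n
  have hmem : φ n ∈ φ.target ∩ φ.symm ⁻¹' U :=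
    ⟨mem_extChartAt_target n, by simpa [hφ, extChartAt_to_inv] using hn⟩
  obtain ⟨r, hr, hball⟩ := Metric.isOpen_iff.1 hs _ hmem
  -- The bounded reparametrisation `δ sin(t / δ)` of the line keeps the curve inside the chart.
  obtain ⟨δ, hδ, hδr⟩ : ∃ δ : ℝ, 0 < δ ∧ δ * ‖v‖ < r := by
    refine ⟨r / (‖v‖ + 1), by positivity, ?_⟩
    rw [div_mul_eq_mul_div, div_lt_iff₀ (by positivity)]
    nlinarith [norm_nonneg v]
  let ℓ : ℝ → E := fun t => φ n + (δ * Real.sin (t / δ)) • v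
  have hℓ : ContDiff ℝ ∞ ℓ := by
    refine contDiff_const.add ((contDiff_const.mul (Real.contDiff_sin.comp ?_)).smul contDiff_const)
    exact contDiff_id.div_const δ
  have hℓm : ∀ t, ℓ t ∈ φ.target ∩ φ.symm ⁻¹' U := by
    intro t
    apply hball
    rw [mem_ball_iff_norm, add_sub_cancel_left, norm_smul, norm_mul, Real.norm_eq_abs,
      Real.norm_eq_abs, abs_of_pos hδ]
    calc δ * |Real.sin (t / δ)| * ‖v‖ ≤ δ * 1 * ‖v‖ := by
          gcongr; exact Real.abs_sin_le_one _
      _ < r := by rwa [mul_one]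
  have h0 : ℓ 0 = φ n := by simp [ℓ]
  have hd : HasDerivAt ℓ v 0 := by
    have h1 : HasDerivAt (fun t : ℝ => δ * Real.sin (t / δ)) 1 0 := by
      have := (((hasDerivAt_id (0 : ℝ)).div_const δ).sin).const_mul δ
      simpa [hδ.ne'] using this
    simpa [ℓ] using (h1.smul_const v).const_add (φ n)
  have hsm : ContMDiffOn 𝓘(ℝ, E) 𝓘(ℝ, E) ∞ φ.symm φ.target := contMDiffOn_extChartAt_symm n
  refine ⟨fun t => φ.symm (ℓ t), ?_, fun t => (hℓm t).2, ?_, ?_⟩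
  · exact hsm.comp_contMDiff hℓ.contMDiff fun t => (hℓm t).1
  · simp only [h0]
    simp [hφ]
  · rw [mD_comp (E' := E) (N' := E) (f := ℓ) (g := φ.symm)
      (mdiffAt_of_on hsm (isOpen_extChartAt_target n) (hℓm 0).1)
      (hℓ.contMDiff.mdifferentiableAt (by simp)), h0, mD_chart_symm, mD_eq_fderiv,
      hd.hasFDerivAt.fderiv]
    simp

end Curves

/-- The model space of `d`-dimensional manifolds. -/
abbrev Euc (d : ℕ) : Type := EuclideanSpace ℝ (Fin d)

/-! ### Smooth families in a principal bundle -/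

section Principal

variable {d m : ℕ} {X M : Type*}
  [TopologicalSpace X] [ChartedSpace (Euc d) X]
  [TopologicalSpace M] [ChartedSpace (Euc m) M]
  {E : Type*} [NormedAddCommGroup E] [NormedSpace ℝ E]
  {N : Type*} [TopologicalSpace N] [ChartedSpace E N]
  {H : Subgroup Spin33} {act : X → H → X} {π : X → M}

/-- The action is smooth on families parametrised by any manifold. -/
lemma IsPrincipalBundle.contMDiffOn_act [FiniteDimensional ℝ E] [IsManifold 𝓘(ℝ, E) ∞ N]
    (hP : IsPrincipalBundle (d := d) (m := m) H act π)
    {U : Set N} (hU : IsOpen U) {c : N → X} {h : N → H}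
    (hc : ContMDiffOn 𝓘(ℝ, E) (𝓡 d) ∞ c U)
    (hh : SmoothIntoSpinOn 𝓘(ℝ, E) (fun y => (h y : Spin33)) U) :
    ContMDiffOn 𝓘(ℝ, E) (𝓡 d) ∞ (fun y => act (c y) (h y)) U := by
  intro n hn
  set φ := extChartAt 𝓘(ℝ, E) n with hφ
  let e := toEuclidean (E := E)
  let s : Set (EuclideanSpace ℝ (Fin (Module.finrank ℝ E))) :=
    e.symm ⁻¹' (φ.target ∩ φ.symm ⁻¹' U)
  have hs : IsOpen s := (isOpen_chart_preimage hU n).preimage e.symm.continuous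
  have hψ : ContMDiffOn (𝓡 (Module.finrank ℝ E)) 𝓘(ℝ, E) ∞ (fun z => φ.symm (e.symm z)) s :=
    (contMDiffOn_extChartAt_symm (I := 𝓘(ℝ, E)) n).comp e.symm.contDiff.contMDiff.contMDiffOn
      fun z hz => hz.1
  have hm : Set.MapsTo (fun z => φ.symm (e.symm z)) s U := fun z hz => hz.2
  have h1 := hP.smooth_act _ s _ (fun z => h (φ.symm (e.symm z))) hs (hc.comp hψ hm)
    (hh.comp hψ hm)
  have hV : IsOpen (U ∩ φ.source) := hU.inter (isOpen_extChartAt_source n)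
  have h2 : ContMDiffOn 𝓘(ℝ, E) (𝓡 (Module.finrank ℝ E)) ∞ (fun y => e (φ y)) (U ∩ φ.source) :=
    e.contDiff.contMDiff.comp_contMDiffOn
      ((contMDiffOn_extChartAt (I := 𝓘(ℝ, E)) (x := n)).mono fun y hy => by
        simpa [hφ] using hy.2)
  have h3 : ContMDiffOn 𝓘(ℝ, E) (𝓡 d) ∞ (fun y => act (c y) (h y)) (U ∩ φ.source) := by
    refine (h1.comp h2 ?_).congr ?_
    · intro y hy
      refine ⟨?_, ?_⟩ <;> simp only [e.symm_apply_apply]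
      · exact φ.map_source hy.2
      · change φ.symm (φ y) ∈ U
        rw [φ.left_inv hy.2]; exact hy.1
    · intro y hy
      simp only [Function.comp, e.symm_apply_apply, φ.left_inv hy.2]
  exact (h3.contMDiffAt (hV.mem_nhds ⟨hn, mem_extChartAt_source n⟩)).contMDiffWithinAt

/-- The quotient `h` of two smooth families `f` and `g = f · h` of points in the same fibres is
smooth. -/
lemma IsPrincipalBundle.smooth_div
    (hP : IsPrincipalBundle (d := d) (m := m) H act π)
    {U : Set N} (hU : IsOpen U) {f g : N → X} {h : N → H}
    (hf : ContMDiffOn 𝓘(ℝ, E) (𝓡 d) ∞ f U) (hg : ContMDiffOn 𝓘(ℝ, E) (𝓡 d) ∞ g U)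
    (hfg : ∀ y ∈ U, g y = act (f y) (h y)) :
    SmoothIntoSpinOn 𝓘(ℝ, E) (fun y => (h y : Spin33)) U := by
  intro φ n hn
  obtain ⟨V, σ, δ, hV, hxV, -, -, hδ, hσδ⟩ := hP.locally_trivial (π (f n))
  have hW : IsOpen (U ∩ (fun y => π (f y)) ⁻¹' V) :=
    (hP.smooth_proj.continuous.comp_continuousOn hf.continuousOn).isOpen_inter_preimage hU hV
  have hmf : Set.MapsTo f (U ∩ (fun y => π (f y)) ⁻¹' V) (π ⁻¹' V) := fun y hy => hy.2
  have hmg : Set.MapsTo g (U ∩ (fun y => π (f y)) ⁻¹' V) (π ⁻¹' V) := fun y hy => by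
    rw [Set.mem_preimage, hfg y hy.1, hP.proj_act]; exact hy.2
  have h1 := (hδ.comp (hf.mono Set.inter_subset_left) hmf).inv.mul
    (hδ.comp (hg.mono Set.inter_subset_left) hmg)
  refine (((h1.congr ?_) φ).contMDiffAt (hW.mem_nhds ⟨hn, hxV⟩)).contMDiffWithinAt
  intro y hy
  have e1 := hσδ (f y) (hmf hy)
  have e2 := hσδ (g y) (hmg hy)
  have e3 : π (g y) = π (f y) := by rw [hfg y hy.1, hP.proj_act]
  have e4 : act (σ (π (f y))) (δ (g y)) = act (σ (π (f y))) (δ (f y) * h y) := by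
    rw [hP.act_mul, ← e1, ← hfg y hy.1, ← e3, ← e2]
  have e5 := (hP.simply_transitive (σ (π (f y))) (act (σ (π (f y))) (δ (g y)))
    (hP.proj_act _ _).symm).unique rfl e4
  rw [e5]
  simp

lemma IsPrincipalBundle.act_injective (hP : IsPrincipalBundle (d := d) (m := m) H act π) {u : X}
    {h k : H} (e : act u h = act u k) : h = k :=
  (hP.simply_transitive u (act u h) (hP.proj_act _ _).symm).unique rfl e

lemma IsPrincipalBundle.contMDiff_act_right [IsManifold (𝓡 d) ∞ X]
    (hP : IsPrincipalBundle (d := d) (m := m) H act π) (h : H) :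
    ContMDiff (𝓡 d) (𝓡 d) ∞ (fun x => act x h) := by
  rw [← contMDiffOn_univ]
  exact hP.contMDiffOn_act isOpen_univ (c := fun x : X => x) (h := fun _ => h) contMDiffOn_id
    (smoothIntoSpinOn_const _)

lemma smoothIntoSpinOn_rho {U : Set N} {h : N → H}
    (hh : SmoothIntoSpinOn 𝓘(ℝ, E) (fun y => (h y : Spin33)) U) :
    SmoothMatOn E (fun y => rho (h y : Spin33)) U := fun i j => hh.rho_apply i j

end Principal

/-! ### Cartan connections along families -/

section Cartan

variable {d m : ℕ} {X M : Type*}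
  [TopologicalSpace X] [ChartedSpace (Euc d) X]
  [TopologicalSpace M] [ChartedSpace (Euc m) M]
  {E : Type*} [NormedAddCommGroup E] [NormedSpace ℝ E] [FiniteDimensional ℝ E]
  {N : Type*} [TopologicalSpace N] [ChartedSpace E N] [IsManifold 𝓘(ℝ, E) ∞ N]

/-- The matrix-valued one-form underlying a one-form with values in a matrix Lie algebra. -/
def OneForm.mat {𝔤 : LieSubalgebra ℝ Mat33} (θ : OneForm X d 𝔤) (u : X) :
    Euc d →ₗ[ℝ] Mat33 :=
  𝔤.toSubmodule.subtype ∘ₗ θ u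

variable {𝔪 : Model} {act : X → 𝔪.parabolic → X} {π : X → M} [IsManifold (𝓡 d) ∞ X]
  {θ : OneForm X d 𝔪.alg}

/-- The **Leibniz rule** for a Cartan connection along a family `c · h`:
`θ(d(c·h)) = Ad(h⁻¹) θ(dc) + h⁻¹ dh`. -/
lemma IsCartanConnection.leibniz (hP : IsPrincipalBundle (d := d) (m := m) 𝔪.parabolic act π)
    (hθ : IsCartanConnection 𝔪 act θ)
    {U : Set N} (hU : IsOpen U) {n : N} (hn : n ∈ U) {c : N → X} {h : N → 𝔪.parabolic}
    (hc : ContMDiffOn 𝓘(ℝ, E) (𝓡 d) ∞ c U)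
    (hh : SmoothIntoSpinOn 𝓘(ℝ, E) (fun y => (h y : Spin33)) U) (v : E) :
    θ.mat (act (c n) (h n)) (mD E (Euc d) (fun y => act (c y) (h y)) n v) =
      rho (h n : Spin33)⁻¹ * θ.mat (c n) (mD E (Euc d) c n v) *
        rho (h n : Spin33) +
      rho (h n : Spin33)⁻¹ * mDMat E (fun y => rho (h y : Spin33)) n v := by
  obtain ⟨η, hη, hηU, hη0, hηv⟩ := exists_curve hU hn v
  have hηd : MDifferentiableAt 𝓘(ℝ, ℝ) 𝓘(ℝ, E) η 0 := hη.mdifferentiableAt (by simp)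
  have hcη : ContMDiff 𝓘(ℝ, ℝ) (𝓡 d) ∞ (fun t => c (η t)) := hc.comp_contMDiff hη hηU
  have hhη : SmoothIntoSpinOn 𝓘(ℝ, ℝ) (fun t => (h (η t) : Spin33)) Set.univ :=
    hh.comp hη.contMDiffOn fun t _ => hηU t
  -- the two-parameter family `(s, t) ↦ c(η(s)) · h(η(t))`
  let f : ℝ × ℝ → X := fun p => act (c (η p.1)) (h (η p.2))
  have hf : ContMDiff 𝓘(ℝ, ℝ × ℝ) (𝓡 d) ∞ f := by
    rw [← contMDiffOn_univ]
    refine hP.contMDiffOn_act isOpen_univ (c := fun p : ℝ × ℝ => c (η p.1))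
      (h := fun p : ℝ × ℝ => h (η p.2)) ?_ ?_
    · exact (hcη.comp contDiff_fst.contMDiff).contMDiffOn
    · exact hhη.comp (contDiff_snd.contMDiff (n := ∞)).contMDiffOn fun _ _ => Set.mem_univ _
  have hfd : MDifferentiableAt 𝓘(ℝ, ℝ × ℝ) 𝓘(ℝ, Euc d) f (0, 0) :=
    hf.mdifferentiableAt (by simp)
  have line : ∀ w : ℝ × ℝ, mD ℝ (Euc d) (fun t : ℝ => f (t • w)) 0 (1 : ℝ) =
      mD (ℝ × ℝ) (Euc d) f (0, 0) w := by
    intro w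
    have hl : HasFDerivAt (fun t : ℝ => t • w) ((ContinuousLinearMap.id ℝ ℝ).smulRight w) 0 :=
      (ContinuousLinearMap.id ℝ ℝ).hasFDerivAt.smul_const w
    have h0 : (0 : ℝ) • w = (0, 0) := zero_smul ℝ w
    rw [mD_comp (E' := ℝ × ℝ) (N' := ℝ × ℝ) (f := fun t : ℝ => t • w) (by rw [h0]; exact hfd)
      hl.differentiableAt.mdifferentiableAt, h0, mD_eq_fderiv, hl.fderiv]
    simp
  have hdiag : mD ℝ (Euc d) (fun t : ℝ => act (c (η t)) (h (η t))) 0 (1 : ℝ) =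
      mD ℝ (Euc d) (fun t : ℝ => act (c (η t)) (h n)) 0 (1 : ℝ) +
      mD ℝ (Euc d) (fun t : ℝ => act (c n) (h (η t))) 0 (1 : ℝ) := by
    have h1 := line (1, 1)
    have h2 := line (1, 0)
    have h3 := line (0, 1)
    simp only [f, Prod.smul_mk, smul_eq_mul, mul_one, mul_zero, hη0] at h1 h2 h3
    rw [h1, h2, h3, ← map_add]
    simp
  have hsm := hP.contMDiffOn_act hU hc hh
  have hlhs : mD E (Euc d) (fun y => act (c y) (h y)) n v =
      mD ℝ (Euc d) (fun t : ℝ => act (c (η t)) (h (η t))) 0 (1 : ℝ) := by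
    rw [mD_comp (g := fun y => act (c y) (h y)) (by rw [hη0]; exact mdiffAt_of_on hsm hU hn) hηd,
      hη0, hηv]
  have hfirst : mD ℝ (Euc d) (fun t : ℝ => act (c (η t)) (h n)) 0 (1 : ℝ) =
      mD (Euc d) (Euc d) (fun x => act x (h n)) (c n)
        (mD E (Euc d) c n v) := by
    rw [mD_comp (g := fun x => act x (h n)) (f := fun t => c (η t))
      ((hP.contMDiff_act_right (h n)).mdifferentiableAt (by simp))
        (hcη.mdifferentiableAt (by simp)),
      mD_comp (g := c) (by rw [hη0]; exact mdiffAt_of_on hc hU hn) hηd, hη0, hηv]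
  rw [hlhs, hdiag, hfirst, map_add]
  congr 1
  · exact hθ.equivariant (h n) (c n) _
  · -- the second factor moves along a curve through `1` after translation by `h(n)⁻¹`
    let γ : ℝ → 𝔪.parabolic := fun t => (h n)⁻¹ * h (η t)
    have hγ : SmoothIntoSpinOn 𝓘(ℝ, ℝ) (fun t => (γ t : Spin33)) Set.univ :=
      (smoothIntoSpinOn_const _).mul hhη
    have hγ0 : γ 0 = 1 := by simp [γ, hη0]
    have hfun := hθ.fundamental γ hγ hγ0 (act (c n) (h n))
    have e1 : ∀ t, act (act (c n) (h n)) (γ t) = act (c n) (h (η t)) := by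
      intro t
      rw [← hP.act_mul, mul_inv_cancel_left]
    have e2 : act (act (c n) (h n)) (γ 0) = act (c n) (h n) := by rw [e1, hη0]
    have hR : SmoothMatOn ℝ (fun t : ℝ => rho (h (η t) : Spin33)) Set.univ :=
      smoothIntoSpinOn_rho hhη
    ext i j
    have h1 : HasDerivAt (fun t => rho (γ t : Spin33) i j) (θ.mat (act (act (c n) (h n)) (γ 0))
      (mD ℝ (Euc d) (fun t => act (act (c n) (h n)) (γ t)) 0 (1 : ℝ)) i j) 0 :=
      hfun i j
    simp only [e1, hη0] at h1
    have h2 : mDMat ℝ (fun t => rho (γ t : Spin33)) 0 (1 : ℝ) =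
        rho (h n : Spin33)⁻¹ * mDMat E (fun y => rho (h y : Spin33)) n v := by
      have : (fun t => rho (γ t : Spin33)) =
          fun t => rho (h n : Spin33)⁻¹ * rho (h (η t) : Spin33) := by
        funext t
        simp only [γ, Subgroup.coe_mul, Subgroup.coe_inv, map_mul]
      rw [this, mDMat_mul (diffMatAt_const _ _) (hR.diffMatAt isOpen_univ (Set.mem_univ 0)),
        mDMat_const, zero_mul, add_zero,
        mDMat_comp (F := fun y => rho (h y : Spin33)) (by
          rw [hη0]; exact (smoothIntoSpinOn_rho hh).diffMatAt hU hn) hηd, hη0, hηv]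
    rw [← h2]
    have h3 : mDMat ℝ (fun t => rho (γ t : Spin33)) 0 (1 : ℝ) i j =
        deriv (fun t => rho (γ t : Spin33) i j) 0 := by
      simp only [mDMat, Matrix.of_apply, mD_eq_fderiv]
      rfl
    rw [h3, h1.deriv]

end Cartan

/-! ### Naturality of the exterior derivative -/

section Exterior

/-- The derivative of `y ↦ G(F y, DF_y w)`, antisymmetrised: the second derivatives of `F`
cancel. -/
lemma fderiv_pullback_sub {E E' : Type*} [NormedAddCommGroup E] [NormedSpace ℝ E]
    [NormedAddCommGroup E'] [NormedSpace ℝ E'] {G : E' → E' →ₗ[ℝ] ℝ} {F : E → E'} {y : E}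
    (hG : ∀ b, DifferentiableAt ℝ (fun p : E' × E' => G p.1 p.2) (F y, b))
    (hF : ContDiffAt ℝ 2 F y) (v w : E) :
    fderiv ℝ (fun x => G (F x) (fderiv ℝ F x w)) y v -
        fderiv ℝ (fun x => G (F x) (fderiv ℝ F x v)) y w =
      fderiv ℝ (fun x => G x (fderiv ℝ F y w)) (F y) (fderiv ℝ F y v) -
        fderiv ℝ (fun x => G x (fderiv ℝ F y v)) (F y) (fderiv ℝ F y w) := by
  have hsymm : IsSymmSndFDerivAt ℝ F y := hF.isSymmSndFDerivAt (by simp)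
  have hFd : DifferentiableAt ℝ F y := hF.differentiableAt (by simp)
  have hF2 : DifferentiableAt ℝ (fderiv ℝ F) y :=
    (hF.fderiv_right (m := 1) (by norm_num)).differentiableAt (by simp)
  have key : ∀ v w : E, fderiv ℝ (fun x => G (F x) (fderiv ℝ F x w)) y v =
      fderiv ℝ (fun x => G x (fderiv ℝ F y w)) (F y) (fderiv ℝ F y v) +
        G (F y) (fderiv ℝ (fderiv ℝ F) y v w) := by
    intro v w
    set G' := fderiv ℝ (fun p : E' × E' => G p.1 p.2) (F y, fderiv ℝ F y w) with hG'
    have h1 : HasFDerivAt (fun p : E' × E' => G p.1 p.2) G' (F y, fderiv ℝ F y w) :=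
      (hG _).hasFDerivAt
    have h2 : HasFDerivAt (fun x => fderiv ℝ F x w)
        ((ContinuousLinearMap.apply ℝ E' w).comp (fderiv ℝ (fderiv ℝ F) y)) y :=
      (ContinuousLinearMap.apply ℝ E' w).hasFDerivAt.comp y hF2.hasFDerivAt
    have h3 := h1.comp y (hFd.hasFDerivAt.prodMk h2)
    have h4 : HasFDerivAt (fun x => G x (fderiv ℝ F y w))
        (G'.comp ((ContinuousLinearMap.id ℝ E').prod 0)) (F y) :=
      HasFDerivAt.comp (g := fun p : E' × E' => G p.1 p.2) (f := fun x => (x, fderiv ℝ F y w)) (F y)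
        h1 ((hasFDerivAt_id (F y)).prodMk (hasFDerivAt_const (fderiv ℝ F y w) (F y)))
    have h5 : ∀ b, G' (0, b) = G (F y) b := by
      intro b
      have h6 : HasDerivAt (fun t : ℝ => G (F y) (fderiv ℝ F y w + t • b)) (G' (0, b)) 0 := by
        have hl : HasDerivAt (fun t : ℝ => (F y, fderiv ℝ F y w + t • b)) ((0 : E'), b) 0 := by
          have : HasDerivAt (fun t : ℝ => fderiv ℝ F y w + t • b) b 0 := by
            simpa using ((hasDerivAt_id (0 : ℝ)).smul_const b).const_add (fderiv ℝ F y w)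
          exact (hasDerivAt_const (0 : ℝ) (F y)).prodMk this
        have h1' : HasFDerivAt (fun p : E' × E' => G p.1 p.2) G'
            (F y, fderiv ℝ F y w + (0 : ℝ) • b) := by simpa using h1
        exact h1'.comp_hasDerivAt (0 : ℝ) hl
      have h7 : HasDerivAt (fun t : ℝ => G (F y) (fderiv ℝ F y w + t • b)) (G (F y) b) 0 := by
        simp only [map_add, map_smul, smul_eq_mul]
        simpa using ((hasDerivAt_id (0 : ℝ)).mul_const (G (F y) b)).const_add
          (G (F y) (fderiv ℝ F y w))
      exact h6.unique h7
    have h8 : fderiv ℝ (fun x => G (F x) (fderiv ℝ F x w)) y v =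
        G' (fderiv ℝ F y v, fderiv ℝ (fderiv ℝ F) y v w) :=
      congrArg (fun L => L v) h3.fderiv
    rw [h8, h4.fderiv, ← h5]
    simp [← map_add]
  rw [key v w, key w v, hsymm v w]
  ring

variable {d e : ℕ} {X Y : Type*}
  [TopologicalSpace X] [ChartedSpace (Euc d) X]
  [TopologicalSpace Y] [ChartedSpace (Euc e) Y]

/-- A one-form in the chart at `u`. -/
def coordForm (α : X → Euc d →ₗ[ℝ] ℝ) (u : X) (y : Euc d) :
    Euc d →ₗ[ℝ] ℝ :=
  α ((extChartAt (𝓡 d) u).symm y) ∘ₗ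
    (mD (Euc d) (Euc d) (extChartAt (𝓡 d) u).symm y :
      Euc d →ₗ[ℝ] Euc d)

lemma dOneForm_eq (α : X → Euc d →ₗ[ℝ] ℝ) (u : X)
    (v w : Euc d) :
    dOneForm (fun x z => α x z) u v w =
      fderiv ℝ (fun y => coordForm α u y w) (extChartAt (𝓡 d) u u) v -
        fderiv ℝ (fun y => coordForm α u y v) (extChartAt (𝓡 d) u u) w := rfl

variable [IsManifold (𝓡 d) ∞ X] [IsManifold (𝓡 e) ∞ Y]

/-- Smoothness of a real-valued one-form, as a function on the tangent bundle. -/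
def SmoothForm (α : X → Euc d →ₗ[ℝ] ℝ) : Prop :=
  ContMDiff (𝓡 d).tangent 𝓘(ℝ, ℝ) ∞ (fun p : TangentBundle (𝓡 d) X => α p.1 p.2)

/-- A smooth form pulled back along a smooth map from a vector space is smooth. -/
lemma SmoothForm.contDiffOn_pullback {α : X → Euc d →ₗ[ℝ] ℝ} (hα : SmoothForm α)
    {E : Type*} [NormedAddCommGroup E] [NormedSpace ℝ E] {s : Set E} (hs : IsOpen s) {f : E → X}
    (hf : ContMDiffOn 𝓘(ℝ, E) (𝓡 d) ∞ f s) :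
    ContDiffOn ℝ ∞ (fun p : E × E => α (f p.1) (mD E (Euc d) f p.1 p.2))
      (s ×ˢ Set.univ) := by
  have h1 := hf.contMDiffOn_tangentMapWithin (m := ∞) (by simp) hs.uniqueMDiffOn
  have h2 := hα.comp_contMDiffOn h1
  have h3 := contMDiff_tangentBundleModelSpaceHomeomorph_symm (I := 𝓘(ℝ, E)) (n := ∞)
  have h4 : ContMDiffOn 𝓘(ℝ, E × E) 𝓘(ℝ, E).tangent ∞
      (fun p : E × E => (⟨p.1, p.2⟩ : TangentBundle 𝓘(ℝ, E) E)) Set.univ :=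
    (h3.comp_contMDiffOn (ModelWithCorners.contMDiffOn_symm 𝓘(ℝ, E).tangent)).mono
      fun p _ => by simp
  have h5 := h2.comp (s := s ×ˢ (Set.univ : Set E)) (h4.mono (Set.subset_univ _)) fun p hp => hp.1
  refine (contMDiffOn_iff_contDiffOn.1 h5).congr fun p hp => ?_
  change _ = α (f p.1) (mfderivWithin 𝓘(ℝ, E) (𝓡 d) f s p.1 p.2)
  rw [mfderivWithin_of_isOpen hs hp.1]
  rfl

lemma SmoothForm.contDiffOn_coordForm {α : X → Euc d →ₗ[ℝ] ℝ}
    (hα : SmoothForm α) (u : X) :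
    ContDiffOn ℝ ∞ (fun p : Euc d × Euc d =>
      coordForm α u p.1 p.2) ((extChartAt (𝓡 d) u).target ×ˢ Set.univ) :=
  hα.contDiffOn_pullback (isOpen_extChartAt_target u) (contMDiffOn_extChartAt_symm u)

/-- The pullback of a one-form. -/
def pullbackForm (f : X → Y) (α : Y → Euc e →ₗ[ℝ] ℝ) (x : X) :
    Euc d →ₗ[ℝ] ℝ :=
  α (f x) ∘ₗ (mD (Euc d) (Euc e) f x :
    Euc d →ₗ[ℝ] Euc e)

lemma SmoothForm.pullback {f : X → Y} (hf : ContMDiff (𝓡 d) (𝓡 e) ∞ f)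
    {α : Y → Euc e →ₗ[ℝ] ℝ} (hα : SmoothForm α) :
    SmoothForm (d := d) (pullbackForm f α) :=
  hα.comp (hf.contMDiff_tangentMap (m := ∞) (by simp))

/-- **Naturality** of the exterior derivative: `d(f^* α) = f^* dα`. -/
lemma dOneForm_pullback {f : X → Y} (hf : ContMDiff (𝓡 d) (𝓡 e) ∞ f)
    {α : Y → Euc e →ₗ[ℝ] ℝ} (hα : SmoothForm α) (u : X)
    (v w : Euc d) :
    dOneForm (fun x z => pullbackForm f α x z) u v w =
      dOneForm (fun y z => α y z) (f u)
        (mD (Euc d) (Euc e) f u v)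
        (mD (Euc d) (Euc e) f u w) := by
  have hfd : ∀ x, MDifferentiableAt (𝓡 d) (𝓡 e) f x := fun x => hf.mdifferentiableAt (by simp)
  set φ := extChartAt (𝓡 d) u with hφ
  set ψ := extChartAt (𝓡 e) (f u) with hψ
  let F : Euc d → Euc e := fun y => ψ (f (φ.symm y))
  let S := φ.target ∩ φ.symm ⁻¹' (f ⁻¹' ψ.source)
  have hS : IsOpen S := isOpen_chart_preimage ((isOpen_extChartAt_source (f u)).preimage
    hf.continuous) u
  have hy0 : φ u ∈ S := by
    refine ⟨mem_extChartAt_target u, ?_⟩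
    simp [hφ, hψ]
  have hφs : ContMDiffOn (𝓡 d) (𝓡 d) ∞ φ.symm φ.target := contMDiffOn_extChartAt_symm u
  have hψs : ContMDiffOn (𝓡 e) (𝓡 e) ∞ ψ.symm ψ.target := contMDiffOn_extChartAt_symm (f u)
  have hF : ContDiffOn ℝ ∞ F S := by
    rw [← contMDiffOn_iff_contDiffOn]
    have h1 : ContMDiffOn (𝓡 e) (𝓡 e) ∞ ψ ψ.source := by
      have := contMDiffOn_extChartAt (I := 𝓡 e) (x := f u) (n := ∞)
      rwa [← extChartAt_source (𝓡 e)] at this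
    exact h1.comp (hf.comp_contMDiffOn (hφs.mono Set.inter_subset_left)) fun y hy => hy.2
  have hFd : ∀ y ∈ S, DifferentiableAt ℝ F y := fun y hy =>
    (hF.contDiffAt (hS.mem_nhds hy)).differentiableAt (by simp)
  have hF0 : F (φ u) = ψ (f u) := by simp [F, hφ]
  -- the derivative of `f` in the charts
  have hmf : mD (Euc d) (Euc e) f u =
      fderiv ℝ F (φ u) := by
    unfold mD
    rw [(hfd u).mfderiv]
    simp only [ModelWithCorners.range_eq_univ, fderivWithin_univ]
    rfl
  -- the pulled-back form in the charts
  have hcoord : ∀ y ∈ S, ∀ z, coordForm (pullbackForm f α) u y z =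
      coordForm α (f u) (F y) (fderiv ℝ F y z) := by
    intro y hy z
    have e1 : ψ.symm (F y) = f (φ.symm y) := ψ.left_inv hy.2
    have e2 : mD (Euc d) (Euc e)
        (fun y => ψ.symm (F y)) y z = mD (Euc d) (Euc e)
        (fun y => f (φ.symm y)) y z := by
      rw [mD_congr_on hS hy fun y hy => ψ.left_inv hy.2]
    rw [mD_comp (g := f) (f := φ.symm) (hfd _)
      (mdiffAt_of_on hφs (isOpen_extChartAt_target u) hy.1), mD_comp (N' := Euc e)
      (g := ψ.symm) (f := F) (mdiffAt_of_on hψs (isOpen_extChartAt_target (f u))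
      (ψ.map_source hy.2)) (hFd y hy).mdifferentiableAt, mD_eq_fderiv] at e2
    change α (f (φ.symm y)) (mD _ _ f _ (mD _ _ φ.symm y z)) =
      α (ψ.symm (F y)) (mD _ _ ψ.symm (F y) (fderiv ℝ F y z))
    rw [e1, e2]
  have hcoord' : ∀ v w, fderiv ℝ (fun y => coordForm (pullbackForm f α) u y w) (φ u) v =
      fderiv ℝ (fun y => coordForm α (f u) (F y) (fderiv ℝ F y w)) (φ u) v := by
    intro v w
    rw [Filter.EventuallyEq.fderiv_eq
      (Filter.eventuallyEq_of_mem (hS.mem_nhds hy0) fun y hy => hcoord y hy w)]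
  rw [dOneForm_eq, dOneForm_eq, ← hφ, ← hψ, hcoord', hcoord', hmf]
  have hG := hα.contDiffOn_coordForm (f u)
  rw [fderiv_pullback_sub _ ((hF.contDiffAt (hS.mem_nhds hy0)).of_le (by norm_cast)), hF0]
  · intro b
    refine (hG.contDiffAt (IsOpen.mem_nhds ((isOpen_extChartAt_target (f u)).prod isOpen_univ)
      ⟨?_, Set.mem_univ _⟩)).differentiableAt (by simp)
    rw [hF0]
    exact mem_extChartAt_target _

end Exterior

/-! ### Curvature -/

section Curvature

variable {d e m : ℕ} {X Y M : Type*}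
  [TopologicalSpace X] [ChartedSpace (Euc d) X]
  [TopologicalSpace Y] [ChartedSpace (Euc e) Y]
  [TopologicalSpace M] [ChartedSpace (Euc m) M]

/-- The image of a matrix-valued one-form under a linear functional. -/
def functionalForm (L : Mat33 →ₗ[ℝ] ℝ) (Θ : X → Euc d →ₗ[ℝ] Mat33) (u : X) :
    Euc d →ₗ[ℝ] ℝ := L ∘ₗ Θ u

/-- The functional that reads off an entry of a matrix. -/
def entry (i j : Fin 3 ⊕ Fin 3) : Mat33 →ₗ[ℝ] ℝ := Matrix.entryLinearMap ℝ ℝ i j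

/-- The entrywise exterior derivative of a matrix-valued one-form. -/
def dMat (Θ : X → Euc d →ₗ[ℝ] Mat33) (u : X)
    (v w : Euc d) : Mat33 :=
  Matrix.of fun i j => dOneForm (fun x z => functionalForm (entry i j) Θ x z) u v w

/-- The curvature `dΘ + [Θ, Θ]` of a matrix-valued one-form. -/
def curvMat (Θ : X → Euc d →ₗ[ℝ] Mat33) (u : X)
    (v w : Euc d) : Mat33 := dMat Θ u v w + ⁅Θ u v, Θ u w⁆

lemma dOneForm_swap (α : X → Euc d →ₗ[ℝ] ℝ) (u : X)
    (v w : Euc d) :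
    dOneForm (fun x z => α x z) u v w = -dOneForm (fun x z => α x z) u w v := by
  rw [dOneForm_eq, dOneForm_eq]; ring

lemma curvMat_swap (Θ : X → Euc d →ₗ[ℝ] Mat33) (u : X)
    (v w : Euc d) : curvMat Θ u v w = -curvMat Θ u w v := by
  rw [curvMat, curvMat, ← lie_skew, neg_add]
  congr 1
  ext i j
  exact dOneForm_swap _ u v w

variable [IsManifold (𝓡 d) ∞ X] [IsManifold (𝓡 e) ∞ Y]

/-- Entrywise smoothness of a matrix-valued one-form. -/
def SmoothMatForm (Θ : X → Euc d →ₗ[ℝ] Mat33) : Prop :=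
  ∀ i j, SmoothForm (functionalForm (entry i j) Θ)

lemma IsCartanConnection.smoothMatForm {𝔪 : Model} {act : X → 𝔪.parabolic → X}
    {θ : OneForm X d 𝔪.alg} (hθ : IsCartanConnection 𝔪 act θ) : SmoothMatForm θ.mat := hθ.smooth

lemma coordForm_differentiableAt {α : X → Euc d →ₗ[ℝ] ℝ} (hα : SmoothForm α)
    (u : X) (w : Euc d) :
    DifferentiableAt ℝ (fun y => coordForm α u y w) (extChartAt (𝓡 d) u u) := by
  have h := (hα.contDiffOn_coordForm u).contDiffAt (IsOpen.mem_nhds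
    ((isOpen_extChartAt_target u).prod isOpen_univ) (x := (extChartAt (𝓡 d) u u, w))
    ⟨mem_extChartAt_target u, Set.mem_univ _⟩)
  exact (h.differentiableAt (by simp)).comp (extChartAt (𝓡 d) u u)
    (f := fun y => (y, w)) (differentiableAt_id.prodMk (differentiableAt_const w))

lemma dOneForm_add_right {α : X → Euc d →ₗ[ℝ] ℝ} (hα : SmoothForm α) (u : X)
    (v w w' : Euc d) :
    dOneForm (fun x z => α x z) u v (w + w') =
      dOneForm (fun x z => α x z) u v w + dOneForm (fun x z => α x z) u v w' := by
  simp only [dOneForm_eq, map_add]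
  rw [fderiv_fun_add (coordForm_differentiableAt hα u w) (coordForm_differentiableAt hα u w')]
  simp only [add_apply]
  ring

lemma dOneForm_smul_right {α : X → Euc d →ₗ[ℝ] ℝ} (hα : SmoothForm α) (u : X)
    (c : ℝ) (v w : Euc d) :
    dOneForm (fun x z => α x z) u v (c • w) = c * dOneForm (fun x z => α x z) u v w := by
  simp only [dOneForm_eq, map_smul, smul_eq_mul]
  rw [fderiv_const_mul (coordForm_differentiableAt hα u w)]
  simp only [smul_apply, smul_eq_mul]
  ring

/-- The curvature of a smooth form, as a bilinear map. -/
def curvBilin {Θ : X → Euc d →ₗ[ℝ] Mat33} (hΘ : SmoothMatForm Θ) (u : X) :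
    Euc d →ₗ[ℝ] Euc d →ₗ[ℝ] Mat33 :=
  have hadd : ∀ v w w', curvMat Θ u v (w + w') = curvMat Θ u v w + curvMat Θ u v w' := by
    intro v w w'
    have : dMat Θ u v (w + w') = dMat Θ u v w + dMat Θ u v w' := by
      ext i j
      exact dOneForm_add_right (hΘ i j) u v w w'
    rw [curvMat, curvMat, curvMat, this, map_add, lie_add]
    abel
  have hsmul : ∀ (c : ℝ) v w, curvMat Θ u v (c • w) = c • curvMat Θ u v w := by
    intro c v w
    have : dMat Θ u v (c • w) = c • dMat Θ u v w := by
      ext i j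
      exact dOneForm_smul_right (hΘ i j) u c v w
    rw [curvMat, curvMat, this, map_smul, lie_smul, smul_add]
  LinearMap.mk₂ ℝ (fun v w => curvMat Θ u v w)
    (fun v v' w => by rw [curvMat_swap, hadd, neg_add, ← curvMat_swap, ← curvMat_swap])
    (fun c v w => by rw [curvMat_swap, hsmul, ← smul_neg, ← curvMat_swap]) hadd hsmul

lemma dMat_pullback {f : X → Y} (hf : ContMDiff (𝓡 d) (𝓡 e) ∞ f)
    {Θ : Y → Euc e →ₗ[ℝ] Mat33} (hΘ : SmoothMatForm Θ)
    {Θ' : X → Euc d →ₗ[ℝ] Mat33}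
    (h : ∀ x v, Θ' x v = Θ (f x) (mD (Euc d) (Euc e) f x v))
    (u : X) (v w : Euc d) :
    dMat Θ' u v w = dMat Θ (f u) (mD (Euc d) (Euc e) f u v)
        (mD (Euc d) (Euc e) f u w) := by
  ext i j
  have h1 : functionalForm (entry i j) Θ' = pullbackForm f (functionalForm (entry i j) Θ) := by
    funext x
    refine LinearMap.ext fun v => ?_
    change entry i j (Θ' x v) = _
    rw [h]
    rfl
  simp only [dMat, Matrix.of_apply, h1]
  exact dOneForm_pullback hf (hΘ i j) u v w

/-- Naturality of the curvature. -/
lemma curvMat_pullback {f : X → Y} (hf : ContMDiff (𝓡 d) (𝓡 e) ∞ f)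
    {Θ : Y → Euc e →ₗ[ℝ] Mat33} (hΘ : SmoothMatForm Θ)
    {Θ' : X → Euc d →ₗ[ℝ] Mat33}
    (h : ∀ x v, Θ' x v = Θ (f x) (mD (Euc d) (Euc e) f x v))
    (u : X) (v w : Euc d) :
    curvMat Θ' u v w = curvMat Θ (f u)
        (mD (Euc d) (Euc e) f u v)
        (mD (Euc d) (Euc e) f u w) := by
  rw [curvMat, curvMat, dMat_pullback hf hΘ h, h, h]

/-- Linear functionals commute with the exterior derivative. -/
lemma functional_dMat {Θ : X → Euc d →ₗ[ℝ] Mat33} (hΘ : SmoothMatForm Θ)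
    (L : Mat33 →ₗ[ℝ] ℝ) (u : X) (v w : Euc d) :
    L (dMat Θ u v w) = dOneForm (fun x z => functionalForm L Θ x z) u v w := by
  have hL : ∀ A : Mat33, L A = ∑ i, ∑ j, A i j * L (Matrix.single i j 1) := by
    intro A
    conv_lhs => rw [Matrix.matrix_eq_sum_single A]
    simp only [map_sum]
    refine Finset.sum_congr rfl fun i _ => Finset.sum_congr rfl fun j _ => ?_
    rw [← smul_eq_mul, ← map_smul, Matrix.smul_single, smul_eq_mul, mul_one]
  have hc : ∀ y z, coordForm (functionalForm L Θ) u y z =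
      ∑ i, ∑ j, coordForm (functionalForm (entry i j) Θ) u y z * L (Matrix.single i j 1) :=
    fun y z => hL _
  have hd : ∀ v w, fderiv ℝ (fun y => coordForm (functionalForm L Θ) u y w)
      (extChartAt (𝓡 d) u u) v = ∑ i, ∑ j,
        fderiv ℝ (fun y => coordForm (functionalForm (entry i j) Θ) u y w)
          (extChartAt (𝓡 d) u u) v * L (Matrix.single i j 1) := by
    intro v w
    have h1 : HasFDerivAt (fun y => coordForm (functionalForm L Θ) u y w)
        (∑ i, ∑ j, (L (Matrix.single i j 1)) •
          fderiv ℝ (fun y => coordForm (functionalForm (entry i j) Θ) u y w)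
            (extChartAt (𝓡 d) u u)) (extChartAt (𝓡 d) u u) := by
      simp only [hc]
      refine HasFDerivAt.fun_sum fun i _ => HasFDerivAt.fun_sum fun j _ => ?_
      exact (coordForm_differentiableAt (hΘ i j) u w).hasFDerivAt.mul_const _
    rw [h1.fderiv]
    simp [mul_comm]
  rw [hL, dOneForm_eq, hd, hd, ← Finset.sum_sub_distrib]
  refine Finset.sum_congr rfl fun i _ => ?_
  rw [← Finset.sum_sub_distrib]
  refine Finset.sum_congr rfl fun j _ => ?_
  rw [← sub_mul]
  rfl

/-- If a form takes values in a subspace, then so does its exterior derivative. -/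
lemma dMat_mem {Θ : X → Euc d →ₗ[ℝ] Mat33} (hΘ : SmoothMatForm Θ)
    {S : Submodule ℝ Mat33} (hS : ∀ x v, Θ x v ∈ S) (u : X) (v w : Euc d) :
    dMat Θ u v w ∈ S := by
  by_contra hcon
  obtain ⟨L, hL, hL'⟩ := Submodule.exists_le_ker_of_notMem hcon
  apply hL
  rw [functional_dMat hΘ]
  have h0 : functionalForm L Θ = fun _ => 0 := by
    funext x
    exact LinearMap.ext fun v => hL' (hS x v)
  rw [h0, dOneForm_eq]
  have : ∀ y z, coordForm (fun _ : X => (0 : Euc d →ₗ[ℝ] ℝ)) u y z = 0 :=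
    fun _ _ => rfl
  simp [this]

lemma dMat_sub {Θ Θ' : X → Euc d →ₗ[ℝ] Mat33} (hΘ : SmoothMatForm Θ)
    (hΘ' : SmoothMatForm Θ') (u : X) (v w : Euc d) :
    dMat (fun x => Θ x - Θ' x) u v w = dMat Θ u v w - dMat Θ' u v w := by
  ext i j
  have hc : ∀ y z, coordForm (functionalForm (entry i j) fun x => Θ x - Θ' x) u y z =
      coordForm (functionalForm (entry i j) Θ) u y z -
        coordForm (functionalForm (entry i j) Θ') u y z := fun _ _ => rfl
  simp only [dMat, Matrix.of_apply, Matrix.sub_apply, dOneForm_eq, hc]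
  rw [fderiv_fun_sub (coordForm_differentiableAt (hΘ i j) u w)
    (coordForm_differentiableAt (hΘ' i j) u w), fderiv_fun_sub
    (coordForm_differentiableAt (hΘ i j) u v) (coordForm_differentiableAt (hΘ' i j) u v)]
  simp only [sub_apply]
  ring

end Curvature

/-! ### Vertical vectors and horizontality of the curvature -/

section Vertical

lemma mDMat_rho_inv {E : Type*} [NormedAddCommGroup E] [NormedSpace ℝ E]
    {N : Type*} [TopologicalSpace N] [ChartedSpace E N] {U : Set N} (hU : IsOpen U) {n : N}
    (hn : n ∈ U) {h : N → Spin33} (hh : SmoothIntoSpinOn 𝓘(ℝ, E) h U) (v : E) :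
    mDMat E (fun y => rho (h y)⁻¹) n v =
      -(rho (h n)⁻¹ * mDMat E (fun y => rho (h y)) n v * rho (h n)⁻¹) := by
  have d1 : DiffMatAt E (fun y => rho (h y)) n := fun i j => mdiffAt_of_on (hh.rho_apply i j) hU hn
  have d2 : DiffMatAt E (fun y => rho (h y)⁻¹) n :=
    fun i j => mdiffAt_of_on (hh.inv.rho_apply i j) hU hn
  have h1 := mDMat_mul d2 d1 v
  simp only [rho_inv_mul, mDMat_const] at h1
  have h2 : mDMat E (fun y => rho (h y)⁻¹) n v * rho (h n) =
      -(rho (h n)⁻¹ * mDMat E (fun y => rho (h y)) n v) :=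
    eq_neg_of_add_eq_zero_right h1.symm
  rw [← neg_mul, ← h2, mul_assoc, rho_mul_inv, mul_one]

lemma mDMat_mulVec_mem {E : Type*} [NormedAddCommGroup E] [NormedSpace ℝ E]
    {N : Type*} [TopologicalSpace N] [ChartedSpace E N] {U : Set N} (hU : IsOpen U) {n : N}
    (hn : n ∈ U) {F : N → Mat33} (hF : DiffMatAt E F n) {a : Vec33} {S : Submodule ℝ Vec33}
    (hS : ∀ y ∈ U, F y *ᵥ a ∈ S) (v : E) : mDMat E F n v *ᵥ a ∈ S := by
  by_contra hcon
  obtain ⟨L, hL, hL'⟩ := Submodule.exists_le_ker_of_notMem hcon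
  apply hL
  have key : ∀ x : Vec33, L x = ∑ i, x i * L (Pi.single i 1) := fun x => by
    conv_lhs => rw [pi_eq_sum_univ' x]
    simp [map_sum]
  have hd : ∀ i, MDifferentiableAt 𝓘(ℝ, E) 𝓘(ℝ, ℝ) (fun y => (F y *ᵥ a) i) n := by
    intro i
    have := (hF.mul (diffMatAt_const (Matrix.of fun i _ => a i : Mat33) n)) i i
    exact this
  rw [key]
  simp only [mDMat_mulVec hF]
  have h1 : ∀ i, mD E ℝ (fun y => (F y *ᵥ a) i) n v * L (Pi.single i 1) =
      mD E ℝ (fun y => (F y *ᵥ a) i * L (Pi.single i 1)) n v := fun i => by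
    rw [mD_mul (hd i) mdifferentiableAt_const, mD_const]; simp
  simp only [h1]
  rw [← mD_sum (f := fun i y => (F y *ᵥ a) i * L (Pi.single i 1))
    (fun i _ => (hd i).mul mdifferentiableAt_const)]
  rw [mD_congr_on (g := fun _ => (0 : ℝ)) hU hn fun y hy => by
    rw [← key]; exact hL' (hS y hy), mD_const]

variable {d m m' : ℕ} {X M M' : Type*}
  [TopologicalSpace X] [ChartedSpace (Euc d) X]
  [TopologicalSpace M] [ChartedSpace (Euc m) M]
  [TopologicalSpace M'] [ChartedSpace (Euc m') M']
  {𝔪 : Model} {act : X → 𝔪.parabolic → X} {π : X → M} {θ : OneForm X d 𝔪.alg}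

/-- The converse of the containment of the vertical vectors in `θ⁻¹(ker q)` holds when the
dimensions agree. -/
lemma vertical_of_apply_eq_zero {𝔤 : LieSubalgebra ℝ Mat33} {θ : OneForm X d 𝔤} {u : X}
    (hbij : Function.Bijective (θ u)) (q : 𝔤 →ₗ[ℝ] (Fin m → ℝ)) (hq : Function.Surjective q)
    (h : ∀ ξ : Euc d, mD (Euc d) (Euc m) π u ξ = 0 → q (θ u ξ) = 0) {ξ : Euc d}
    (hξ : q (θ u ξ) = 0) : mD (Euc d) (Euc m) π u ξ = 0 := by
  let f : Euc d →ₗ[ℝ] (Fin m → ℝ) := q ∘ₗ θ u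
  let p : Euc d →ₗ[ℝ] Euc m := (mD (Euc d) (Euc m) π u : Euc d →L[ℝ] Euc m).toLinearMap
  have hf : Function.Surjective f := hq.comp hbij.2
  have hle : LinearMap.ker p ≤ LinearMap.ker f := fun ζ hζ => h ζ hζ
  have h1 := f.finrank_range_add_finrank_ker
  have h2 := p.finrank_range_add_finrank_ker
  rw [LinearMap.range_eq_top.2 hf, finrank_top] at h1
  have h3 := Submodule.finrank_le (LinearMap.range p)
  simp only [finrank_euclideanSpace, Fintype.card_fin, Module.finrank_fin_fun] at h1 h2 h3
  have h4 : LinearMap.ker p = LinearMap.ker f :=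
    Submodule.eq_of_le_of_finrank_le hle (by omega)
  have : ξ ∈ LinearMap.ker p := by
    rw [h4]; exact hξ
  exact this

variable [IsManifold (𝓡 d) ∞ X]

/-- A Cartan connection maps a vertical vector to the Maurer-Cartan form of the coordinate on the
fibre. The vertical vectors may be those of the quotient by a subgroup of the structure group. -/
lemma IsPrincipalBundle.exists_vertical
    (hP : IsPrincipalBundle (d := d) (m := m) 𝔪.parabolic act π)
    {H : Subgroup Spin33} (hH : H ≤ 𝔪.parabolic) {act' : X → H → X} {π' : X → M'}
    (hact : ∀ u h, act' u h = act u (Subgroup.inclusion hH h))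
    (hP' : IsPrincipalBundle (d := d) (m := m') H act' π') (u : X) :
    ∃ (U : Set X) (δ : X → H), IsOpen U ∧ u ∈ U ∧
      SmoothIntoSpinOn (𝓡 d) (fun x => (δ x : Spin33)) U ∧
      ∀ (θ : OneForm X d 𝔪.alg), IsCartanConnection 𝔪 act θ →
        ∀ ξ, mD (Euc d) (Euc m') π' u ξ = 0 → θ.mat u ξ =
        rho (δ u : Spin33)⁻¹ * mDMat (Euc d) (fun x => rho (δ x : Spin33)) u ξ := by
  obtain ⟨V, σ, δ, hV, huV, hσ, -, hδ, hσδ⟩ := hP'.locally_trivial (π' u)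
  have hU : IsOpen (π' ⁻¹' V) := hV.preimage hP'.smooth_proj.continuous
  refine ⟨π' ⁻¹' V, δ, hU, huV, hδ, fun θ hθ ξ hξ => ?_⟩
  have hc : ContMDiffOn (𝓡 d) (𝓡 d) ∞ (fun x => σ (π' x)) (π' ⁻¹' V) :=
    hσ.comp hP'.smooth_proj.contMDiffOn fun x hx => hx
  have hL := hθ.leibniz hP hU (n := u) huV hc (h := fun x => Subgroup.inclusion hH (δ x)) hδ ξ
  have hid :
      mD (Euc d) (Euc d) (fun y => act (σ (π' y)) (Subgroup.inclusion hH (δ y))) u ξ = ξ := by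
    rw [mD_congr_on (g := fun y => y) hU huV fun y hy => by rw [← hact, ← hσδ y hy], mD_id]
  have h0 : mD (Euc d) (Euc d) (fun y => σ (π' y)) u ξ = 0 := by
    rw [mD_comp (g := σ) (mdiffAt_of_on hσ hV huV) (hP'.smooth_proj.mdifferentiableAt (by simp)),
      hξ, map_zero]
  rw [hid, h0, map_zero, mul_zero, zero_mul, zero_add, ← hact, ← hσδ u huV] at hL
  exact hL

/-- If the structure group fixes the ray of `a`, then a Cartan connection maps vertical vectors to
matrices that preserve the line of `a`. -/
lemma IsCartanConnection.vertical_mulVec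
    (hP : IsPrincipalBundle (d := d) (m := m) 𝔪.parabolic act π) (hθ : IsCartanConnection 𝔪 act θ)
    {H : Subgroup Spin33} (hH : H ≤ 𝔪.parabolic) {act' : X → H → X} {π' : X → M'}
    (hact : ∀ u h, act' u h = act u (Subgroup.inclusion hH h))
    (hP' : IsPrincipalBundle (d := d) (m := m') H act' π') {a : Vec33} (ha : H ≤ rayStabilizer a)
    {u : X} {ξ : Euc d} (hξ : mD (Euc d) (Euc m') π' u ξ = 0) :
    ∃ c : ℝ, θ.mat u ξ *ᵥ a = c • a := by
  obtain ⟨U, δ, hU, hu, hδ, h⟩ := hP.exists_vertical hH hact hP' u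
  rw [h θ hθ ξ hξ]
  have h1 : mDMat (Euc d) (fun x => rho (δ x : Spin33)) u ξ *ᵥ a ∈ Submodule.span ℝ {a} := by
    refine mDMat_mulVec_mem hU hu ((smoothIntoSpinOn_rho hδ).diffMatAt hU hu) (fun y _ => ?_) ξ
    obtain ⟨c, -, hc⟩ := ha (δ y).2
    rw [hc]
    exact Submodule.smul_mem _ _ (Submodule.mem_span_singleton_self a)
  obtain ⟨k, hk⟩ := Submodule.mem_span_singleton.1 h1
  obtain ⟨c, -, hc⟩ := ha ((δ u)⁻¹).2
  refine ⟨k * c, ?_⟩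
  rw [← Matrix.mulVec_mulVec, ← hk, Matrix.mulVec_smul]
  rw [Subgroup.coe_inv] at hc
  rw [hc, smul_smul]

/-- Two Cartan connections agree on vertical vectors. -/
lemma IsCartanConnection.eq_on_vertical
    (hP : IsPrincipalBundle (d := d) (m := m) 𝔪.parabolic act π) (hθ : IsCartanConnection 𝔪 act θ)
    {θ' : OneForm X d 𝔪.alg} (hθ' : IsCartanConnection 𝔪 act θ') {u : X} {ξ : Euc d}
    (hξ : mD (Euc d) (Euc m) π u ξ = 0) : θ.mat u ξ = θ'.mat u ξ := by
  obtain ⟨U, δ, -, -, -, h⟩ := hP.exists_vertical le_rfl (fun _ _ => rfl) hP u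
  rw [h θ hθ ξ hξ, h θ' hθ' ξ hξ]

/-- The exterior derivative on a vector space, as a difference of derivatives along lines. -/
lemma dMat_vectorSpace {k : ℕ} {Θ : Euc k → Euc k →ₗ[ℝ] Mat33} (hΘ : SmoothMatForm Θ)
    (z v w : Euc k) :
    dMat Θ z v w = mDMat ℝ (fun t : ℝ => Θ (z + t • v) w) 0 (1 : ℝ) -
      mDMat ℝ (fun t : ℝ => Θ (z + t • w) v) 0 (1 : ℝ) := by
  ext i j
  have hc : ∀ y x, coordForm (functionalForm (entry i j) Θ) z y x = Θ y x i j := by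
    intro y x
    have h : mD (Euc k) (Euc k) (extChartAt (𝓡 k) z).symm y x = x := by
      simp only [mfld_simps]
      exact mD_id y x
    change entry i j (Θ _ (mD (Euc k) (Euc k) (extChartAt (𝓡 k) z).symm y x)) = _
    rw [h]
    rfl
  have hd : ∀ x, DifferentiableAt ℝ (fun y => Θ y x i j) z := by
    intro x
    have := coordForm_differentiableAt (hΘ i j) z x
    simp only [hc] at this
    exact this
  have hl : ∀ v w, fderiv ℝ (fun y => Θ y w i j) z v =
      mD ℝ ℝ (fun t : ℝ => Θ (z + t • v) w i j) 0 (1 : ℝ) := by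
    intro v w
    have h1 : HasDerivAt (fun t : ℝ => z + t • v) v 0 := by
      simpa using ((hasDerivAt_id (0 : ℝ)).smul_const v).const_add z
    have h2 : HasFDerivAt (fun y => Θ y w i j) (fderiv ℝ (fun y => Θ y w i j) z)
        (z + (0 : ℝ) • v) := by simpa using (hd w).hasFDerivAt
    have h3 : HasDerivAt (fun t : ℝ => Θ (z + t • v) w i j)
        (fderiv ℝ (fun y => Θ y w i j) z v) 0 :=
      HasFDerivAt.comp_hasDerivAt (l := fun y => Θ y w i j) (0 : ℝ) h2 h1
    rw [mD_eq_fderiv, ← h3.deriv]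
    rfl
  simp only [dMat, mDMat, Matrix.of_apply, Matrix.sub_apply, dOneForm_eq, hc, ← hl]
  rfl

/-- The curvature of a Cartan connection is **horizontal**. -/
lemma IsCartanConnection.curvMat_vertical
    (hP : IsPrincipalBundle (d := d) (m := m) 𝔪.parabolic act π) (hθ : IsCartanConnection 𝔪 act θ)
    {u : X} {ξ : Euc d} (hξ : mD (Euc d) (Euc m) π u ξ = 0) (w : Euc d) :
    curvMat θ.mat u ξ w = 0 := by
  obtain ⟨U, δ, hU, hu, hδ, h⟩ := hP.exists_vertical le_rfl (fun _ _ => rfl) hP u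
  obtain ⟨η, hη, hηU, hη0, hηv⟩ := exists_curve hU hu ξ
  obtain ⟨x, hx, -, hx0, hxv⟩ := exists_curve isOpen_univ (Set.mem_univ u) w
  -- the curve `γ` in the structure group with `u · γ` tangent to `ξ`
  let γ : ℝ → 𝔪.parabolic := fun t => (δ u)⁻¹ * δ (η t)
  have hγ : SmoothIntoSpinOn 𝓘(ℝ, ℝ) (fun t => (γ t : Spin33)) Set.univ :=
    (smoothIntoSpinOn_const _).mul (hδ.comp hη.contMDiffOn fun t _ => hηU t)
  have hγ0 : γ 0 = 1 := by simp [γ, hη0]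
  have hRγ : SmoothMatOn ℝ (fun t : ℝ => rho (γ t : Spin33)) Set.univ := smoothIntoSpinOn_rho hγ
  have hRd : ∀ t : ℝ, DiffMatAt ℝ (fun t : ℝ => rho (γ t : Spin33)) t := fun t =>
    hRγ.diffMatAt isOpen_univ (Set.mem_univ t)
  set Γ := mDMat ℝ (fun t : ℝ => rho (γ t : Spin33)) 0 (1 : ℝ) with hΓ
  have hΓξ : Γ = θ.mat u ξ := by
    have : (fun t => rho (γ t : Spin33)) =
        fun t => rho (δ u : Spin33)⁻¹ * rho (δ (η t) : Spin33) := by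
      funext t
      simp only [γ, Subgroup.coe_mul, Subgroup.coe_inv, map_mul]
    have hd : DiffMatAt ℝ (fun t => rho (δ (η t) : Spin33)) 0 :=
      SmoothMatOn.diffMatAt (smoothIntoSpinOn_rho (hδ.comp hη.contMDiffOn fun t _ => hηU t))
        isOpen_univ (Set.mem_univ 0)
    rw [h θ hθ ξ hξ, hΓ, this, mDMat_mul (diffMatAt_const _ _) hd, mDMat_const, zero_mul, add_zero,
      mDMat_comp (F := fun y => rho (δ y : Spin33)) (by
        rw [hη0]; exact (smoothIntoSpinOn_rho hδ).diffMatAt hU hu) (hη.mdifferentiableAt (by simp)),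
      hη0, hηv]
  -- the surface `(s, t) ↦ x(s) · γ(t)`
  let f : Euc 2 → X := fun z => act (x (z 0)) (γ (z 1))
  let pr : Fin 2 → Euc 2 →L[ℝ] ℝ := fun i => EuclideanSpace.proj i
  have hpr : ∀ i, ContMDiff 𝓘(ℝ, Euc 2) 𝓘(ℝ, ℝ) ∞ (pr i) := fun i => (pr i).contDiff.contMDiff
  have hxs : ContMDiffOn 𝓘(ℝ, Euc 2) (𝓡 d) ∞ (fun z : Euc 2 => x (pr 0 z)) Set.univ :=
    (hx.comp (hpr 0)).contMDiffOn
  have hγs : SmoothIntoSpinOn 𝓘(ℝ, Euc 2) (fun z : Euc 2 => (γ (pr 1 z) : Spin33)) Set.univ :=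
    hγ.comp (hpr 1).contMDiffOn fun _ _ => Set.mem_univ _
  have hf : ContMDiff (𝓡 2) (𝓡 d) ∞ f := by
    rw [← contMDiffOn_univ]
    exact hP.contMDiffOn_act isOpen_univ hxs hγs
  let Θ : Euc 2 → Euc 2 →ₗ[ℝ] Mat33 := fun z =>
    θ.mat (f z) ∘ₗ (mD (Euc 2) (Euc d) f z : Euc 2 →L[ℝ] Euc d).toLinearMap
  have hprD : ∀ i z z', mD (Euc 2) ℝ (pr i) z z' = z' i := by
    intro i z z'
    rw [mD_eq_fderiv, ContinuousLinearMap.fderiv]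
    rfl
  have hΘ : ∀ z z', Θ z z' = rho (γ (z 1) : Spin33)⁻¹ *
      (z' 0 • θ.mat (x (z 0)) (mD ℝ (Euc d) x (z 0) (1 : ℝ))) * rho (γ (z 1) : Spin33) +
      rho (γ (z 1) : Spin33)⁻¹ * (z' 1 •
        mDMat ℝ (fun t : ℝ => rho (γ t : Spin33)) (z 1) (1 : ℝ)) := by
    intro z z'
    have h1 := hθ.leibniz hP isOpen_univ (n := z) (Set.mem_univ _) hxs hγs z'
    have h2 : mD (Euc 2) (Euc d) (fun z : Euc 2 => x (pr 0 z)) z z' =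
        z' 0 • mD ℝ (Euc d) x (z 0) (1 : ℝ) := by
      rw [mD_comp (g := x) (hx.mdifferentiableAt (by simp))
        ((hpr 0).mdifferentiableAt (by simp)), hprD, ← map_smul, smul_eq_mul, mul_one]
      rfl
    have h3 : mDMat (Euc 2) (fun z : Euc 2 => rho (γ (pr 1 z) : Spin33)) z z' =
        z' 1 • mDMat ℝ (fun t : ℝ => rho (γ t : Spin33)) (z 1) (1 : ℝ) := by
      rw [mDMat_comp (F := fun t : ℝ => rho (γ t : Spin33)) (hRd _)
        ((hpr 1).mdifferentiableAt (by simp)), hprD, ← mDMat_smul, smul_eq_mul, mul_one]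
      rfl
    rw [h2, h3, map_smul] at h1
    exact h1
  have hf0 : f 0 = u := by
    change act (x 0) (γ 0) = u
    rw [hx0, hγ0, hP.act_one]
  let e₀ : Euc 2 := EuclideanSpace.single 0 1
  let e₁ : Euc 2 := EuclideanSpace.single 1 1
  have hΘ0 : ∀ t : ℝ, Θ (0 + t • e₁) e₀ =
      rho (γ t : Spin33)⁻¹ * θ.mat u w * rho (γ t : Spin33) := by
    intro t
    rw [hΘ]
    simp [e₀, e₁, hx0, hxv]
  have hΘ1 : ∀ t : ℝ, Θ (0 + t • e₀) e₁ = Γ := by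
    intro t
    rw [hΘ]
    simp [e₀, e₁, hγ0, hΓ]
  have hinj : Function.Injective (θ.mat u) := fun a b hab =>
    (hθ.bijective u).1 (Subtype.ext hab)
  have hz : (0 : Euc 2) = 0 + (0 : ℝ) • e₁ := by simp
  have hz' : (0 : Euc 2) = 0 + (0 : ℝ) • e₀ := by simp
  have he₀ : mD (Euc 2) (Euc d) f 0 e₀ = w := by
    apply hinj
    have h1 : Θ 0 e₀ = θ.mat u w := by
      rw [hz, hΘ0, hγ0]; simp
    rw [← h1]
    change _ = θ.mat (f 0) (mD (Euc 2) (Euc d) f 0 e₀)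
    rw [hf0]
  have he₁ : mD (Euc 2) (Euc d) f 0 e₁ = ξ := by
    apply hinj
    have h1 : Θ 0 e₁ = θ.mat u ξ := by
      rw [hz', hΘ1, hΓξ]
    rw [← h1]
    change _ = θ.mat (f 0) (mD (Euc 2) (Euc d) f 0 e₁)
    rw [hf0]
  have hΘs : SmoothMatForm Θ := fun i j => (hθ.smoothMatForm i j).pullback hf
  have hpull := curvMat_pullback hf hθ.smoothMatForm (Θ' := Θ) (fun _ _ => rfl) 0 e₁ e₀
  rw [he₀, he₁, hf0] at hpull
  rw [← hpull, curvMat, dMat_vectorSpace hΘs]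
  simp only [hΘ0, hΘ1, mDMat_const]
  have hRi : DiffMatAt ℝ (fun t : ℝ => rho (γ t : Spin33)⁻¹) 0 := fun i j =>
    mdiffAt_of_on (hγ.inv.rho_apply i j) isOpen_univ (Set.mem_univ _)
  have h1 : Θ 0 e₀ = θ.mat u w := by
    rw [hz, hΘ0, hγ0]; simp
  have h2 : Θ 0 e₁ = Γ := by rw [hz', hΘ1]
  rw [h1, h2, mDMat_mul (F := fun t : ℝ => rho (γ t : Spin33)⁻¹ * θ.mat u w)
    (hRi.mul (diffMatAt_const _ _)) (hRd 0), mDMat_mul hRi (diffMatAt_const _ _), mDMat_const,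
    mDMat_rho_inv isOpen_univ (Set.mem_univ _) hγ, ← hΓ, hγ0, Ring.lie_def]
  simp
  abel

end Vertical

/-! ### The orthogonal Lie algebra -/

section Algebra

lemma mat_ext {A B : Mat33} (h : ∀ v, A *ᵥ v = B *ᵥ v) : A = B :=
  Matrix.toLin'.injective (LinearMap.ext h)

lemma hForm_eq_dotProduct (v w : Vec33) :
    hForm v w = v ⬝ᵥ (LieAlgebra.Orthogonal.JD (Fin 3) ℝ *ᵥ w) := by
  simp [hForm, LieAlgebra.Orthogonal.JD, Matrix.fromBlocks_mulVec, dotProduct, eComp_apply,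
    fComp_apply, mul_comm, add_comm]

lemma mem_conformal_iff {X : Mat33} :
    X ∈ conformal.alg ↔ ∀ v w, hForm (X *ᵥ v) w = -hForm v (X *ᵥ w) := by
  change X ∈ LieAlgebra.Orthogonal.typeD (Fin 3) ℝ ↔ _
  rw [LieAlgebra.Orthogonal.typeD, mem_skewAdjointMatricesLieSubalgebra,
    mem_skewAdjointMatricesSubmodule, Matrix.IsSkewAdjoint, Matrix.IsAdjointPair]
  have h1 : ∀ v w, hForm (X *ᵥ v) w = v ⬝ᵥ ((Xᵀ * LieAlgebra.Orthogonal.JD (Fin 3) ℝ) *ᵥ w) := by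
    intro v w
    rw [hForm_eq_dotProduct, ← Matrix.mulVec_mulVec, Matrix.dotProduct_mulVec v Xᵀ,
      Matrix.vecMul_transpose]
  have h2 : ∀ v w, -hForm v (X *ᵥ w) =
      v ⬝ᵥ ((LieAlgebra.Orthogonal.JD (Fin 3) ℝ * -X) *ᵥ w) := by
    intro v w
    rw [hForm_eq_dotProduct, ← Matrix.mulVec_mulVec, Matrix.neg_mulVec, Matrix.mulVec_neg,
      dotProduct_neg]
  simp only [h1, h2]
  refine ⟨fun h v w => by rw [h], fun h => mat_ext fun w => ?_⟩
  ext i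
  simpa using h (Pi.single i 1) w

lemma conformal_skew (X : conformal.alg) (v w : Vec33) :
    hForm ((X : Mat33) *ᵥ v) w = -hForm v ((X : Mat33) *ᵥ w) := mem_conformal_iff.1 X.2 v w

lemma skew_self {X : Mat33} (hX : X ∈ conformal.alg) (v : Vec33) : hForm v (X *ᵥ v) = 0 := by
  have := mem_conformal_iff.1 hX v v
  rw [hForm_comm] at this
  linarith

/-- The covector `h(b, ·)`. -/
def flat (b : Vec33) : Vec33 := Sum.elim (fComp b) (eComp b)

lemma flat_dotProduct (b v : Vec33) : flat b ⬝ᵥ v = hForm b v := by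
  simp [flat, hForm, dotProduct, eComp_apply, fComp_apply, mul_comm]

/-- The element `a ∧ b` of the orthogonal Lie algebra, `v ↦ h(b, v) a - h(a, v) b`. -/
def wedge (a b : Vec33) : Mat33 := Matrix.vecMulVec a (flat b) - Matrix.vecMulVec b (flat a)

lemma wedge_mulVec (a b v : Vec33) : wedge a b *ᵥ v = hForm b v • a - hForm a v • b := by
  rw [wedge, Matrix.sub_mulVec, Matrix.vecMulVec_mulVec, Matrix.vecMulVec_mulVec, flat_dotProduct,
    flat_dotProduct]
  ext i
  simp [mul_comm]

lemma wedge_mem (a b : Vec33) : wedge a b ∈ conformal.alg := by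
  rw [mem_conformal_iff]
  intro v w
  simp only [wedge_mulVec, hForm_sub_left, hForm_sub_right, hForm_smul_left, hForm_smul_right,
    hForm_comm v a, hForm_comm v b]
  ring

lemma lie_wedge {X : Mat33} (hX : X ∈ conformal.alg) (a b : Vec33) :
    ⁅X, wedge a b⁆ = wedge (X *ᵥ a) b + wedge a (X *ᵥ b) := by
  rw [mem_conformal_iff] at hX
  refine mat_ext fun v => ?_
  rw [Ring.lie_def, Matrix.sub_mulVec, ← Matrix.mulVec_mulVec, ← Matrix.mulVec_mulVec,
    Matrix.add_mulVec]
  simp only [wedge_mulVec, Matrix.mulVec_sub, Matrix.mulVec_smul, hX]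
  module

lemma wedge_add_left (a a' b : Vec33) : wedge (a + a') b = wedge a b + wedge a' b := by
  refine mat_ext fun v => ?_
  simp only [wedge_mulVec, Matrix.add_mulVec, hForm_add_left]
  module

lemma wedge_smul_left (c : ℝ) (a b : Vec33) : wedge (c • a) b = c • wedge a b := by
  refine mat_ext fun v => ?_
  simp only [wedge_mulVec, Matrix.smul_mulVec, hForm_smul_left]
  module

lemma wedge_swap (a b : Vec33) : wedge a b = -wedge b a := by
  refine mat_ext fun v => ?_
  simp only [wedge_mulVec, Matrix.neg_mulVec]
  module

lemma wedge_add_right (a b b' : Vec33) : wedge a (b + b') = wedge a b + wedge a b' := by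
  rw [wedge_swap, wedge_add_left, wedge_swap b, wedge_swap b']; abel

lemma wedge_smul_right (c : ℝ) (a b : Vec33) : wedge a (c • b) = c • wedge a b := by
  rw [wedge_swap, wedge_smul_left, wedge_swap b, smul_neg, neg_neg]

lemma wedge_sub_right (a b b' : Vec33) : wedge a (b - b') = wedge a b - wedge a b' := by
  rw [sub_eq_add_neg, ← neg_one_smul ℝ b', wedge_add_right, wedge_smul_right, neg_one_smul,
    sub_eq_add_neg]

lemma wedge_sub_left (a a' b : Vec33) : wedge (a - a') b = wedge a b - wedge a' b := by
  rw [wedge_swap, wedge_sub_right, wedge_swap b, wedge_swap b]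
  abel

lemma wedge_self (a : Vec33) : wedge a a = 0 := by
  refine mat_ext fun v => ?_
  simp [wedge_mulVec]

lemma wedge_zero_right (a : Vec33) : wedge a 0 = 0 := by
  refine mat_ext fun v => ?_
  simp [wedge_mulVec, hForm_zero_left]

lemma wedge_sum_right {ι : Type*} (s : Finset ι) (a : Vec33) (f : ι → Vec33) :
    wedge a (∑ i ∈ s, f i) = ∑ i ∈ s, wedge a (f i) := by
  classical
  induction s using Finset.induction_on with
  | empty => simp [wedge_zero_right]
  | insert i s hi ih => rw [Finset.sum_insert hi, Finset.sum_insert hi, wedge_add_right, ih]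

lemma trace_wedge_mul (a b : Vec33) (Z : Mat33) :
    (wedge a b * Z).trace = hForm b (Z *ᵥ a) - hForm a (Z *ᵥ b) := by
  rw [wedge, sub_mul, Matrix.trace_sub, Matrix.vecMulVec_mul, Matrix.vecMulVec_mul,
    Matrix.trace_vecMulVec, Matrix.trace_vecMulVec, dotProduct_comm, ← Matrix.dotProduct_mulVec,
    dotProduct_comm b, ← Matrix.dotProduct_mulVec, flat_dotProduct, flat_dotProduct]

/-! ### Killing forms -/

lemma sum_mul_single_mul {n : Type*} [Fintype n] [DecidableEq n] (L R : Matrix n n ℝ) :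
    ∑ i, ∑ j, (L * Matrix.single i j (1 : ℝ) * R : Matrix n n ℝ) i j = L.trace * R.trace := by
  simp only [Matrix.trace, Matrix.diag, Finset.sum_mul_sum]
  refine Finset.sum_congr rfl fun i _ => Finset.sum_congr rfl fun j _ => ?_
  rw [Matrix.mul_apply, Finset.sum_eq_single j]
  · simp
  · intro k _ hk
    rw [Matrix.mul_single_apply_of_ne _ _ _ _ _ hk, zero_mul]
  · simp

lemma sum_mul_single_transpose_mul {n : Type*} [Fintype n] [DecidableEq n] (L R : Matrix n n ℝ) :
    ∑ i, ∑ j, (L * (Matrix.single i j (1 : ℝ))ᵀ * R : Matrix n n ℝ) i j = (L * Rᵀ).trace := by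
  simp only [Matrix.trace, Matrix.diag, Matrix.transpose_single]
  refine Finset.sum_congr rfl fun i _ => ?_
  rw [Matrix.mul_apply]
  refine Finset.sum_congr rfl fun j _ => ?_
  rw [Matrix.mul_apply, Finset.sum_eq_single i]
  · simp
  · intro k _ hk
    rw [Matrix.mul_single_apply_of_ne _ _ _ _ _ hk, zero_mul]
  · simp

/-- The Killing form of a Lie algebra of matrices, as a trace over all matrices, by means of a
projection onto the Lie algebra. -/
lemma killingForm_eq_sum (𝔤 : LieSubalgebra ℝ Mat33) (P : Mat33 →ₗ[ℝ] 𝔤)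
    (hP : ∀ x : 𝔤, P (x : Mat33) = x) (X Y : 𝔤) :
    killingForm ℝ 𝔤 X Y = ∑ i, ∑ j,
      (⁅(X : Mat33), ⁅(Y : Mat33), (P (Matrix.single i j 1) : Mat33)⁆⁆ : Mat33) i j := by
  change LinearMap.trace ℝ 𝔤 (LieAlgebra.ad ℝ 𝔤 X ∘ₗ LieAlgebra.ad ℝ 𝔤 Y) = _
  have h1 : (LieAlgebra.ad ℝ 𝔤 X ∘ₗ LieAlgebra.ad ℝ 𝔤 Y) =
      (LieAlgebra.ad ℝ 𝔤 X ∘ₗ LieAlgebra.ad ℝ 𝔤 Y ∘ₗ P) ∘ₗ 𝔤.toSubmodule.subtype := by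
    refine LinearMap.ext fun x => ?_
    simp only [LinearMap.comp_apply]
    rw [show P (𝔤.toSubmodule.subtype x) = x from hP x]
  rw [h1, LinearMap.trace_comp_comm', LinearMap.trace_eq_matrix_trace ℝ
    (Matrix.stdBasis ℝ (Fin 3 ⊕ Fin 3) (Fin 3 ⊕ Fin 3)), Matrix.trace, Fintype.sum_prod_type]
  refine Finset.sum_congr rfl fun i _ => Finset.sum_congr rfl fun j _ => ?_
  rw [Matrix.diag, LinearMap.toMatrix_apply, Matrix.stdBasis_eq_single]
  rfl

lemma JD_transpose :
    (LieAlgebra.Orthogonal.JD (Fin 3) ℝ)ᵀ = LieAlgebra.Orthogonal.JD (Fin 3) ℝ := by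
  simp [LieAlgebra.Orthogonal.JD, Matrix.fromBlocks_transpose]

lemma JD_mul_JD :
    LieAlgebra.Orthogonal.JD (Fin 3) ℝ * LieAlgebra.Orthogonal.JD (Fin 3) ℝ = 1 := by
  simp [LieAlgebra.Orthogonal.JD, Matrix.fromBlocks_multiply]

lemma mem_conformal_iff_transpose {X : Mat33} : X ∈ conformal.alg ↔
    LieAlgebra.Orthogonal.JD (Fin 3) ℝ * Xᵀ * LieAlgebra.Orthogonal.JD (Fin 3) ℝ = -X := by
  change X ∈ LieAlgebra.Orthogonal.typeD (Fin 3) ℝ ↔ _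
  rw [LieAlgebra.Orthogonal.typeD, mem_skewAdjointMatricesLieSubalgebra,
    mem_skewAdjointMatricesSubmodule, Matrix.IsSkewAdjoint, Matrix.IsAdjointPair, mul_assoc]
  constructor
  · intro h
    rw [h, ← mul_assoc, JD_mul_JD, one_mul]
  · intro h
    rw [← h, ← mul_assoc, JD_mul_JD, one_mul]

/-- The Killing form of `so(3,3)` is four times the trace form. -/
lemma killingForm_conformal (X Y : conformal.alg) :
    killingForm ℝ conformal.alg X Y = 4 * ((X : Mat33) * (Y : Mat33)).trace := by
  set J := LieAlgebra.Orthogonal.JD (Fin 3) ℝ with hJ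
  have hJJ : J * J = 1 := JD_mul_JD
  have hJT : Jᵀ = J := JD_transpose
  let P : Mat33 →ₗ[ℝ] conformal.alg := LinearMap.codRestrict conformal.alg.toSubmodule
    { toFun := fun M => (1 / 2 : ℝ) • (M - J * Mᵀ * J)
      map_add' := fun M N => by
        rw [Matrix.transpose_add, mul_add, add_mul, ← smul_add]; congr 1; abel
      map_smul' := fun c M => by
        simp only [Matrix.transpose_smul, Matrix.mul_smul, Matrix.smul_mul, ← smul_sub,
          RingHom.id_apply]
        exact smul_comm _ _ _ }
    (fun M => by
      change (1 / 2 : ℝ) • (M - J * Mᵀ * J) ∈ conformal.alg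
      rw [mem_conformal_iff_transpose, ← hJ, Matrix.transpose_smul, Matrix.transpose_sub,
        Matrix.transpose_mul, Matrix.transpose_mul, Matrix.transpose_transpose, hJT,
        Matrix.mul_smul, Matrix.smul_mul, mul_sub, sub_mul, ← smul_neg, neg_sub]
      congr 2
      rw [← mul_assoc J J, hJJ, one_mul, mul_assoc, hJJ, mul_one])
  have hPv : ∀ M, (P M : Mat33) = (1 / 2 : ℝ) • (M - J * Mᵀ * J) := fun M => rfl
  have hP : ∀ x : conformal.alg, P (x : Mat33) = x := by
    intro x
    apply Subtype.ext
    rw [hPv, mem_conformal_iff_transpose.1 x.2]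
    module
  have hX := mem_conformal_iff_transpose.1 X.2
  have hY := mem_conformal_iff_transpose.1 Y.2
  rw [← hJ] at hX hY
  rw [killingForm_eq_sum _ P hP]
  generalize (X : Mat33) = A at *
  generalize (Y : Mat33) = B at *
  have htr : A.trace = 0 := by
    have := congrArg Matrix.trace hX
    rw [Matrix.trace_mul_comm, ← mul_assoc, hJJ, one_mul, Matrix.trace_transpose,
      Matrix.trace_neg] at this
    linarith
  have hsum : ∀ M : Mat33, ⁅A, ⁅B, (1 / 2 : ℝ) • (M - J * Mᵀ * J)⁆⁆ = (1 / 2 : ℝ) •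
      ((A * B * M * 1 - A * M * B - B * M * A + 1 * M * (B * A)) -
      (A * B * J * Mᵀ * J - A * J * Mᵀ * (J * B) - B * J * Mᵀ * (J * A) +
        J * Mᵀ * (J * B * A))) := by
    intro M
    simp only [Ring.lie_def, mul_one, one_mul, mul_sub, sub_mul, mul_smul_comm, smul_mul_assoc,
      smul_sub, smul_add, mul_assoc]
    abel
  simp only [hPv, hsum, Matrix.smul_apply, Matrix.sub_apply, Matrix.add_apply, smul_eq_mul,
    ← Finset.mul_sum, Finset.sum_sub_distrib, Finset.sum_add_distrib, sum_mul_single_mul,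
    sum_mul_single_transpose_mul, Matrix.transpose_mul, hJT, htr]
  have e1 : (A * B * J * J).trace = (A * B).trace := by rw [mul_assoc, hJJ, mul_one]
  have e2 : (A * J * (Bᵀ * J)).trace = -(A * B).trace := by
    rw [mul_assoc, ← mul_assoc J, hY, mul_neg, Matrix.trace_neg]
  have e3 : (B * J * (Aᵀ * J)).trace = -(A * B).trace := by
    rw [mul_assoc, ← mul_assoc J, hX, mul_neg, Matrix.trace_neg, Matrix.trace_mul_comm]
  have e4 : (J * (Aᵀ * (Bᵀ * J))).trace = (A * B).trace := by
    rw [Matrix.trace_mul_comm, mul_assoc, mul_assoc, hJJ, mul_one, ← Matrix.transpose_mul,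
      Matrix.trace_transpose, Matrix.trace_mul_comm]
  rw [e1, e2, e3, e4, Matrix.trace_mul_comm B A]
  simp only [Matrix.trace_one, Fintype.card_sum, Fintype.card_fin]
  push_cast
  ring

lemma mem_projective_iff {X : Mat33} : X ∈ projective.alg ↔
    ∃ A : Matrix (Fin 3) (Fin 3) ℝ, A.trace = 0 ∧ X = Matrix.fromBlocks A 0 0 (-Aᵀ) := by
  constructor
  · rintro ⟨A, hA⟩
    exact ⟨A.1, A.2, hA.symm⟩
  · rintro ⟨A, hA, rfl⟩
    exact ⟨⟨A, hA⟩, rfl⟩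

/-- The Killing form of `sl(3)` is six times the trace form of the `3 × 3` matrices, so three times
that of the matrices `diag(A, -Aᵗ)`. -/
lemma killingForm_projective (X Y : projective.alg) :
    killingForm ℝ projective.alg X Y = 3 * ((X : Mat33) * (Y : Mat33)).trace := by
  let pr : Mat33 →ₗ[ℝ] LieAlgebra.SpecialLinear.sl (Fin 3) ℝ := LinearMap.codRestrict
    (LieAlgebra.SpecialLinear.sl (Fin 3) ℝ).toSubmodule
    { toFun := fun M => M.toBlocks₁₁ - (M.toBlocks₁₁.trace / 3) • 1
      map_add' := fun M N => by
        have : (M + N).toBlocks₁₁ = M.toBlocks₁₁ + N.toBlocks₁₁ := rfl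
        rw [this, Matrix.trace_add]
        module
      map_smul' := fun c M => by
        have : (c • M).toBlocks₁₁ = c • M.toBlocks₁₁ := rfl
        rw [this, Matrix.trace_smul, smul_eq_mul, RingHom.id_apply]
        module }
    (fun M => by
      change (M.toBlocks₁₁ - (M.toBlocks₁₁.trace / 3) • 1).trace = 0
      rw [Matrix.trace_sub, Matrix.trace_smul, Matrix.trace_one]
      simp)
  let P : Mat33 →ₗ[ℝ] projective.alg := slEmbedding.rangeRestrict.toLinearMap ∘ₗ pr
  have hPv : ∀ M, (P M : Mat33) = Matrix.fromBlocks
      (M.toBlocks₁₁ - (M.toBlocks₁₁.trace / 3) • 1) 0 0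
      (-(M.toBlocks₁₁ - (M.toBlocks₁₁.trace / 3) • 1)ᵀ) := fun M => rfl
  have hP : ∀ x : projective.alg, P (x : Mat33) = x := by
    intro x
    obtain ⟨A, hA, hx⟩ := mem_projective_iff.1 x.2
    apply Subtype.ext
    rw [hPv, hx, Matrix.toBlocks_fromBlocks₁₁, hA]
    simp
  rw [killingForm_eq_sum _ P hP]
  obtain ⟨A, hA, hX⟩ := mem_projective_iff.1 X.2
  obtain ⟨B, hB, hY⟩ := mem_projective_iff.1 Y.2
  simp only [hPv, hX, hY]
  have h0 : ∀ C : Matrix (Fin 3) (Fin 3) ℝ, ⁅Matrix.fromBlocks A 0 0 (-Aᵀ),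
      ⁅Matrix.fromBlocks B 0 0 (-Bᵀ), Matrix.fromBlocks C 0 0 (-Cᵀ)⁆⁆ =
      Matrix.fromBlocks ⁅A, ⁅B, C⁆⁆ 0 0 ⁅-Aᵀ, ⁅-Bᵀ, -Cᵀ⁆⁆ := by
    intro C
    have hsub : ∀ P Q P' Q' : Matrix (Fin 3) (Fin 3) ℝ, Matrix.fromBlocks P 0 0 Q -
        Matrix.fromBlocks P' 0 0 Q' = Matrix.fromBlocks (P - P') 0 0 (Q - Q') := by
      intro P Q P' Q'
      ext (i | i) (j | j) <;> simp
    simp only [Ring.lie_def, Matrix.fromBlocks_multiply, mul_zero, zero_mul, add_zero, zero_add,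
      hsub]
  have h1 : ∀ M : Matrix (Fin 3) (Fin 3) ℝ, ⁅A, ⁅B, M - (M.trace / 3) • (1 : Matrix _ _ ℝ)⁆⁆ =
      A * B * M * 1 - A * M * B - B * M * A + 1 * M * (B * A) := by
    intro M
    simp only [Ring.lie_def, mul_one, one_mul, mul_sub, sub_mul, mul_smul_comm, smul_mul_assoc,
      mul_assoc]
    abel
  have hs : ∀ i j : Fin 3, (Matrix.single (Sum.inl i) (Sum.inl j) 1 : Mat33).toBlocks₁₁ =
      Matrix.single i j 1 := by
    intro i j
    ext a b
    simp [Matrix.toBlocks₁₁, Matrix.single_apply]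
  have hs2 : ∀ i j : Fin 3, (Matrix.single (Sum.inr i) (Sum.inr j) 1 : Mat33).toBlocks₁₁ = 0 := by
    intro i j
    ext a b
    simp [Matrix.toBlocks₁₁]
  simp only [Fintype.sum_sum_type, h0, Matrix.fromBlocks_apply₁₁, Matrix.fromBlocks_apply₁₂,
    Matrix.fromBlocks_apply₂₁, Matrix.fromBlocks_apply₂₂, hs, hs2, h1, Matrix.sub_apply,
    Matrix.add_apply, Finset.sum_sub_distrib, Finset.sum_add_distrib, sum_mul_single_mul, hA]
  have htr : ∀ P Q : Matrix (Fin 3) (Fin 3) ℝ, (Matrix.fromBlocks P 0 0 Q).trace =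
      P.trace + Q.trace := by
    intro P Q
    simp [Matrix.trace, Fintype.sum_sum_type]
  rw [Matrix.fromBlocks_multiply]
  simp only [mul_zero, add_zero, zero_add, zero_mul, htr]
  rw [Matrix.trace_mul_comm B A]
  have : (-Aᵀ * -Bᵀ).trace = (A * B).trace := by
    rw [neg_mul_neg, ← Matrix.transpose_mul, Matrix.trace_transpose, Matrix.trace_mul_comm]
  simp only [this]
  simp [Matrix.trace_one]
  ring

end Algebra

/-! ### Frames adapted to the null line -/

section Frames

/-- The null vector `(f₁ + e₃) / 2`, dual to `ṽ₊`. -/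
def vBar : Vec33 := Sum.elim ![0, 0, 1 / 2] ![1 / 2, 0, 0]

/-- The vectors `e₂, f₂, e₁ - f₃, e₃ - f₁`, a basis of the orthogonal complement of `ṽ₊` and
`vBar`. -/
def frameA : Fin 4 → Vec33 :=
  ![Sum.elim ![0, 1, 0] 0, Sum.elim 0 ![0, 1, 0], Sum.elim ![1, 0, 0] ![0, 0, -1],
    Sum.elim ![0, 0, 1] ![-1, 0, 0]]

/-- The basis dual to `frameA` with respect to `h`. -/
def frameB : Fin 4 → Vec33 :=
  ![Sum.elim 0 ![0, 1, 0], Sum.elim ![0, 1, 0] 0, Sum.elim ![0, 0, -1 / 2] ![1 / 2, 0, 0],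
    Sum.elim ![-1 / 2, 0, 0] ![0, 0, 1 / 2]]

lemma hForm_def (v w : Vec33) : hForm v w =
    v (Sum.inr 0) * w (Sum.inl 0) + v (Sum.inr 1) * w (Sum.inl 1) + v (Sum.inr 2) * w (Sum.inl 2) +
    (w (Sum.inr 0) * v (Sum.inl 0) + w (Sum.inr 1) * v (Sum.inl 1) +
      w (Sum.inr 2) * v (Sum.inl 2)) := by
  simp [hForm, dotProduct, Fin.sum_univ_three, eComp_apply, fComp_apply]

lemma hForm_vTilde_self : hForm vTilde vTilde = 0 := by simp [hForm_def, vTilde]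

lemma hForm_vTilde_vBar : hForm vTilde vBar = 1 := by simp [hForm_def, vTilde, vBar]; norm_num

lemma hForm_vTilde_frameA (i : Fin 4) : hForm vTilde (frameA i) = 0 := by
  fin_cases i <;> simp [hForm_def, vTilde, frameA]

lemma hForm_vTilde_frameB (i : Fin 4) : hForm vTilde (frameB i) = 0 := by
  fin_cases i <;> simp [hForm_def, vTilde, frameB]
  norm_num

lemma hForm_vBar_frameA (i : Fin 4) : hForm vBar (frameA i) = 0 := by
  fin_cases i <;> simp [hForm_def, vBar, frameA]

lemma hForm_frameB_frameA (i j : Fin 4) :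
    hForm (frameB i) (frameA j) = if i = j then 1 else 0 := by
  fin_cases i <;> fin_cases j <;> simp [hForm_def, frameA, frameB] <;> norm_num

lemma vec_decomp_frameA (v : Vec33) : v = hForm vBar v • vTilde + hForm vTilde v • vBar +
    ∑ i, hForm (frameB i) v • frameA i := by
  ext (i | i) <;> fin_cases i <;>
    simp [hForm_def, vBar, vTilde, frameA, frameB, Fin.sum_univ_four] <;> ring

lemma vec_decomp_frameB (v : Vec33) : v = hForm vBar v • vTilde + hForm vTilde v • vBar +
    ∑ i, hForm (frameA i) v • frameB i := by
  ext (i | i) <;> fin_cases i <;>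
    simp [hForm_def, vBar, vTilde, frameA, frameB, Fin.sum_univ_four] <;> ring

/-- A vector of `ṽ₊^⊥` that is orthogonal to `frameA` lies on the line of `ṽ₊`. -/
lemma eq_smul_vTilde {v : Vec33} (h : hForm vTilde v = 0) (ha : ∀ i, hForm (frameA i) v = 0) :
    v = hForm vBar v • vTilde := by
  conv_lhs => rw [vec_decomp_frameB v]
  simp [h, ha]

lemma eq_smul_vTilde' {v : Vec33} (h : hForm vTilde v = 0) (hb : ∀ i, hForm (frameB i) v = 0) :
    v = hForm vBar v • vTilde := by
  conv_lhs => rw [vec_decomp_frameA v]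
  simp [h, hb]

/-- The elements of `so(3,3)` as sums of decomposable ones. -/
lemma so_decomp {X : Mat33} (hX : X ∈ conformal.alg) : X = (1 / 2 : ℝ) •
    (wedge (X *ᵥ vTilde) vBar + wedge (X *ᵥ vBar) vTilde +
      ∑ i, wedge (X *ᵥ frameA i) (frameB i)) := by
  rw [mem_conformal_iff] at hX
  refine mat_ext fun v => ?_
  have h1 : X *ᵥ v = hForm vBar v • (X *ᵥ vTilde) + hForm vTilde v • (X *ᵥ vBar) +
      ∑ i, hForm (frameB i) v • (X *ᵥ frameA i) := by
    conv_lhs => rw [vec_decomp_frameA v]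
    simp only [Matrix.mulVec_add, Matrix.mulVec_smul, Matrix.mulVec_sum]
  have h2 := vec_decomp_frameB (X *ᵥ v)
  rw [Matrix.smul_mulVec, Matrix.add_mulVec, Matrix.add_mulVec, Matrix.sum_mulVec]
  simp only [wedge_mulVec, hX, Finset.sum_sub_distrib, neg_smul, Finset.sum_neg_distrib]
  have h3 : hForm vBar v • (X *ᵥ vTilde) - -(hForm vTilde (X *ᵥ v) • vBar) +
      (hForm vTilde v • (X *ᵥ vBar) - -(hForm vBar (X *ᵥ v) • vTilde)) +
      (∑ i, hForm (frameB i) v • (X *ᵥ frameA i) - -∑ i, hForm (frameA i) (X *ᵥ v) • frameB i) =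
      X *ᵥ v + X *ᵥ v := by
    conv_rhs => rw [h1]
    conv_rhs => rw [← h1, h2]
    conv_rhs =>
      enter [1]
      rw [← h2, h1]
    abel
  rw [h3]
  module

/-- The coordinates on `so(3,3) / 𝔭̃`: the components of `X ṽ₊` with respect to `frameA`. -/
def conformalQuot : conformal.alg →ₗ[ℝ] (Fin 4 → ℝ) where
  toFun X := fun i => hForm (frameB i) ((X : Mat33) *ᵥ vTilde)
  map_add' X Y := by
    funext i
    simp [Matrix.add_mulVec, hForm_add_right]
  map_smul' c X := by
    funext i
    simp [Matrix.smul_mulVec, hForm_smul_right]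

lemma conformalQuot_apply (X : conformal.alg) (i : Fin 4) :
    conformalQuot X i = hForm (frameB i) ((X : Mat33) *ᵥ vTilde) := rfl

lemma mem_parabolicAlg_conformal {X : conformal.alg} :
    X ∈ conformal.parabolicAlg ↔ conformalQuot X = 0 := by
  constructor
  · rintro ⟨c, hc⟩
    funext i
    change (X : Mat33) *ᵥ vTilde = c • vTilde at hc
    rw [conformalQuot_apply, hc, hForm_smul_right, hForm_comm, hForm_vTilde_frameB]
    simp
  · intro h
    exact ⟨_, eq_smul_vTilde' (skew_self X.2 _) fun i => congrFun h i⟩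

/-- The element `aᵢ ∧ vBar`, which maps `ṽ₊` to `aᵢ`. -/
def stdA (i : Fin 4) : conformal.alg := ⟨wedge (frameA i) vBar, wedge_mem _ _⟩

/-- The dual basis of `𝔭̃₊`. -/
def stdZ (i : Fin 4) : conformal.alg :=
  ⟨(1 / 8 : ℝ) • wedge vTilde (frameB i), conformal.alg.smul_mem _ (wedge_mem _ _)⟩

lemma stdA_vTilde (i : Fin 4) : (stdA i : Mat33) *ᵥ vTilde = frameA i := by
  change wedge (frameA i) vBar *ᵥ vTilde = _
  rw [wedge_mulVec, hForm_comm, hForm_vTilde_vBar, hForm_comm, hForm_vTilde_frameA]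
  simp

lemma killingForm_stdZ (X : conformal.alg) (j : Fin 4) :
    killingForm ℝ conformal.alg X (stdZ j) = conformalQuot X j := by
  rw [killingForm_conformal, Matrix.trace_mul_comm]
  change 4 * ((1 / 8 : ℝ) • wedge vTilde (frameB j) * (X : Mat33)).trace = _
  rw [Matrix.smul_mul, Matrix.trace_smul, trace_wedge_mul, conformalQuot_apply,
    ← neg_eq_iff_eq_neg.2 (conformal_skew X vTilde (frameB j)), hForm_comm (frameB j), smul_eq_mul]
  ring

lemma killingForm_conformal_nondegenerate {Z : conformal.alg}
    (h : ∀ X, killingForm ℝ conformal.alg X Z = 0) : Z = 0 := by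
  apply Subtype.ext
  refine mat_ext fun a => ?_
  rw [ZeroMemClass.coe_zero, Matrix.zero_mulVec]
  refine hForm_eq_zero_left fun b => ?_
  have h1 := h ⟨wedge a b, wedge_mem a b⟩
  rw [killingForm_conformal] at h1
  change 4 * (wedge a b * (Z : Mat33)).trace = 0 at h1
  rw [trace_wedge_mul, ← neg_eq_iff_eq_neg.2 (conformal_skew Z a b), hForm_comm b] at h1
  linarith

/-- Dual frames from coordinates on the quotient by the parabolic subalgebra. -/
lemma isDualFrame_of_quot {𝔪 : Model} {n : ℕ} (q : 𝔪.alg →ₗ[ℝ] (Fin n → ℝ))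
    (hq : ∀ X, X ∈ 𝔪.parabolicAlg ↔ q X = 0) {A Z : Fin n → 𝔪.alg}
    (hA : ∀ i j, q (A i) j = if i = j then 1 else 0)
    (hZ : ∀ X j, killingForm ℝ 𝔪.alg X (Z j) = q X j) : IsDualFrame 𝔪 A Z where
  linearIndependent := by
    have hle : 𝔪.parabolicAlg ≤ LinearMap.ker q := fun X hX => (hq X).1 hX
    refine LinearIndependent.of_comp (𝔪.parabolicAlg.liftQ q hle) ?_
    have : (𝔪.parabolicAlg.liftQ q hle ∘ fun i => 𝔪.parabolicAlg.mkQ (A i)) =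
        fun i => Pi.basisFun ℝ (Fin n) i := by
      funext i j
      simp [hA, Pi.single_apply, eq_comm]
    rw [this]
    exact (Pi.basisFun ℝ (Fin n)).linearIndependent
  span_eq_top := by
    rw [eq_top_iff]
    rintro x -
    obtain ⟨X, rfl⟩ := 𝔪.parabolicAlg.mkQ_surjective x
    rw [Submodule.mem_span_range_iff_exists_fun]
    refine ⟨q X, ?_⟩
    simp only [← map_smul, ← map_sum]
    rw [← sub_eq_zero, ← map_sub, Submodule.mkQ_apply, Submodule.Quotient.mk_eq_zero, hq]
    funext j
    simp [hA]
  mem_nilradical i Y hY := by rw [hZ, (hq Y).1 hY]; rfl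
  dual i j := by rw [hZ, hA]

lemma isDualFrame_std : IsDualFrame conformal stdA stdZ :=
  isDualFrame_of_quot conformalQuot (fun _ => mem_parabolicAlg_conformal)
    (fun i j => by
      rw [conformalQuot_apply, stdA_vTilde, hForm_frameB_frameA]
      simp [eq_comm]) killingForm_stdZ

/-- If `Cⱼ ṽ₊ = aⱼ`, then `X ∈ so(3,3)` agrees with `∑ⱼ qⱼ(X) Cⱼ` up to `𝔭̃`. -/
lemma sub_sum_mem_parabolicAlg {C : Fin 4 → conformal.alg}
    (hC : ∀ j, (C j : Mat33) *ᵥ vTilde = frameA j) (X : conformal.alg) :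
    X - ∑ j, conformalQuot X j • C j ∈ conformal.parabolicAlg := by
  rw [mem_parabolicAlg_conformal]
  have h : ∀ j, conformalQuot (C j) = Pi.single j 1 := by
    intro j
    funext k
    rw [conformalQuot_apply, hC, hForm_frameB_frameA, Pi.single_apply]
  rw [map_sub, map_sum]
  simp only [map_smul, h]
  funext k
  simp [Pi.single_apply]

/-- Contractions of a dual frame do not depend on the frame. -/
lemma IsDualFrame.sum_eq {n : ℕ} {A Z : Fin n → conformal.alg} (h : IsDualFrame conformal A Z)
    {C : Fin 4 → conformal.alg} (hC : ∀ j, (C j : Mat33) *ᵥ vTilde = frameA j)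
    (g : conformal.alg →ₗ[ℝ] conformal.alg →ₗ[ℝ] Mat33)
    (hg : ∀ Y ∈ conformal.parabolicAlg, ∀ W, g Y W = 0) :
    ∑ i, g (A i) (Z i) = ∑ j, g (C j) (stdZ j) := by
  have h1 : ∀ i W, g (A i) W = ∑ j, g (C j) (conformalQuot (A i) j • W) := by
    intro i W
    have h2 := hg _ (sub_sum_mem_parabolicAlg hC (A i)) W
    rw [map_sub, LinearMap.sub_apply, sub_eq_zero] at h2
    rw [h2]
    simp
  have h3 : ∀ j, ∑ i, conformalQuot (A i) j • Z i = stdZ j := by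
    intro j
    rw [← sub_eq_zero]
    refine killingForm_conformal_nondegenerate fun X => ?_
    have hX : conformal.parabolicAlg.mkQ X ∈
        Submodule.span ℝ (Set.range fun i => conformal.parabolicAlg.mkQ (A i)) := by
      rw [h.span_eq_top]; trivial
    obtain ⟨c, hc⟩ := Submodule.mem_span_range_iff_exists_fun ℝ |>.1 hX
    simp only [← map_smul, ← map_sum] at hc
    rw [← sub_eq_zero, ← map_sub, Submodule.mkQ_apply, Submodule.Quotient.mk_eq_zero] at hc
    obtain ⟨Y, hY, rfl⟩ : ∃ Y ∈ conformal.parabolicAlg, X = ∑ i, c i • A i - Y :=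
      ⟨_, hc, by abel⟩
    have hY0 := mem_parabolicAlg_conformal.1 hY
    rw [map_sub (killingForm ℝ conformal.alg _), killingForm_stdZ]
    simp only [map_sub, map_sum, map_smul, LinearMap.sub_apply, LinearMap.sum_apply,
      LinearMap.smul_apply, h.dual, h.mem_nilradical _ Y hY, hY0]
    simp [mul_comm]
  simp only [h1]
  rw [Finset.sum_comm]
  refine Finset.sum_congr rfl fun j _ => ?_
  rw [← map_sum, h3]

/-- `[𝔭̃₊, so(3,3)] ⊆ 𝔭̃`. -/
lemma lie_stdZ_mem (i : Fin 4) (B : conformal.alg) : ⁅stdZ i, B⁆ ∈ conformal.parabolicAlg := by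
  refine ⟨-(1 / 8 : ℝ) * hForm ((B : Mat33) *ᵥ frameB i) vTilde, ?_⟩
  change (⁅(1 / 8 : ℝ) • wedge vTilde (frameB i), (B : Mat33)⁆) *ᵥ vTilde = _ • vTilde
  rw [← lie_skew, lie_smul, lie_wedge B.2, Matrix.neg_mulVec, Matrix.smul_mulVec,
    Matrix.add_mulVec, wedge_mulVec, wedge_mulVec, hForm_comm (frameB i), hForm_vTilde_frameB,
    hForm_comm ((B : Mat33) *ᵥ vTilde), skew_self B.2, hForm_vTilde_self]
  module

end Frames

/-! ### The subalgebra `sl(3)` -/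

section Projective

/-- The matrix `diag(A, -Aᵗ)`. -/
def slMat (A : Matrix (Fin 3) (Fin 3) ℝ) : Mat33 := Matrix.fromBlocks A 0 0 (-Aᵀ)

lemma slMat_mem {A : Matrix (Fin 3) (Fin 3) ℝ} (hA : A.trace = 0) : slMat A ∈ projective.alg :=
  mem_projective_iff.2 ⟨A, hA, rfl⟩

lemma projective_le_conformal : projective.alg ≤ conformal.alg := by
  intro X hX
  obtain ⟨A, -, rfl⟩ := mem_projective_iff.1 hX
  rw [mem_conformal_iff_transpose]
  simp [LieAlgebra.Orthogonal.JD, Matrix.fromBlocks_transpose, Matrix.fromBlocks_multiply,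
    Matrix.fromBlocks_neg]

/-- The coordinates on `sl(3) / 𝔭`. -/
def projectiveQuot : projective.alg →ₗ[ℝ] (Fin 2 → ℝ) where
  toFun X := ![(X : Mat33) (Sum.inl 1) (Sum.inl 0), (X : Mat33) (Sum.inl 2) (Sum.inl 0)]
  map_add' X Y := by ext i; fin_cases i <;> simp
  map_smul' c X := by ext i; fin_cases i <;> simp

lemma mem_parabolicAlg_projective {X : projective.alg} :
    X ∈ projective.parabolicAlg ↔ projectiveQuot X = 0 := by
  obtain ⟨X, hX⟩ := X
  obtain ⟨A, hA, rfl⟩ := mem_projective_iff.1 hX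
  have h0 : Matrix.fromBlocks A 0 0 (-Aᵀ) *ᵥ vPlus = Sum.elim (fun i => A i 0) 0 := by
    ext (i | i)
    · simp [vPlus, Matrix.mulVec, dotProduct, Fin.sum_univ_three]
    · simp [vPlus, Matrix.mulVec, dotProduct]
  constructor
  · rintro ⟨c, hc⟩
    change Matrix.fromBlocks A 0 0 (-Aᵀ) *ᵥ vPlus = c • vPlus at hc
    rw [h0] at hc
    have h1 := congrFun hc (Sum.inl 1)
    have h2 := congrFun hc (Sum.inl 2)
    simp [vPlus] at h1 h2
    ext i
    fin_cases i <;> simp [projectiveQuot, h1, h2]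
  · intro h
    have h1 := congrFun h 0
    have h2 := congrFun h 1
    simp [projectiveQuot] at h1 h2
    refine ⟨A 0 0, ?_⟩
    change Matrix.fromBlocks A 0 0 (-Aᵀ) *ᵥ vPlus = A 0 0 • vPlus
    rw [h0]
    ext (i | i)
    · fin_cases i <;> simp [vPlus, h1, h2]
    · simp [vPlus]

/-- Elements of `sl(3)` that represent a basis of `sl(3) / 𝔭`. -/
def projA : Fin 2 → projective.alg :=
  ![⟨slMat !![0, 0, 0; 1, 0, 0; 0, 0, 0], slMat_mem (by simp [Matrix.trace_fin_three])⟩,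
    ⟨slMat !![0, 0, 0; 0, 0, 0; 1, 0, 0], slMat_mem (by simp [Matrix.trace_fin_three])⟩]

/-- The dual basis of `𝔭₊`. -/
def projZ : Fin 2 → projective.alg :=
  ![⟨slMat !![0, 1 / 6, 0; 0, 0, 0; 0, 0, 0], slMat_mem (by simp [Matrix.trace_fin_three])⟩,
    ⟨slMat !![0, 0, 1 / 6; 0, 0, 0; 0, 0, 0], slMat_mem (by simp [Matrix.trace_fin_three])⟩]

lemma projectiveQuot_projA (i j : Fin 2) :
    projectiveQuot (projA i) j = if i = j then 1 else 0 := by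
  fin_cases i <;> fin_cases j <;> simp [projectiveQuot, projA, slMat]

lemma isDualFrame_proj : IsDualFrame projective projA projZ := by
  refine isDualFrame_of_quot projectiveQuot (fun _ => mem_parabolicAlg_projective)
    projectiveQuot_projA fun X j => ?_
  rw [killingForm_projective]
  obtain ⟨X, hX⟩ := X
  obtain ⟨A, hA, rfl⟩ := mem_projective_iff.1 hX
  fin_cases j <;>
    simp [projZ, slMat, projectiveQuot, Matrix.trace, Matrix.mul_apply, Fin.sum_univ_three] <;> ring

lemma lie_projZ_projA_mem (i j : Fin 2) : ⁅projZ i, projA j⁆ ∈ projective.parabolicAlg := by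
  rw [mem_parabolicAlg_projective]
  ext k
  fin_cases i <;> fin_cases j <;> fin_cases k <;>
    simp [projectiveQuot, projZ, projA, slMat, Ring.lie_def, Matrix.mul_apply, Fin.sum_univ_three]

/-- An element of `sl(3)` that commutes with `𝔭₊` lies in `𝔭₊`, and so kills `e₁`, `f₂` and
`f₃`. -/
lemma mulVec_eq_zero_of_lie_projZ {X : Mat33} (hX : X ∈ projective.alg)
    (h : ∀ i, ⁅X, (projZ i : Mat33)⁆ = 0) :
    X *ᵥ Sum.elim ![1, 0, 0] 0 = 0 ∧ X *ᵥ Sum.elim 0 ![0, 1, 0] = 0 ∧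
      X *ᵥ Sum.elim 0 ![0, 0, 1] = 0 := by
  obtain ⟨A, hA, rfl⟩ := mem_projective_iff.1 hX
  have e : ∀ i k l, (⁅Matrix.fromBlocks A 0 0 (-Aᵀ), (projZ i : Mat33)⁆ : Mat33) k l = 0 :=
    fun i k l => by rw [h i]; rfl
  have e1 := e 0 (Sum.inl 1) (Sum.inl 1)
  have e2 := e 0 (Sum.inl 2) (Sum.inl 1)
  have e3 := e 0 (Sum.inl 0) (Sum.inl 1)
  have e4 := e 0 (Sum.inl 0) (Sum.inl 2)
  have e5 := e 1 (Sum.inl 0) (Sum.inl 2)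
  have e6 := e 1 (Sum.inl 0) (Sum.inl 1)
  simp [projZ, slMat, Ring.lie_def, Matrix.mul_apply, Fin.sum_univ_three] at e1 e2 e3 e4 e5 e6
  rw [Matrix.trace_fin_three] at hA
  have d0 : A 0 0 = 0 := by linarith
  have d1 : A 1 1 = 0 := by linarith
  have d2 : A 2 2 = 0 := by linarith
  refine ⟨?_, ?_, ?_⟩ <;> ext (k | k) <;> fin_cases k <;>
    simp [Matrix.mulVec, dotProduct, Fin.sum_univ_three, d0, d1, d2, e1, e2, e4, e6]

/-- Elements of `sl(3)` that map `ṽ₊` to the members of `frameA`. -/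
def slC : Fin 4 → projective.alg :=
  ![projA 0, ⟨slMat !![0, 0, 0; 0, 0, 0; 0, -1, 0], slMat_mem (by simp [Matrix.trace_fin_three])⟩,
    ⟨slMat !![1, 0, 0; 0, -2, 0; 0, 0, 1], slMat_mem (by simp [Matrix.trace_fin_three]; norm_num)⟩,
    projA 1]

lemma slC_vTilde (i : Fin 4) : (slC i : Mat33) *ᵥ vTilde = frameA i := by
  fin_cases i <;> ext (k | k) <;> fin_cases k <;>
    simp [slC, projA, slMat, vTilde, frameA, Matrix.mulVec, dotProduct, Fin.sum_univ_three]

lemma exists_sl_smul (c : ℝ) : ∃ X ∈ projective.alg, X *ᵥ vTilde = c • vTilde := by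
  refine ⟨slMat !![c, 0, 0; 0, 0, 0; 0, 0, -c], slMat_mem (by simp [Matrix.trace_fin_three]), ?_⟩
  ext (k | k) <;> fin_cases k <;>
    simp [slMat, vTilde, Matrix.mulVec, dotProduct, Fin.sum_univ_three]

/-- A fifteen-parameter family of elements of `so(3,3)`. -/
def soParam : ((Fin 3 → Fin 3 → ℝ) × (Fin 3 → ℝ) × (Fin 3 → ℝ)) →ₗ[ℝ] Mat33 where
  toFun p := Matrix.fromBlocks (Matrix.of p.1)
    !![0, p.2.1 0, p.2.1 1; -p.2.1 0, 0, p.2.1 2; -p.2.1 1, -p.2.1 2, 0]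
    !![0, p.2.2 0, p.2.2 1; -p.2.2 0, 0, p.2.2 2; -p.2.2 1, -p.2.2 2, 0] (-(Matrix.of p.1)ᵀ)
  map_add' p q := by
    ext (i | i) (j | j) <;> fin_cases i <;> fin_cases j <;> simp <;> ring
  map_smul' c p := by
    ext (i | i) (j | j) <;> fin_cases i <;> fin_cases j <;> simp

lemma le_finrank_conformal : 15 ≤ Module.finrank ℝ conformal.alg := by
  have hmem : ∀ p, soParam p ∈ conformal.alg.toSubmodule := by
    intro p
    rw [LieSubalgebra.mem_toSubmodule, mem_conformal_iff_transpose]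
    simp [LieAlgebra.Orthogonal.JD, Matrix.fromBlocks_transpose, Matrix.fromBlocks_multiply,
      Matrix.fromBlocks_neg, soParam]
    constructor <;> ext i j <;> fin_cases i <;> fin_cases j <;> simp
  have hinj : Function.Injective (soParam.codRestrict conformal.alg.toSubmodule hmem) := by
    intro p q h
    have h1 : soParam p = soParam q := congrArg Subtype.val h
    have e : ∀ i j, soParam p i j = soParam q i j := fun i j => by rw [h1]
    refine Prod.ext ?_ (Prod.ext ?_ ?_)
    · funext i j
      exact e (Sum.inl i) (Sum.inl j)
    · funext i
      have e1 := e (Sum.inl 0) (Sum.inr 1)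
      have e2 := e (Sum.inl 0) (Sum.inr 2)
      have e3 := e (Sum.inl 1) (Sum.inr 2)
      simp [soParam] at e1 e2 e3
      fin_cases i <;> assumption
    · funext i
      have e1 := e (Sum.inr 0) (Sum.inl 1)
      have e2 := e (Sum.inr 0) (Sum.inl 2)
      have e3 := e (Sum.inr 1) (Sum.inl 2)
      simp [soParam] at e1 e2 e3
      fin_cases i <;> assumption
  have h := LinearMap.finrank_le_finrank_of_injective hinj
  have h0 : Module.finrank ℝ ((Fin 3 → Fin 3 → ℝ) × (Fin 3 → ℝ) × (Fin 3 → ℝ)) = 15 := by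
    rw [Module.finrank_prod, Module.finrank_prod, Module.finrank_pi_fintype]
    simp
  rw [h0] at h
  exact h

end Projective

/-! ### Unipotent elements of the spin group -/

section Shear

/-- The element `1 + x w` of the Clifford algebra. -/
def shear (x w : Vec33) : Cl33 := 1 + CliffordAlgebra.ι Q33 x * CliffordAlgebra.ι Q33 w

lemma ι_mul_self (x : Vec33) : CliffordAlgebra.ι Q33 x * CliffordAlgebra.ι Q33 x =
    algebraMap ℝ Cl33 (Q33 x) := CliffordAlgebra.ι_sq_scalar Q33 x

lemma isUnit_ι {v : Vec33} (hv : Q33 v = 1) :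
    ∃ u : Cl33ˣ, (u : Cl33) = CliffordAlgebra.ι Q33 v := by
  have h : CliffordAlgebra.ι Q33 v * CliffordAlgebra.ι Q33 v = 1 := by
    rw [ι_mul_self, hv, map_one]
  exact ⟨⟨_, _, h, h⟩, rfl⟩

/-- The product of two unit vectors lies in the spin group. -/
lemma ι_mul_ι_mem_spin {v w : Vec33} (hv : Q33 v = 1) (hw : Q33 w = 1) :
    CliffordAlgebra.ι Q33 v * CliffordAlgebra.ι Q33 w ∈ spinGroup Q33 := by
  obtain ⟨a, ha⟩ := isUnit_ι hv
  obtain ⟨b, hb⟩ := isUnit_ι hw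
  have hmem : ∀ {u : Cl33ˣ} {v : Vec33}, (u : Cl33) = CliffordAlgebra.ι Q33 v →
      u ∈ lipschitzGroup Q33 := fun h => Subgroup.subset_closure ⟨_, h.symm⟩
  have hvv : CliffordAlgebra.ι Q33 v * CliffordAlgebra.ι Q33 v = 1 := by
    rw [ι_mul_self, hv, map_one]
  have hww : CliffordAlgebra.ι Q33 w * CliffordAlgebra.ι Q33 w = 1 := by
    rw [ι_mul_self, hw, map_one]
  rw [spinGroup.mem_iff, pinGroup.mem_iff]
  refine ⟨⟨⟨a * b, mul_mem (hmem ha) (hmem hb), by simp [ha, hb]⟩, ?_⟩, ?_⟩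
  · rw [Unitary.mem_iff, star_mul, CliffordAlgebra.star_ι, CliffordAlgebra.star_ι]
    constructor
    · rw [neg_mul_neg, mul_assoc, ← mul_assoc (CliffordAlgebra.ι Q33 v), hvv, one_mul, hww]
    · rw [neg_mul_neg, mul_assoc, ← mul_assoc (CliffordAlgebra.ι Q33 w), hww, one_mul, hvv]
  · exact CliffordAlgebra.ι_mul_ι_mem_evenOdd_zero Q33 v w

lemma shear_mul {x w w' : Vec33} (hx : Q33 x = 0) (hw : hForm x w = 0) :
    shear x w * shear x w' = shear x (w + w') := by
  have h : CliffordAlgebra.ι Q33 x * CliffordAlgebra.ι Q33 w *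
      (CliffordAlgebra.ι Q33 x * CliffordAlgebra.ι Q33 w') = 0 := by
    rw [ι_mul_ι x w, hw, map_zero, zero_sub, neg_mul, mul_assoc,
      ← mul_assoc (CliffordAlgebra.ι Q33 x), ι_mul_self, hx, map_zero, zero_mul, mul_zero, neg_zero]
  simp only [shear, map_add, mul_add, add_mul, one_mul, mul_one]
  rw [h]
  abel

lemma shear_zero (x : Vec33) : shear x 0 = 1 := by simp [shear]

/-- `1 + t x c = (c + t x) c` for a unit vector `c` orthogonal to the null vector `x`. -/
lemma shear_smul_mem {x c : Vec33} (hx : Q33 x = 0) (hc : Q33 c = 1) (hxc : hForm x c = 0)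
    (t : ℝ) : shear x (t • c) ∈ spinGroup Q33 := by
  have h : shear x (t • c) =
      CliffordAlgebra.ι Q33 (c + t • x) * CliffordAlgebra.ι Q33 c := by
    rw [map_add, add_mul, ι_mul_self, hc, map_one, shear]
    simp
  rw [h]
  refine ι_mul_ι_mem_spin ?_ hc
  have h1 := hForm_self (c + t • x)
  rw [hForm_add_left, hForm_add_right, hForm_add_right, hForm_smul_left, hForm_smul_left,
    hForm_smul_right, hForm_smul_right, hForm_self, hForm_self, hx, hc, hForm_comm c, hxc] at h1
  linarith

/-- The unit vectors `e₂ + f₂`, `2 e₂ + f₂ / 2` and so on, which span the span of `frameA`. -/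
def unitA : Fin 4 → Vec33 :=
  ![frameA 0 + frameA 1, (2 : ℝ) • frameA 0 + (1 / 2 : ℝ) • frameA 1,
    frameA 2 - (1 / 2 : ℝ) • frameA 3, (2 : ℝ) • frameA 2 - (1 / 4 : ℝ) • frameA 3]

lemma Q33_eq (v : Vec33) : Q33 v = hForm v v / 2 := by rw [hForm_self]; ring

lemma Q33_unitA (i : Fin 4) : Q33 (unitA i) = 1 := by
  rw [Q33_eq]
  fin_cases i <;> simp [unitA, hForm_def, frameA] <;> norm_num

lemma hForm_vTilde_unitA (i : Fin 4) : hForm vTilde (unitA i) = 0 := by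
  fin_cases i <;> simp [unitA, hForm_add_right, hForm_sub_right, hForm_smul_right,
    hForm_vTilde_frameA]

lemma Q33_vTilde : Q33 vTilde = 0 := by rw [Q33_eq, hForm_vTilde_self]; simp

/-- The vectors of `ṽ₊^⊥` give elements of the spin group. -/
lemma shear_vTilde_mem {w : Vec33} (hw : hForm vTilde w = 0) :
    shear vTilde w ∈ spinGroup Q33 := by
  have hsum : ∀ w w', hForm vTilde w = 0 → shear vTilde w ∈ spinGroup Q33 →
      shear vTilde w' ∈ spinGroup Q33 → shear vTilde (w + w') ∈ spinGroup Q33 := by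
    intro w w' h0 h1 h2
    rw [← shear_mul Q33_vTilde h0]
    exact mul_mem h1 h2
  have hu : ∀ i (t : ℝ), shear vTilde (t • unitA i) ∈ spinGroup Q33 := fun i t =>
    shear_smul_mem Q33_vTilde (Q33_unitA i) (hForm_vTilde_unitA i) t
  have hh : ∀ i (t : ℝ), hForm vTilde (t • unitA i) = 0 := fun i t => by
    rw [hForm_smul_right, hForm_vTilde_unitA, mul_zero]
  have hl : ∀ t : ℝ, shear vTilde (t • vTilde) ∈ spinGroup Q33 := by
    intro t
    have : shear vTilde (t • vTilde) = 1 := by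
      rw [shear, map_smul, mul_smul_comm, ι_mul_self, Q33_vTilde]
      simp
    rw [this]
    exact one_mem _
  set b : Fin 4 → ℝ := fun i => hForm (frameB i) w
  have hdec : w = hForm vBar w • vTilde + (((4 / 3 * b 1 - 1 / 3 * b 0 : ℝ) • unitA 0 +
      ((2 / 3 * b 0 - 2 / 3 * b 1 : ℝ) • unitA 1 + ((-1 / 3 * b 2 - 8 / 3 * b 3 : ℝ) • unitA 2 +
      (2 / 3 * b 2 + 4 / 3 * b 3 : ℝ) • unitA 3)))) := by
    conv_lhs => rw [vec_decomp_frameA w]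
    simp only [unitA, Fin.sum_univ_four, hw, zero_smul, add_zero, b, Matrix.cons_val]
    module
  rw [hdec]
  refine hsum _ _ (by rw [hForm_smul_right, hForm_vTilde_self, mul_zero]) (hl _) ?_
  refine hsum _ _ (hh _ _) (hu _ _) (hsum _ _ (hh _ _) (hu _ _)
    (hsum _ _ (hh _ _) (hu _ _) (hu _ _)))

/-- The action of `1 + x w` on vectors. -/
lemma rho_of_shear {g : Spin33} {x w : Vec33} (hg : (g : Cl33) = shear x w) (hx : Q33 x = 0)
    (hw : hForm x w = 0) (v : Vec33) :
    rho g *ᵥ v = v + wedge x w *ᵥ v - (Q33 w * hForm x v) • x := by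
  rw [rho_mulVec]
  apply ι33_injective
  have hstar : ((g⁻¹ : Spin33) : Cl33) =
      1 - CliffordAlgebra.ι Q33 x * CliffordAlgebra.ι Q33 w := by
    rw [coe_inv_spin, hg, shear, star_add, star_one, star_mul, CliffordAlgebra.star_ι,
      CliffordAlgebra.star_ι, neg_mul_neg, ι_mul_ι w x, hForm_comm, hw, map_zero, zero_sub,
      sub_eq_add_neg]
  rw [ι_vectorAct, hstar, hg, shear, wedge_mulVec]
  simp only [map_add, map_sub, map_smul]
  set X := CliffordAlgebra.ι Q33 x
  set W := CliffordAlgebra.ι Q33 w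
  set V := CliffordAlgebra.ι Q33 v
  have hXX : X * X = 0 := by rw [ι_mul_self, hx, map_zero]
  have hWW : W * W = Q33 w • 1 := by rw [ι_mul_self, Algebra.algebraMap_eq_smul_one]
  have hVX : V * X = hForm x v • 1 - X * V := by
    rw [ι_mul_ι v x, hForm_comm, Algebra.algebraMap_eq_smul_one]
  have hVW : V * W = hForm w v • 1 - W * V := by
    rw [ι_mul_ι v w, hForm_comm, Algebra.algebraMap_eq_smul_one]
  have hWX : W * X = -(X * W) := by
    rw [ι_mul_ι w x, hForm_comm, hw, map_zero, zero_sub]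
  have h1 : V * (X * W) = hForm x v • W - hForm w v • X + X * W * V := by
    rw [← mul_assoc, hVX, sub_mul, mul_assoc X, hVW, mul_sub]
    simp only [smul_mul_assoc, one_mul, mul_smul_comm, mul_one, mul_assoc]
    abel
  have h2 : X * W * V * (X * W) = (Q33 w * hForm x v) • X := by
    rw [mul_assoc (X * W), h1, mul_add, mul_sub]
    have e1 : X * W * (X * W * V) = 0 := by
      have : X * W * (X * W) = 0 := by
        rw [mul_assoc X W, ← mul_assoc W X, hWX, neg_mul, mul_neg, mul_assoc X W W, ← mul_assoc X X,
          hXX, zero_mul, neg_zero]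
      rw [← mul_assoc, this, zero_mul]
    have e2 : X * W * W = Q33 w • X := by rw [mul_assoc, hWW, mul_smul_comm, mul_one]
    have e3 : X * W * X = 0 := by rw [mul_assoc, hWX, mul_neg, ← mul_assoc, hXX, zero_mul, neg_zero]
    rw [e1, mul_smul_comm, mul_smul_comm, e2, e3, smul_smul]
    simp [mul_comm]
  have h3 : (1 + X * W) * V * (1 - X * W) =
      V + (X * W * V - V * (X * W)) - X * W * V * (X * W) := by
    simp only [mul_sub, add_mul, one_mul, mul_one]
    abel
  rw [h3, h2, h1]
  abel

/-- The one-parameter family `1 + t x c` in `P̃`, with velocity `x ∧ c`, for a null vector `x` and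
an orthogonal unit vector `c` in `ṽ₊^⊥`. -/
lemma exists_shear_curve {x c : Vec33} (hx : Q33 x = 0) (hc : Q33 c = 1) (hxc : hForm x c = 0)
    (hlx : hForm vTilde x = 0) (hlc : hForm vTilde c = 0) :
    ∃ γ : ℝ → conformal.parabolic,
      SmoothIntoSpinOn 𝓘(ℝ, ℝ) (fun t => (γ t : Spin33)) Set.univ ∧ γ 0 = 1 ∧
      ∀ i j, HasDerivAt (fun t => rho (γ t : Spin33) i j) (wedge x c i j) 0 := by
  let g : ℝ → Spin33 := fun t => ⟨shear x (t • c), shear_smul_mem hx hc hxc t⟩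
  have hg : ∀ t v, rho (g t) *ᵥ v = v + t • (wedge x c *ᵥ v) - (t ^ 2 * hForm x v) • x := by
    intro t v
    rw [rho_of_shear (g := g t) rfl hx (by rw [hForm_smul_right, hxc, mul_zero]),
      wedge_smul_right, Matrix.smul_mulVec, QuadraticMap.map_smul, hc, smul_eq_mul, mul_one, sq]
  have hmem : ∀ t, g t ∈ conformal.parabolic := fun t => by
    refine ⟨Subgroup.mem_top _, 1, one_pos, ?_⟩
    change rho (g t) *ᵥ vTilde = (1 : ℝ) • vTilde
    rw [hg, wedge_mulVec, hForm_comm c, hForm_comm x, hlx, hlc]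
    simp
  refine ⟨fun t => ⟨g t, hmem t⟩, ?_, ?_, fun i j => ?_⟩
  · intro φ
    have : ∀ t : ℝ, φ (shear x (t • c)) = φ 1 +
        t * φ (CliffordAlgebra.ι Q33 x * CliffordAlgebra.ι Q33 c) := by
      intro t
      simp [shear]
    change ContMDiffOn _ _ _ (fun t : ℝ => φ (shear x (t • c))) _
    simp only [this]
    exact (contDiff_const.add (contDiff_id.mul contDiff_const)).contMDiff.contMDiffOn
  · apply Subtype.ext
    apply Subtype.ext
    change shear x ((0 : ℝ) • c) = 1
    rw [zero_smul, shear_zero]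
  · have h1 : ∀ t, rho (g t) i j = (Pi.single j (1 : ℝ) : Vec33) i + t * wedge x c i j -
        t ^ 2 * hForm x (Pi.single j 1) * x i := by
      intro t
      have h2 := congrFun (hg t (Pi.single j 1)) i
      simpa using h2
    change HasDerivAt (fun t => rho (g t) i j) _ 0
    simp only [h1]
    have h2 := HasDerivAt.fun_sub (((hasDerivAt_id' (0 : ℝ)).mul_const (wedge x c i j)).const_add
      ((Pi.single j (1 : ℝ) : Vec33) i))
      ((((hasDerivAt_id' (0 : ℝ)).fun_pow 2).mul_const (hForm x (Pi.single j 1))).mul_const (x i))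
    simpa using h2

/-- The velocities `x ∧ c` span the elements of `so(3,3)` that kill `ṽ₊`. -/
lemma mem_of_wedge_mem {S : Submodule ℝ Mat33}
    (hS : ∀ x c : Vec33, Q33 x = 0 → Q33 c = 1 → hForm x c = 0 → hForm vTilde x = 0 →
      hForm vTilde c = 0 → wedge x c ∈ S) {X : Mat33} (hX : X ∈ conformal.alg)
    (h0 : X *ᵥ vTilde = 0) : X ∈ S := by
  have hAll : ∀ y z, hForm vTilde y = 0 → hForm vTilde z = 0 → wedge y z ∈ S := by
    have hA : ∀ i, hForm vTilde (frameA i) = 0 := hForm_vTilde_frameA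
    have hU : ∀ i, hForm vTilde (unitA i) = 0 := hForm_vTilde_unitA
    -- `frameA 0, frameA 1` and `unitA 0, unitA 1` span the same plane, as do the other two pairs
    have pair1 : ∀ x, wedge x (unitA 0) ∈ S → wedge x (unitA 1) ∈ S →
        wedge x (frameA 0) ∈ S ∧ wedge x (frameA 1) ∈ S := by
      intro x h1 h2
      have e1 : wedge x (frameA 0) =
          (-1 / 3 : ℝ) • wedge x (unitA 0) + (2 / 3 : ℝ) • wedge x (unitA 1) := by
        simp only [unitA, Matrix.cons_val, wedge_add_right, wedge_smul_right]
        module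
      have e2 : wedge x (frameA 1) =
          (4 / 3 : ℝ) • wedge x (unitA 0) + (-2 / 3 : ℝ) • wedge x (unitA 1) := by
        simp only [unitA, Matrix.cons_val, wedge_add_right, wedge_smul_right]
        module
      rw [e1, e2]
      exact ⟨S.add_mem (S.smul_mem _ h1) (S.smul_mem _ h2),
        S.add_mem (S.smul_mem _ h1) (S.smul_mem _ h2)⟩
    have pair2 : ∀ x, wedge x (unitA 2) ∈ S → wedge x (unitA 3) ∈ S →
        wedge x (frameA 2) ∈ S ∧ wedge x (frameA 3) ∈ S := by
      intro x h1 h2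
      have e1 : wedge x (frameA 2) =
          (-1 / 3 : ℝ) • wedge x (unitA 2) + (2 / 3 : ℝ) • wedge x (unitA 3) := by
        simp only [unitA, Matrix.cons_val, wedge_sub_right, wedge_smul_right]
        module
      have e2 : wedge x (frameA 3) =
          (-8 / 3 : ℝ) • wedge x (unitA 2) + (4 / 3 : ℝ) • wedge x (unitA 3) := by
        simp only [unitA, Matrix.cons_val, wedge_sub_right, wedge_smul_right]
        module
      rw [e1, e2]
      exact ⟨S.add_mem (S.smul_mem _ h1) (S.smul_mem _ h2),
        S.add_mem (S.smul_mem _ h1) (S.smul_mem _ h2)⟩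
    have hl : ∀ i, wedge vTilde (unitA i) ∈ S := fun i =>
      hS _ _ Q33_vTilde (Q33_unitA i) (hU i) hForm_vTilde_self (hU i)
    obtain ⟨l0, l1⟩ := pair1 _ (hl 0) (hl 1)
    obtain ⟨l2, l3⟩ := pair2 _ (hl 2) (hl 3)
    have h2 : ∀ i : Fin 4, i = 0 ∨ i = 1 → wedge (frameA 2) (unitA i) ∈ S := by
      intro i hi
      refine hS _ _ ?_ (Q33_unitA i) ?_ (hA 2) (hU i)
      · simp [Q33_eq, hForm_def, frameA]
      · rcases hi with rfl | rfl <;> simp [hForm_def, frameA, unitA]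
    have h3 : ∀ i : Fin 4, i = 0 ∨ i = 1 → wedge (frameA 3) (unitA i) ∈ S := by
      intro i hi
      refine hS _ _ ?_ (Q33_unitA i) ?_ (hA 3) (hU i)
      · simp [Q33_eq, hForm_def, frameA]
      · rcases hi with rfl | rfl <;> simp [hForm_def, frameA, unitA]
    obtain ⟨w20, w21⟩ := pair1 _ (h2 0 (by simp)) (h2 1 (by simp))
    obtain ⟨w30, w31⟩ := pair1 _ (h3 0 (by simp)) (h3 1 (by simp))
    -- within its plane no null vector is orthogonal to `unitA 0`, so the other plane is used as well
    have w01 : wedge (frameA 0) (frameA 1) ∈ S := by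
      have h := hS (frameA 0 - frameA 1 + unitA 2) (unitA 0)
        (by simp [Q33_eq, hForm_def, frameA, unitA]; norm_num) (Q33_unitA 0)
        (by simp [hForm_def, frameA, unitA])
        (by rw [hForm_add_right, hForm_sub_right, hA, hA, hU]; simp) (hU 0)
      have e : wedge (frameA 0) (frameA 1) = (1 / 2 : ℝ) •
          (wedge (frameA 0 - frameA 1 + unitA 2) (unitA 0) - (wedge (frameA 2) (frameA 0) +
            wedge (frameA 2) (frameA 1)) + (1 / 2 : ℝ) • (wedge (frameA 3) (frameA 0) +
            wedge (frameA 3) (frameA 1))) := by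
        simp only [unitA, Matrix.cons_val, wedge_sub_left, wedge_add_left, wedge_smul_left,
          wedge_add_right, wedge_self, wedge_swap (frameA 1) (frameA 0)]
        module
      rw [e]
      exact S.smul_mem _ (S.add_mem (S.sub_mem h (S.add_mem w20 w21))
        (S.smul_mem _ (S.add_mem w30 w31)))
    have w23 : wedge (frameA 2) (frameA 3) ∈ S := by
      have h := hS (frameA 2 + (1 / 2 : ℝ) • frameA 3 + unitA 0) (unitA 2)
        (by simp [Q33_eq, hForm_def, frameA, unitA]; norm_num) (Q33_unitA 2)
        (by simp [hForm_def, frameA, unitA])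
        (by rw [hForm_add_right, hForm_add_right, hForm_smul_right, hA, hA, hU]; simp) (hU 2)
      have e : wedge (frameA 2) (frameA 3) =
          -(wedge (frameA 2 + (1 / 2 : ℝ) • frameA 3 + unitA 0) (unitA 2)) -
            (wedge (frameA 2) (frameA 0) + wedge (frameA 2) (frameA 1)) +
            (1 / 2 : ℝ) • (wedge (frameA 3) (frameA 0) + wedge (frameA 3) (frameA 1)) := by
        simp only [unitA, Matrix.cons_val, wedge_add_left, wedge_smul_left, wedge_sub_right,
          wedge_smul_right, wedge_self, wedge_swap (frameA 3) (frameA 2),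
          wedge_swap (frameA 0), wedge_swap (frameA 1)]
        module
      rw [e]
      exact S.add_mem (S.sub_mem (S.neg_mem h) (S.add_mem w20 w21))
        (S.smul_mem _ (S.add_mem w30 w31))
    have hl' : ∀ i, wedge vTilde (frameA i) ∈ S := by
      intro i
      fin_cases i <;> assumption
    have sw : ∀ {a b}, wedge a b ∈ S → wedge b a ∈ S := fun {a b} h => by
      rw [wedge_swap]; exact S.neg_mem h
    have hw : ∀ i j, wedge (frameA i) (frameA j) ∈ S := by
      intro i j
      fin_cases i <;> fin_cases j <;>
        first
          | assumption
          | exact sw (by assumption)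
          | (rw [wedge_self]; exact S.zero_mem)
    intro y z hy hz
    have hstep : ∀ y z, hForm vTilde z = 0 → wedge y vTilde ∈ S →
        (∀ i, wedge y (frameA i) ∈ S) → wedge y z ∈ S := by
      intro y z hz h1 h2
      rw [vec_decomp_frameA z, hz, zero_smul, add_zero, wedge_add_right, wedge_smul_right,
        wedge_sum_right]
      refine S.add_mem (S.smul_mem _ h1) (S.sum_mem fun i _ => ?_)
      rw [wedge_smul_right]
      exact S.smul_mem _ (h2 i)
    refine hstep y z hz (sw (hstep _ y hy (by rw [wedge_self]; exact S.zero_mem) hl')) fun i => ?_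
    exact sw (hstep _ y hy (sw (hl' i)) (hw i))
  have hXl : ∀ v, hForm vTilde (X *ᵥ v) = 0 := by
    intro v
    rw [← neg_eq_iff_eq_neg.2 (mem_conformal_iff.1 hX vTilde v), h0, hForm_zero_left, neg_zero]
  rw [so_decomp hX, h0, wedge_swap 0, wedge_zero_right, neg_zero, zero_add]
  exact S.smul_mem _ (S.add_mem (hAll _ _ (hXl _) hForm_vTilde_self)
    (S.sum_mem fun i _ => hAll _ _ (hXl _) (hForm_vTilde_frameB i)))

end Shear

/-! ### The adjoint action and the Maurer-Cartan form on `so(3,3)` -/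

section Adjoint

lemma conj_mem_conformal (g : Spin33) {X : Mat33} (hX : X ∈ conformal.alg) :
    rho g⁻¹ * X * rho g ∈ conformal.alg := by
  rw [mem_conformal_iff] at hX ⊢
  intro v w
  simp only [← Matrix.mulVec_mulVec]
  rw [hForm_rho_inv, hX, hForm_comm v, hForm_rho_inv, hForm_comm]

lemma rho_transpose (g : Spin33) : (rho g)ᵀ = LieAlgebra.Orthogonal.JD (Fin 3) ℝ * rho g⁻¹ *
    LieAlgebra.Orthogonal.JD (Fin 3) ℝ := by
  have h : (rho g)ᵀ * LieAlgebra.Orthogonal.JD (Fin 3) ℝ =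
      LieAlgebra.Orthogonal.JD (Fin 3) ℝ * rho g⁻¹ := by
    refine mat_ext fun w => ?_
    have key : ∀ v : Vec33, v ⬝ᵥ (((rho g)ᵀ * LieAlgebra.Orthogonal.JD (Fin 3) ℝ) *ᵥ w) =
        v ⬝ᵥ ((LieAlgebra.Orthogonal.JD (Fin 3) ℝ * rho g⁻¹) *ᵥ w) := by
      intro v
      rw [← Matrix.mulVec_mulVec, ← Matrix.mulVec_mulVec, Matrix.dotProduct_mulVec v,
        Matrix.vecMul_transpose, ← hForm_eq_dotProduct, ← hForm_eq_dotProduct, hForm_comm v,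
        hForm_rho_inv, hForm_comm]
    ext i
    simpa using key (Pi.single i 1)
  rw [← h, mul_assoc, JD_mul_JD, mul_one]

/-- The Maurer-Cartan form takes values in the Lie algebra. -/
lemma rho_inv_mul_mDMat_mem {E : Type*} [NormedAddCommGroup E] [NormedSpace ℝ E]
    {N : Type*} [TopologicalSpace N] [ChartedSpace E N] {U : Set N} (hU : IsOpen U) {n : N}
    (hn : n ∈ U) {h : N → Spin33} (hh : SmoothIntoSpinOn 𝓘(ℝ, E) h U) (v : E) :
    rho (h n)⁻¹ * mDMat E (fun y => rho (h y)) n v ∈ conformal.alg := by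
  set J := LieAlgebra.Orthogonal.JD (Fin 3) ℝ with hJ
  have hd : DiffMatAt E (fun y => rho (h y)⁻¹) n :=
    fun i j => mdiffAt_of_on (hh.inv.rho_apply i j) hU hn
  have h1 : (mDMat E (fun y => rho (h y)) n v)ᵀ =
      -(J * (rho (h n)⁻¹ * mDMat E (fun y => rho (h y)) n v * rho (h n)⁻¹) * J) := by
    have : (mDMat E (fun y => rho (h y)) n v)ᵀ = mDMat E (fun y => J * rho (h y)⁻¹ * J) n v := by
      simp only [hJ, ← rho_transpose]
      rfl
    rw [this, mDMat_mul (F := fun y => J * rho (h y)⁻¹) ((diffMatAt_const _ _).mul hd)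
      (diffMatAt_const _ _), mDMat_mul (diffMatAt_const _ _) hd, mDMat_const,
      mDMat_rho_inv hU hn hh]
    simp
  have h2 : (rho (h n)⁻¹)ᵀ = J * rho (h n) * J := by rw [rho_transpose, inv_inv]
  rw [mem_conformal_iff_transpose, ← hJ, Matrix.transpose_mul, h1, h2]
  have hJJ : J * J = 1 := JD_mul_JD
  simp only [mul_neg, neg_mul, neg_inj, mul_assoc]
  rw [← mul_assoc J J, hJJ, one_mul, ← mul_assoc J J, hJJ, one_mul, mul_one, rho_inv_mul,
    mul_one]

end Adjoint

/-! ### Representatives of points of the extended bundle -/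

section Representatives

variable {𝒢 : Type*} {act : 𝒢 → projective.parabolic → 𝒢}

lemma feffAct_mk (u : 𝒢) (p : conformal.parabolic) :
    (Quot.mk _ (u, p) : FeffBundle act) = feffAct act (feffIncl act u) p := by
  change _ = Quot.mk _ (u, 1 * p)
  rw [one_mul]

lemma exists_eq_feffAct (x : FeffBundle act) :
    ∃ u p, x = feffAct act (feffIncl act u) p := by
  induction x using Quot.ind with
  | mk a => exact ⟨a.1, a.2, feffAct_mk a.1 a.2⟩

lemma feffAct_actQ (u : 𝒢) (q : groupQ) (p : conformal.parabolic) :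
    feffAct act (feffIncl act (actQ act u q)) p = feffAct act (feffIncl act u) (inclQ q * p) := by
  rw [← feffAct_mk, ← feffAct_mk]
  refine (Quot.sound ⟨q, ?_⟩).symm
  rw [inv_mul_cancel_left]

lemma feffProj_feffAct (u : 𝒢) (p : conformal.parabolic) :
    feffProj act (feffAct act (feffIncl act u) p) = toFeffSpace act u := rfl

end Representatives

/-! ### The extended Cartan connection -/

section Extension

variable {E : Type*} [NormedAddCommGroup E] [NormedSpace ℝ E]
  {N : Type*} [TopologicalSpace N] [ChartedSpace E N]
  {𝒢 : Type*} [TopologicalSpace 𝒢] [ChartedSpace (Euc 8) 𝒢]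

/-- The value of the extended Cartan connection along the family `[c, h]` in `𝒢̃`:
`Ad(h⁻¹) θ(dc) + h⁻¹ dh`. -/
def liftForm (θ : OneForm 𝒢 8 projective.alg) (c : N → 𝒢) (h : N → conformal.parabolic) (n : N) :
    E →ₗ[ℝ] Mat33 where
  toFun v := rho (h n : Spin33)⁻¹ * θ.mat (c n) (mD E (Euc 8) c n v) * rho (h n : Spin33) +
    rho (h n : Spin33)⁻¹ * mDMat E (fun y => rho (h y : Spin33)) n v
  map_add' v w := by
    rw [map_add, map_add, mDMat_add, mul_add, mul_add, add_mul]
    abel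
  map_smul' a v := by
    rw [map_smul, map_smul, mDMat_smul, Matrix.mul_smul, Matrix.mul_smul, Matrix.smul_mul,
      RingHom.id_apply, smul_add]

lemma liftForm_apply (θ : OneForm 𝒢 8 projective.alg) (c : N → 𝒢) (h : N → conformal.parabolic)
    (n : N) (v : E) : liftForm θ c h n v =
    rho (h n : Spin33)⁻¹ * θ.mat (c n) (mD E (Euc 8) c n v) * rho (h n : Spin33) +
    rho (h n : Spin33)⁻¹ * mDMat E (fun y => rho (h y : Spin33)) n v := rfl

variable (E) in
/-- On the open set `U`, the family `F` in `𝒢̃` is represented by the smooth pair `(c, h)`. -/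
structure IsLocalLift (act : 𝒢 → projective.parabolic → 𝒢) (U : Set N) (F : N → FeffBundle act)
    (c : N → 𝒢) (h : N → conformal.parabolic) : Prop where
  isOpen : IsOpen U
  smooth_left : ContMDiffOn 𝓘(ℝ, E) (𝓡 8) ∞ c U
  smooth_right : SmoothIntoSpinOn 𝓘(ℝ, E) (fun y => (h y : Spin33)) U
  eq : ∀ y ∈ U, feffAct act (feffIncl act (c y)) (h y) = F y

variable {act : 𝒢 → projective.parabolic → 𝒢}

lemma IsLocalLift.liftForm_mem {U : Set N} {F : N → FeffBundle act} {c : N → 𝒢}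
    {h : N → conformal.parabolic} (hl : IsLocalLift E act U F c h)
    (θ : OneForm 𝒢 8 projective.alg) {n : N} (hn : n ∈ U) (v : E) :
    liftForm θ c h n v ∈ conformal.alg :=
  conformal.alg.add_mem
    (conj_mem_conformal _ (projective_le_conformal (θ (c n) (mD E (Euc 8) c n v)).2))
    (rho_inv_mul_mDMat_mem hl.isOpen hn hl.smooth_right v)

lemma IsLocalLift.comp {E' : Type*} [NormedAddCommGroup E'] [NormedSpace ℝ E'] {N' : Type*}
    [TopologicalSpace N'] [ChartedSpace E' N'] {U : Set N} {F : N → FeffBundle act} {c : N → 𝒢}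
    {h : N → conformal.parabolic} (hl : IsLocalLift E act U F c h) {V : Set N'} (hV : IsOpen V)
    {f : N' → N} (hf : ContMDiffOn 𝓘(ℝ, E') 𝓘(ℝ, E) ∞ f V) :
    IsLocalLift E' act (V ∩ f ⁻¹' U) (fun y => F (f y)) (fun y => c (f y)) (fun y => h (f y)) where
  isOpen := hf.continuousOn.isOpen_inter_preimage hV hl.isOpen
  smooth_left := hl.smooth_left.comp (hf.mono Set.inter_subset_left) fun _ hy => hy.2
  smooth_right := hl.smooth_right.comp (hf.mono Set.inter_subset_left) fun _ hy => hy.2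
  eq y hy := hl.eq (f y) hy.2

lemma liftForm_comp {E' : Type*} [NormedAddCommGroup E'] [NormedSpace ℝ E'] {N' : Type*}
    [TopologicalSpace N'] [ChartedSpace E' N'] {U : Set N} {F : N → FeffBundle act} {c : N → 𝒢}
    {h : N → conformal.parabolic} (hl : IsLocalLift E act U F c h) (θ : OneForm 𝒢 8 projective.alg)
    {f : N' → N} {n : N'} (hn : f n ∈ U) (hf : MDifferentiableAt 𝓘(ℝ, E') 𝓘(ℝ, E) f n) (v : E') :
    liftForm θ (fun y => c (f y)) (fun y => h (f y)) n v =
      liftForm θ c h (f n) (mD E' E f n v) := by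
  rw [liftForm_apply, liftForm_apply, mD_comp (mdiffAt_of_on hl.smooth_left hl.isOpen hn) hf,
    mDMat_comp (F := fun y => rho (h y : Spin33))
      ((smoothIntoSpinOn_rho hl.smooth_right).diffMatAt hl.isOpen hn) hf]

variable [TopologicalSpace (FeffSpace act)] [ChartedSpace (Euc 4) (FeffSpace act)]
  [TopologicalSpace (FeffBundle act)] [ChartedSpace (Euc 15) (FeffBundle act)]

/-- Two representatives of a point of `𝒢̃` differ by an element of `Q`. -/
lemma IsCanonicalStructure.exists_groupQ (hcan : IsCanonicalStructure act) {u u' : 𝒢}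
    {p p' : conformal.parabolic}
    (h : feffAct act (feffIncl act u) p = feffAct act (feffIncl act u') p') :
    ∃ q : groupQ, u' = actQ act u q ∧ p = inclQ q * p' := by
  have h1 := congrArg (feffProj act) h
  rw [feffProj_feffAct, feffProj_feffAct] at h1
  obtain ⟨q, hq, -⟩ := hcan.base.simply_transitive u u' h1
  refine ⟨q, hq, ?_⟩
  rw [hq, feffAct_actQ] at h
  exact hcan.bundle.act_injective h

/-- Every point of `𝒢̃` has a neighbourhood with a smooth representation by pairs. -/
lemma IsCanonicalStructure.exists_localLift (hcan : IsCanonicalStructure act)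
    (x : FeffBundle act) : ∃ (U : Set (FeffBundle act)) (c : FeffBundle act → 𝒢)
      (h : FeffBundle act → conformal.parabolic),
      x ∈ U ∧ IsLocalLift (Euc 15) act U (fun y => y) c h := by
  obtain ⟨V, σ, -, hV, hxV, hσ, hσV, -⟩ := hcan.base.locally_trivial (feffProj act x)
  have hU : IsOpen (feffProj act ⁻¹' V) := hV.preimage hcan.bundle.smooth_proj.continuous
  have hex : ∀ y : FeffBundle act, ∃ p : conformal.parabolic, y ∈ feffProj act ⁻¹' V →
      y = feffAct act (feffIncl act (σ (feffProj act y))) p := by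
    intro y
    by_cases hy : y ∈ feffProj act ⁻¹' V
    · obtain ⟨p, hp, -⟩ := hcan.bundle.simply_transitive
        (feffIncl act (σ (feffProj act y))) y (hσV _ hy)
      exact ⟨p, fun _ => hp⟩
    · exact ⟨1, fun h => absurd h hy⟩
  choose h hh using hex
  have hc : ContMDiffOn (𝓡 15) (𝓡 8) ∞ (fun y => σ (feffProj act y)) (feffProj act ⁻¹' V) :=
    hσ.comp hcan.bundle.smooth_proj.contMDiffOn fun _ hy => hy
  exact ⟨_, _, h, hxV, hU, hc,
    hcan.bundle.smooth_div hU (hcan.smooth_incl.comp_contMDiffOn hc) contMDiffOn_id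
      (g := fun y => y) hh, fun y hy => (hh y hy).symm⟩

/-- A form on `𝒢̃` that is given by `liftForm` in all local representations. -/
def IsLiftForm (θ : OneForm 𝒢 8 projective.alg)
    (θ' : OneForm (FeffBundle act) 15 conformal.alg) : Prop :=
  ∀ U c h, IsLocalLift (Euc 15) act U (fun y => y) c h → ∀ x ∈ U, ∀ v,
    θ'.mat x v = liftForm θ c h x v

lemma IsLiftForm.unique (hcan : IsCanonicalStructure act) {θ : OneForm 𝒢 8 projective.alg}
    {θ₁ θ₂ : OneForm (FeffBundle act) 15 conformal.alg} (h₁ : IsLiftForm θ θ₁)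
    (h₂ : IsLiftForm θ θ₂) : θ₁ = θ₂ := by
  funext x
  obtain ⟨U, c, h, hx, hl⟩ := hcan.exists_localLift x
  refine LinearMap.ext fun v => Subtype.ext ?_
  exact (h₁ U c h hl x hx v).trans (h₂ U c h hl x hx v).symm

/-- An extension of `θ` is given by `liftForm`, and so is unique. -/
lemma IsExtension.isLiftForm [IsManifold (𝓡 15) ∞ (FeffBundle act)]
    (hcan : IsCanonicalStructure act) {θ : OneForm 𝒢 8 projective.alg}
    {θ' : OneForm (FeffBundle act) 15 conformal.alg} (hθ' : IsExtension act θ θ') :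
    IsLiftForm θ θ' := by
  intro U c h hl x hx v
  have hi : ContMDiffOn (𝓡 15) (𝓡 15) ∞ (fun y => feffIncl act (c y)) U :=
    hcan.smooth_incl.comp_contMDiffOn hl.smooth_left
  have hL := hθ'.cartan.leibniz hcan.bundle hl.isOpen hx hi hl.smooth_right v
  have e1 : mD (Euc 15) (Euc 15) (fun y => feffAct act (feffIncl act (c y)) (h y)) x v = v := by
    rw [mD_congr_on (g := fun y => y) hl.isOpen hx fun y hy => hl.eq y hy, mD_id]
  have e2 : mD (Euc 15) (Euc 15) (fun y => feffIncl act (c y)) x v =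
      mD (Euc 8) (Euc 15) (feffIncl act) (c x) (mD (Euc 15) (Euc 8) c x v) :=
    mD_comp (hcan.smooth_incl.mdifferentiableAt (by simp))
      (mdiffAt_of_on hl.smooth_left hl.isOpen hx) v
  have e3 : θ'.mat (feffIncl act (c x)) (mD (Euc 8) (Euc 15) (feffIncl act) (c x)
      (mD (Euc 15) (Euc 8) c x v)) = θ.mat (c x) (mD (Euc 15) (Euc 8) c x v) := hθ'.restrict _ _
  have e4 : feffAct act (feffIncl act (c x)) (h x) = x := hl.eq x hx
  rw [e1, e2, e4, e3] at hL
  exact hL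

variable {M : Type*} [TopologicalSpace M] [ChartedSpace (Euc 2) M] {π : 𝒢 → M}
  [IsManifold (𝓡 8) ∞ 𝒢] [FiniteDimensional ℝ E] [IsManifold 𝓘(ℝ, E) ∞ N]

/-- The value of the extended connection does not depend on the representation. -/
lemma IsLocalLift.liftForm_eq (hπ : IsPrincipalBundle (d := 8) (m := 2) projective.parabolic act π)
    {θ : OneForm 𝒢 8 projective.alg} (hθ : IsCartanConnection projective act θ)
    (hcan : IsCanonicalStructure act) {U U' : Set N} {F : N → FeffBundle act} {c c' : N → 𝒢}
    {h h' : N → conformal.parabolic} (hl : IsLocalLift E act U F c h)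
    (hl' : IsLocalLift E act U' F c' h') {n : N} (hn : n ∈ U) (hn' : n ∈ U') (v : E) :
    liftForm θ c h n v = liftForm θ c' h' n v := by
  have hex : ∀ y, ∃ q : groupQ, y ∈ U ∩ U' → c' y = actQ act (c y) q ∧ h y = inclQ q * h' y := by
    intro y
    by_cases hy : y ∈ U ∩ U'
    · obtain ⟨q, hq⟩ := hcan.exists_groupQ ((hl.eq y hy.1).trans (hl'.eq y hy.2).symm)
      exact ⟨q, fun _ => hq⟩
    · exact ⟨1, fun h => absurd h hy⟩
  choose q hq using hex
  have hV : IsOpen (U ∩ U') := hl.isOpen.inter hl'.isOpen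
  have hnV : n ∈ U ∩ U' := ⟨hn, hn'⟩
  have hc := hl.smooth_left.mono (Set.inter_subset_left (t := U'))
  have hc' := hl'.smooth_left.mono (Set.inter_subset_right (s := U))
  have hh' := hl'.smooth_right.mono (Set.inter_subset_right (s := U))
  have hqs : SmoothIntoSpinOn 𝓘(ℝ, E) (fun y => (q y : Spin33)) (U ∩ U') :=
    hcan.base.smooth_div hV hc hc' fun y hy => (hq y hy).1
  have hL := hθ.leibniz hπ hV hnV hc (h := fun y => Subgroup.inclusion groupQ_le (q y)) hqs v
  have e1 : mD E (Euc 8) (fun y => act (c y) (Subgroup.inclusion groupQ_le (q y))) n =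
      mD E (Euc 8) c' n := mD_congr_on hV hnV fun y hy => ((hq y hy).1).symm
  have e2 : act (c n) (Subgroup.inclusion groupQ_le (q n)) = c' n := ((hq n hnV).1).symm
  rw [e1, e2] at hL
  have e3 : mDMat E (fun y => rho (h y : Spin33)) n v =
      rho (q n : Spin33) * mDMat E (fun y => rho (h' y : Spin33)) n v +
        mDMat E (fun y => rho (q y : Spin33)) n v * rho (h' n : Spin33) := by
    rw [mDMat_congr_on (G := fun y => rho (q y : Spin33) * rho (h' y : Spin33)) hV hnV
      fun y hy => by
      rw [(hq y hy).2, Subgroup.coe_mul, map_mul]; rfl]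
    exact mDMat_mul (SmoothMatOn.diffMatAt (smoothIntoSpinOn_rho hqs) hV hnV)
      (SmoothMatOn.diffMatAt (smoothIntoSpinOn_rho hh') hV hnV) v
  have e4 : (h n : Spin33) = (q n : Spin33) * (h' n : Spin33) := by
    rw [(hq n hnV).2]; rfl
  rw [liftForm_apply, liftForm_apply, hL, e3, e4, mul_inv_rev, map_mul, map_mul]
  change _ = rho (h' n : Spin33)⁻¹ * (rho (q n : Spin33)⁻¹ * θ.mat (c n) (mD E (Euc 8) c n v) *
    rho (q n : Spin33) + rho (q n : Spin33)⁻¹ * mDMat E (fun y => rho (q y : Spin33)) n v) *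
    rho (h' n : Spin33) + _
  have e5 : rho (q n : Spin33)⁻¹ * (rho (q n : Spin33) *
      mDMat E (fun y => rho (h' y : Spin33)) n v) = mDMat E (fun y => rho (h' y : Spin33)) n v := by
    rw [← mul_assoc, rho_inv_mul, one_mul]
  simp only [mul_add, add_mul, mul_assoc, e5]
  abel

lemma exists_isLiftForm [IsManifold (𝓡 15) ∞ (FeffBundle act)]
    (hπ : IsPrincipalBundle (d := 8) (m := 2) projective.parabolic act π)
    {θ : OneForm 𝒢 8 projective.alg} (hθ : IsCartanConnection projective act θ)
    (hcan : IsCanonicalStructure act) :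
    ∃ θ' : OneForm (FeffBundle act) 15 conformal.alg, IsLiftForm θ θ' := by
  choose U c h hx hl using hcan.exists_localLift
  refine ⟨fun x => (liftForm θ (c x) (h x) x).codRestrict conformal.alg.toSubmodule
    fun v => (hl x).liftForm_mem θ (hx x) v, fun U' c' h' hl' x hx' v => ?_⟩
  exact (hl x).liftForm_eq hπ hθ hcan hl' (hx x) hx' v

/-- The extended form along a family in `𝒢̃`. -/
lemma IsLiftForm.apply_mD (hπ : IsPrincipalBundle (d := 8) (m := 2) projective.parabolic act π)
    {θ : OneForm 𝒢 8 projective.alg} (hθ : IsCartanConnection projective act θ)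
    (hcan : IsCanonicalStructure act) {θ' : OneForm (FeffBundle act) 15 conformal.alg}
    (hθ' : IsLiftForm θ θ') {U : Set N} {F : N → FeffBundle act} {c : N → 𝒢}
    {h : N → conformal.parabolic} (hl : IsLocalLift E act U F c h)
    {n : N} (hn : n ∈ U) (v : E) :
    θ'.mat (F n) (mD E (Euc 15) F n v) = liftForm θ c h n v := by
  have hF : ContMDiffOn 𝓘(ℝ, E) (𝓡 15) ∞ F U :=
    (hcan.bundle.contMDiffOn_act hl.isOpen (hcan.smooth_incl.comp_contMDiffOn hl.smooth_left)
      hl.smooth_right).congr fun y hy => (hl.eq y hy).symm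
  obtain ⟨U', c', h', hx, hl'⟩ := hcan.exists_localLift (F n)
  rw [hθ' U' c' h' hl' _ hx, ← liftForm_comp hl' θ hx (mdiffAt_of_on hF hl.isOpen hn)]
  exact (hl'.comp hl.isOpen hF).liftForm_eq hπ hθ hcan hl ⟨hn, hx⟩ hn v

end Extension

/-! ### The extended form is a Cartan connection -/

section Smoothness

variable {d : ℕ} {X : Type*} [TopologicalSpace X] [ChartedSpace (Euc d) X]
  [IsManifold (𝓡 d) ∞ X]

/-- The differential of a smooth function is smooth. -/
lemma contMDiffOn_mD {f : X → ℝ} {U : Set X} (hU : IsOpen U)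
    (hf : ContMDiffOn (𝓡 d) 𝓘(ℝ, ℝ) ∞ f U) :
    ContMDiffOn (𝓡 d).tangent 𝓘(ℝ, ℝ) ∞
      (fun p : TangentBundle (𝓡 d) X => mD (Euc d) ℝ f p.1 p.2) (Bundle.TotalSpace.proj ⁻¹' U) := by
  have h1 := hf.contMDiffOn_tangentMapWithin (m := ∞) (by simp) hU.uniqueMDiffOn
  have h2 := (contMDiff_tangentBundleModelSpaceHomeomorph (I := 𝓘(ℝ, ℝ)) (n := ∞)).comp_contMDiffOn
    h1
  have h3 : ContMDiff (𝓘(ℝ, ℝ).prod 𝓘(ℝ, ℝ)) 𝓘(ℝ, ℝ) ∞ (fun p : ModelProd ℝ ℝ => p.2) := by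
    have h : ContMDiff (𝓘(ℝ, ℝ).prod 𝓘(ℝ, ℝ)) 𝓘(ℝ, ℝ) ∞ (fun p : ℝ × ℝ => p.2) := contMDiff_snd
    rw [chartedSpaceSelf_prod] at h
    exact h
  refine (h3.comp_contMDiffOn h2).congr fun p hp => ?_
  change mfderiv (𝓡 d) 𝓘(ℝ, ℝ) f p.1 p.2 = mfderivWithin (𝓡 d) 𝓘(ℝ, ℝ) f U p.1 p.2
  rw [mfderivWithin_of_isOpen hU hp]

/-- A smooth one-form along a smooth map. -/
lemma SmoothForm.contMDiffOn_comp {e : ℕ} {Y : Type*} [TopologicalSpace Y] [ChartedSpace (Euc e) Y]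
    [IsManifold (𝓡 e) ∞ Y] {α : Y → Euc e →ₗ[ℝ] ℝ} (hα : SmoothForm α) {c : X → Y} {U : Set X}
    (hU : IsOpen U) (hc : ContMDiffOn (𝓡 d) (𝓡 e) ∞ c U) :
    ContMDiffOn (𝓡 d).tangent 𝓘(ℝ, ℝ) ∞
      (fun p : TangentBundle (𝓡 d) X => α (c p.1) (mD (Euc d) (Euc e) c p.1 p.2))
      (Bundle.TotalSpace.proj ⁻¹' U) := by
  have h1 := hc.contMDiffOn_tangentMapWithin (m := ∞) (by simp) hU.uniqueMDiffOn
  refine (hα.comp_contMDiffOn h1).congr fun p hp => ?_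
  change α (c p.1) (mfderiv (𝓡 d) (𝓡 e) c p.1 p.2) =
    α (c p.1) (mfderivWithin (𝓡 d) (𝓡 e) c U p.1 p.2)
  rw [mfderivWithin_of_isOpen hU hp]

end Smoothness

section Extension

variable {𝒢 : Type*} [TopologicalSpace 𝒢] [ChartedSpace (Euc 8) 𝒢] [IsManifold (𝓡 8) ∞ 𝒢]
  {act : 𝒢 → projective.parabolic → 𝒢}
  [TopologicalSpace (FeffSpace act)] [ChartedSpace (Euc 4) (FeffSpace act)]
  [TopologicalSpace (FeffBundle act)] [ChartedSpace (Euc 15) (FeffBundle act)]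
  {M : Type*} [TopologicalSpace M] [ChartedSpace (Euc 2) M] {π : 𝒢 → M}
  {θ : OneForm 𝒢 8 projective.alg} {θ' : OneForm (FeffBundle act) 15 conformal.alg}

lemma IsLiftForm.restrict (hπ : IsPrincipalBundle (d := 8) (m := 2) projective.parabolic act π)
    (hθ : IsCartanConnection projective act θ)
    (hcan : IsCanonicalStructure act) (h' : IsLiftForm θ θ') (u : 𝒢) (v : Euc 8) :
    θ'.mat (feffIncl act u) (mD (Euc 8) (Euc 15) (feffIncl act) u v) = θ.mat u v := by
  have hl : IsLocalLift (Euc 8) act Set.univ (feffIncl act) (fun u => u) (fun _ => 1) :=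
    ⟨isOpen_univ, contMDiffOn_id, smoothIntoSpinOn_const _, fun y _ => hcan.bundle.act_one _⟩
  rw [h'.apply_mD hπ hθ hcan hl (Set.mem_univ u), liftForm_apply, mD_id, mDMat_const]
  simp

lemma IsLiftForm.fundamental (hπ : IsPrincipalBundle (d := 8) (m := 2) projective.parabolic act π)
    (hθ : IsCartanConnection projective act θ)
    (hcan : IsCanonicalStructure act) (h' : IsLiftForm θ θ') (γ : ℝ → conformal.parabolic)
    (hγ : SmoothIntoSpinOn 𝓘(ℝ, ℝ) (fun t => (γ t : Spin33)) Set.univ) (hγ0 : γ 0 = 1)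
    (x : FeffBundle act) (i j : Fin 3 ⊕ Fin 3) :
    HasDerivAt (fun t => rho (γ t : Spin33) i j)
      (θ'.mat (feffAct act x (γ 0)) (mD ℝ (Euc 15) (fun t => feffAct act x (γ t)) 0 (1 : ℝ)) i j)
      0 := by
  obtain ⟨u, p, rfl⟩ := exists_eq_feffAct x
  have hl : IsLocalLift ℝ act Set.univ
      (fun t => feffAct act (feffAct act (feffIncl act u) p) (γ t)) (fun _ => u)
      (fun t => p * γ t) :=
    ⟨isOpen_univ, contMDiffOn_const, (smoothIntoSpinOn_const _).mul hγ, fun y _ =>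
      hcan.bundle.act_mul _ _ _⟩
  have hd : DiffMatAt ℝ (fun t => rho (γ t : Spin33)) 0 :=
    SmoothMatOn.diffMatAt (smoothIntoSpinOn_rho hγ) isOpen_univ (Set.mem_univ _)
  have e0 := h'.apply_mD hπ hθ hcan hl (Set.mem_univ 0) 1
  have e1 : mDMat ℝ (fun t => rho ((p * γ t : conformal.parabolic) : Spin33)) 0 (1 : ℝ) =
      rho (p : Spin33) * mDMat ℝ (fun t => rho (γ t : Spin33)) 0 (1 : ℝ) := by
    simp only [Subgroup.coe_mul, map_mul]
    rw [mDMat_mul (diffMatAt_const _ _) hd, mDMat_const, zero_mul, add_zero]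
  rw [liftForm_apply, mD_const, map_zero, mul_zero, zero_mul, zero_add, e1, hγ0, mul_one,
    ← mul_assoc, rho_inv_mul, one_mul] at e0
  rw [hγ0, e0]
  have e2 : mDMat ℝ (fun t => rho (γ t : Spin33)) 0 (1 : ℝ) i j =
      deriv (fun t => rho (γ t : Spin33) i j) 0 := by
    simp only [mDMat, Matrix.of_apply, mD_eq_fderiv]
    rfl
  rw [e2]
  exact ((hd i j).differentiableAt).hasDerivAt

variable [IsManifold (𝓡 15) ∞ (FeffBundle act)]

lemma IsLiftForm.smooth (hθ : IsCartanConnection projective act θ)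
    (hcan : IsCanonicalStructure act) (h' : IsLiftForm θ θ') (i j : Fin 3 ⊕ Fin 3) :
    ContMDiff (𝓡 15).tangent 𝓘(ℝ, ℝ) ∞
      (fun p : TangentBundle (𝓡 15) (FeffBundle act) => (θ' p.1 p.2 : Mat33) i j) := by
  intro p
  obtain ⟨U, c, h, hx, hl⟩ := hcan.exists_localLift p.1
  have hV : IsOpen ((Bundle.TotalSpace.proj : TangentBundle (𝓡 15) (FeffBundle act) → _) ⁻¹' U) :=
    hl.isOpen.preimage (FiberBundle.continuous_proj _ _)
  refine ContMDiffOn.contMDiffAt ?_ (hV.mem_nhds hx)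
  have hproj : ContMDiffOn (𝓡 15).tangent (𝓡 15) ∞
      (Bundle.TotalSpace.proj : TangentBundle (𝓡 15) (FeffBundle act) → _)
      (Bundle.TotalSpace.proj ⁻¹' U) := (Bundle.contMDiff_proj _).contMDiffOn
  have hR : ∀ k l, ContMDiffOn (𝓡 15).tangent 𝓘(ℝ, ℝ) ∞
      (fun p : TangentBundle (𝓡 15) (FeffBundle act) => rho (h p.1 : Spin33) k l)
      (Bundle.TotalSpace.proj ⁻¹' U) := fun k l =>
    (hl.smooth_right.rho_apply k l).comp hproj fun _ hp => hp
  have hRi : ∀ k l, ContMDiffOn (𝓡 15).tangent 𝓘(ℝ, ℝ) ∞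
      (fun p : TangentBundle (𝓡 15) (FeffBundle act) => rho (h p.1 : Spin33)⁻¹ k l)
      (Bundle.TotalSpace.proj ⁻¹' U) := fun k l =>
    (hl.smooth_right.inv.rho_apply k l).comp hproj fun _ hp => hp
  have hA : ∀ k l, ContMDiffOn (𝓡 15).tangent 𝓘(ℝ, ℝ) ∞
      (fun p : TangentBundle (𝓡 15) (FeffBundle act) =>
        θ.mat (c p.1) (mD (Euc 15) (Euc 8) c p.1 p.2) k l)
      (Bundle.TotalSpace.proj ⁻¹' U) := fun k l =>
    (hθ.smoothMatForm k l).contMDiffOn_comp hl.isOpen hl.smooth_left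
  have hD : ∀ k l, ContMDiffOn (𝓡 15).tangent 𝓘(ℝ, ℝ) ∞
      (fun p : TangentBundle (𝓡 15) (FeffBundle act) =>
        mDMat (Euc 15) (fun y => rho (h y : Spin33)) p.1 p.2 k l)
      (Bundle.TotalSpace.proj ⁻¹' U) := fun k l =>
    contMDiffOn_mD hl.isOpen (hl.smooth_right.rho_apply k l)
  have hsum : ContMDiffOn (𝓡 15).tangent 𝓘(ℝ, ℝ) ∞
      (fun p : TangentBundle (𝓡 15) (FeffBundle act) =>
        ∑ l, (∑ k, rho (h p.1 : Spin33)⁻¹ i k *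
          θ.mat (c p.1) (mD (Euc 15) (Euc 8) c p.1 p.2) k l) * rho (h p.1 : Spin33) l j +
        ∑ k, rho (h p.1 : Spin33)⁻¹ i k *
          mDMat (Euc 15) (fun y => rho (h y : Spin33)) p.1 p.2 k j)
      (Bundle.TotalSpace.proj ⁻¹' U) :=
    (contMDiffOn_finsetSum fun l _ => (contMDiffOn_finsetSum fun k _ =>
      (hRi i k).mul (hA k l)).mul (hR l j)).add
      (contMDiffOn_finsetSum fun k _ => (hRi i k).mul (hD k j))
  have e : ∀ y ∈ U, ∀ v : Euc 15, θ'.mat y v i j =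
      ∑ l, (∑ k, rho (h y : Spin33)⁻¹ i k * θ.mat (c y) (mD (Euc 15) (Euc 8) c y v) k l) *
        rho (h y : Spin33) l j +
      ∑ k, rho (h y : Spin33)⁻¹ i k * mDMat (Euc 15) (fun y => rho (h y : Spin33)) y v k j := by
    intro y hy v
    rw [h' U c h hl y hy v, liftForm_apply]
    simp only [Matrix.add_apply, Matrix.mul_apply]
  exact hsum.congr fun p hp => e p.1 hp p.2

lemma IsLiftForm.equivariant (hπ : IsPrincipalBundle (d := 8) (m := 2) projective.parabolic act π)
    (hθ : IsCartanConnection projective act θ)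
    (hcan : IsCanonicalStructure act) (h' : IsLiftForm θ θ') (p : conformal.parabolic)
    (x : FeffBundle act) (v : Euc 15) :
    θ'.mat (feffAct act x p) (mD (Euc 15) (Euc 15) (fun y => feffAct act y p) x v) =
      rho (p : Spin33)⁻¹ * θ'.mat x v * rho (p : Spin33) := by
  obtain ⟨U, c, h, hx, hl⟩ := hcan.exists_localLift x
  have hl' : IsLocalLift (Euc 15) act U (fun y => feffAct act y p) c (fun y => h y * p) :=
    ⟨hl.isOpen, hl.smooth_left, hl.smooth_right.mul (smoothIntoSpinOn_const _), fun y hy => by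
      rw [hcan.bundle.act_mul, hl.eq y hy]⟩
  have hd := (smoothIntoSpinOn_rho hl.smooth_right).diffMatAt hl.isOpen hx
  rw [h'.apply_mD hπ hθ hcan hl' hx, h' U c h hl x hx, liftForm_apply, liftForm_apply]
  have e1 : mDMat (Euc 15) (fun y => rho ((h y * p : conformal.parabolic) : Spin33)) x v =
      mDMat (Euc 15) (fun y => rho (h y : Spin33)) x v * rho (p : Spin33) := by
    simp only [Subgroup.coe_mul, map_mul]
    rw [mDMat_mul hd (diffMatAt_const _ _), mDMat_const, mul_zero, zero_add]
  rw [e1, Subgroup.coe_mul, mul_inv_rev, map_mul, map_mul]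
  simp only [mul_add, add_mul, mul_assoc]

/-- The extended form is onto, since `sl(3)` acts transitively enough: its elements move `ṽ₊` in all
directions of `ṽ₊^⊥`, so that `so(3,3) = sl(3) + 𝔭̃`. -/
lemma IsLiftForm.surjective (hπ : IsPrincipalBundle (d := 8) (m := 2) projective.parabolic act π)
    (hθ : IsCartanConnection projective act θ)
    (hcan : IsCanonicalStructure act) (h' : IsLiftForm θ θ') (x : FeffBundle act) {X : Mat33}
    (hX : X ∈ conformal.alg) : ∃ v, θ'.mat x v = X := by
  -- the image at a point of `𝒢` contains `sl(3)` and the velocities of curves in `P̃`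
  have key : ∀ (u : 𝒢) {X : Mat33}, X ∈ conformal.alg → ∃ v, θ'.mat (feffIncl act u) v = X := by
    intro u X hX
    let S : Submodule ℝ Mat33 := LinearMap.range (θ'.mat (feffIncl act u))
    have hsl : ∀ Y ∈ projective.alg, Y ∈ S := by
      intro Y hY
      obtain ⟨(v : Euc 8), hv⟩ := (hθ.bijective u).2 ⟨Y, hY⟩
      refine ⟨mD (Euc 8) (Euc 15) (feffIncl act) u v, ?_⟩
      rw [h'.restrict hπ hθ hcan]
      exact congrArg Subtype.val hv
    have hw : ∀ x c : Vec33, Q33 x = 0 → Q33 c = 1 → hForm x c = 0 → hForm vTilde x = 0 →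
        hForm vTilde c = 0 → wedge x c ∈ S := by
      intro x c h1 h2 h3 h4 h5
      obtain ⟨γ, hγ, hγ0, hγd⟩ := exists_shear_curve h1 h2 h3 h4 h5
      refine ⟨mD ℝ (Euc 15) (fun t => feffAct act (feffIncl act u) (γ t)) 0 (1 : ℝ), ?_⟩
      ext i j
      have h6 := h'.fundamental hπ hθ hcan γ hγ hγ0 (feffIncl act u) i j
      rw [hγ0, hcan.bundle.act_one] at h6
      exact h6.unique (hγd i j)
    obtain ⟨k, hk⟩ := sub_sum_mem_parabolicAlg (C := fun i =>
      ⟨slC i, projective_le_conformal (slC i).2⟩) slC_vTilde ⟨X, hX⟩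
    set G : Mat33 := ∑ i, conformalQuot ⟨X, hX⟩ i • (slC i : Mat33) with hG
    have hk' : (X - G) *ᵥ vTilde = k • vTilde := by
      have hk1 : ((⟨X, hX⟩ - ∑ i, conformalQuot ⟨X, hX⟩ i •
          ⟨slC i, projective_le_conformal (slC i).2⟩ : conformal.alg) : Mat33) *ᵥ vTilde =
          k • vTilde := hk
      rw [hG]
      simpa using hk1
    obtain ⟨Y, hY, hYk⟩ := exists_sl_smul k
    have hGm : G ∈ projective.alg := by
      rw [hG]
      exact projective.alg.toSubmodule.sum_mem fun i _ => projective.alg.smul_mem _ (slC i).2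
    have h0 : X - G - Y ∈ S := mem_of_wedge_mem hw
      (conformal.alg.sub_mem (conformal.alg.sub_mem hX (projective_le_conformal hGm))
        (projective_le_conformal hY)) (by rw [Matrix.sub_mulVec, hk', hYk, sub_self])
    have h1 := S.add_mem (S.add_mem h0 (hsl _ hY)) (hsl _ hGm)
    rwa [sub_add_cancel, sub_add_cancel] at h1
  obtain ⟨u, p, rfl⟩ := exists_eq_feffAct x
  have hX' : rho (p : Spin33) * X * rho (p : Spin33)⁻¹ ∈ conformal.alg := by
    simpa using conj_mem_conformal (p : Spin33)⁻¹ hX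
  obtain ⟨v, hv⟩ := key u hX'
  refine ⟨mD (Euc 15) (Euc 15) (fun y => feffAct act y p) (feffIncl act u) v, ?_⟩
  rw [h'.equivariant hπ hθ hcan, hv]
  simp only [mul_assoc]
  rw [rho_inv_mul, mul_one, ← mul_assoc, rho_inv_mul, one_mul]

lemma IsLiftForm.isExtension (hπ : IsPrincipalBundle (d := 8) (m := 2) projective.parabolic act π)
    (hθ : IsCartanConnection projective act θ)
    (hcan : IsCanonicalStructure act) (h' : IsLiftForm θ θ') : IsExtension act θ θ' where
  cartan :=
    { smooth := h'.smooth hθ hcan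
      equivariant := h'.equivariant hπ hθ hcan
      fundamental := h'.fundamental hπ hθ hcan
      bijective := by
        intro x
        let f : Euc 15 →ₗ[ℝ] conformal.alg := θ' x
        have hs : Function.Surjective f := by
          intro X
          obtain ⟨v, hv⟩ := h'.surjective hπ hθ hcan x X.2
          exact ⟨v, Subtype.ext hv⟩
        -- a surjection from a space of dimension `15` to one of dimension at least `15`
        have h1 := f.finrank_range_add_finrank_ker
        rw [LinearMap.range_eq_top.2 hs, finrank_top, finrank_euclideanSpace, Fintype.card_fin]
          at h1
        have h2 := le_finrank_conformal
        have h3 : LinearMap.ker f = ⊥ :=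
          Submodule.finrank_eq_zero.1 (by omega)
        exact ⟨LinearMap.ker_eq_bot.1 h3, hs⟩ }
  restrict := h'.restrict hπ hθ hcan

end Extension

/-! ### The curvature function -/

section CurvatureFunction

variable {d m : ℕ} {X M : Type*}
  [TopologicalSpace X] [ChartedSpace (Euc d) X] [IsManifold (𝓡 d) ∞ X]
  [TopologicalSpace M] [ChartedSpace (Euc m) M]
  {𝔪 : Model} {act : X → 𝔪.parabolic → X} {π : X → M} {θ : OneForm X d 𝔪.alg}

/-- A Cartan connection identifies each tangent space with the Lie algebra. -/
def IsCartanConnection.equiv (hθ : IsCartanConnection 𝔪 act θ) (u : X) : Euc d ≃ₗ[ℝ] 𝔪.alg :=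
  LinearEquiv.ofBijective (θ u : Euc d →ₗ[ℝ] 𝔪.alg) (hθ.bijective u)

lemma IsCartanConnection.mat_symm (hθ : IsCartanConnection 𝔪 act θ) (u : X) (A : 𝔪.alg) :
    θ.mat u ((hθ.equiv u).symm A) = (A : Mat33) :=
  congrArg Subtype.val ((hθ.equiv u).apply_symm_apply A)

lemma IsCartanConnection.coe_equiv (hθ : IsCartanConnection 𝔪 act θ) (u : X) (v : Euc d) :
    (hθ.equiv u v : Mat33) = θ.mat u v := rfl

lemma IsCartanConnection.symm_eq (hθ : IsCartanConnection 𝔪 act θ) {u : X} {v : Euc d} {A : 𝔪.alg}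
    (h : θ.mat u v = A) : (hθ.equiv u).symm A = v := by
  rw [LinearEquiv.symm_apply_eq]
  exact Subtype.ext h.symm

/-- The curvature function, as a bilinear map. -/
def IsCartanConnection.curv (hθ : IsCartanConnection 𝔪 act θ) (u : X) :
    𝔪.alg →ₗ[ℝ] 𝔪.alg →ₗ[ℝ] Mat33 :=
  (curvBilin hθ.smoothMatForm u).compl₁₂ (hθ.equiv u).symm.toLinearMap
    (hθ.equiv u).symm.toLinearMap

lemma IsCartanConnection.curv_apply (hθ : IsCartanConnection 𝔪 act θ) (u : X) (A B : 𝔪.alg) :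
    hθ.curv u A B = curvMat θ.mat u ((hθ.equiv u).symm A) ((hθ.equiv u).symm B) := rfl

lemma IsCartanConnection.curvatureFunction_eq (hθ : IsCartanConnection 𝔪 act θ) (u : X)
    (A B : 𝔪.alg) : curvatureFunction θ u A B = hθ.curv u A B := by
  have h : ∀ A : 𝔪.alg, Function.invFun (θ u) A = (hθ.equiv u).symm A := by
    intro A
    apply (hθ.bijective u).1
    rw [Function.rightInverse_invFun (hθ.bijective u).2 A]
    exact ((hθ.equiv u).apply_symm_apply A).symm
  rw [curvatureFunction, h, h]
  rfl

lemma IsCartanConnection.curv_swap (hθ : IsCartanConnection 𝔪 act θ) (u : X) (A B : 𝔪.alg) :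
    hθ.curv u A B = -hθ.curv u B A := curvMat_swap _ _ _ _

lemma IsCartanConnection.curv_self (hθ : IsCartanConnection 𝔪 act θ) (u : X) (A : 𝔪.alg) :
    hθ.curv u A A = 0 := by
  ext i j
  have h := congrFun (congrFun (hθ.curv_swap u A A) i) j
  rw [Matrix.neg_apply] at h
  rw [Matrix.zero_apply]
  linarith

lemma IsCartanConnection.curvMat_mem (hθ : IsCartanConnection 𝔪 act θ) (u : X) (v w : Euc d) :
    curvMat θ.mat u v w ∈ 𝔪.alg :=
  𝔪.alg.add_mem (dMat_mem hθ.smoothMatForm (S := 𝔪.alg.toSubmodule) (fun x v => (θ x v).2) u v w)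
    (𝔪.alg.lie_mem (θ u v).2 (θ u w).2)

lemma IsCartanConnection.curv_mem (hθ : IsCartanConnection 𝔪 act θ) (u : X) (A B : 𝔪.alg) :
    hθ.curv u A B ∈ 𝔪.alg := hθ.curvMat_mem u _ _

/-- Vertical vectors are those that a Cartan connection maps to the parabolic subalgebra. -/
lemma IsCartanConnection.vertical_iff
    (hP : IsPrincipalBundle (d := d) (m := m) 𝔪.parabolic act π) (hθ : IsCartanConnection 𝔪 act θ)
    {q : 𝔪.alg →ₗ[ℝ] (Fin m → ℝ)} (hqs : Function.Surjective q)
    (hq : ∀ A, A ∈ 𝔪.parabolicAlg ↔ q A = 0) {u : X} {ξ : Euc d} :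
    mD (Euc d) (Euc m) π u ξ = 0 ↔ hθ.equiv u ξ ∈ 𝔪.parabolicAlg := by
  have h : ∀ ξ : Euc d, mD (Euc d) (Euc m) π u ξ = 0 → hθ.equiv u ξ ∈ 𝔪.parabolicAlg := by
    intro ξ hξ
    exact hθ.vertical_mulVec hP le_rfl (fun _ _ => rfl) hP inf_le_right hξ
  exact ⟨h ξ, fun h' => vertical_of_apply_eq_zero (hθ.bijective u) q hqs
    (fun ξ hξ => (hq _).1 (h ξ hξ)) ((hq _).1 h')⟩

lemma IsCartanConnection.curv_of_mem
    (hP : IsPrincipalBundle (d := d) (m := m) 𝔪.parabolic act π) (hθ : IsCartanConnection 𝔪 act θ)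
    {q : 𝔪.alg →ₗ[ℝ] (Fin m → ℝ)} (hqs : Function.Surjective q)
    (hq : ∀ A, A ∈ 𝔪.parabolicAlg ↔ q A = 0) (u : X) {A : 𝔪.alg} (hA : A ∈ 𝔪.parabolicAlg)
    (B : 𝔪.alg) : hθ.curv u A B = 0 := by
  have h : hθ.equiv u ((hθ.equiv u).symm A) = A := LinearEquiv.apply_symm_apply _ _
  exact hθ.curvMat_vertical hP ((hθ.vertical_iff hP hqs hq).2 (h.symm ▸ hA)) _

/-- Linear maps commute with the exterior derivative. -/
lemma dMat_linear {Θ : X → Euc d →ₗ[ℝ] Mat33} (hΘ : SmoothMatForm Θ)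
    (T : Mat33 →ₗ[ℝ] Mat33) (u : X) (v w : Euc d) :
    dMat (fun x => T ∘ₗ Θ x) u v w = T (dMat Θ u v w) := by
  ext i j
  exact (functional_dMat hΘ (entry i j ∘ₗ T) u v w).symm

end CurvatureFunction

/-! ### Normality of conformal Cartan connections -/

section ConformalNormal

lemma conformalQuot_surjective : Function.Surjective conformalQuot := by
  intro y
  refine ⟨∑ j, y j • stdA j, ?_⟩
  have h : ∀ j, conformalQuot (stdA j) = Pi.single j 1 := by
    intro j
    funext i
    simp [conformalQuot_apply, stdA_vTilde, hForm_frameB_frameA, Pi.single_apply, eq_comm]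
  rw [map_sum]
  funext i
  simp only [map_smul, h, Finset.sum_apply, Pi.smul_apply, Pi.single_apply, smul_eq_mul]
  simp

lemma projectiveQuot_surjective : Function.Surjective projectiveQuot := by
  intro y
  refine ⟨∑ j, y j • projA j, ?_⟩
  funext i
  fin_cases i <;> simp [projectiveQuot_projA]

/-- The automorphism `Ad(g⁻¹)` of `so(3,3)`. -/
def adInv (g : Spin33) : conformal.alg →ₗ[ℝ] conformal.alg where
  toFun A := ⟨rho g⁻¹ * (A : Mat33) * rho g, conj_mem_conformal g A.2⟩
  map_add' A B := Subtype.ext (by simp [mul_add, add_mul])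
  map_smul' c A := Subtype.ext (by simp)

lemma coe_adInv (g : Spin33) (A : conformal.alg) :
    (adInv g A : Mat33) = rho g⁻¹ * (A : Mat33) * rho g := rfl

lemma adInv_adInv_inv (g : Spin33) (A : conformal.alg) : adInv g (adInv g⁻¹ A) = A := by
  apply Subtype.ext
  rw [coe_adInv, coe_adInv, inv_inv]
  simp only [mul_assoc]
  rw [rho_inv_mul, mul_one, ← mul_assoc, rho_inv_mul, one_mul]

lemma adInv_inv_adInv (g : Spin33) (A : conformal.alg) : adInv g⁻¹ (adInv g A) = A := by
  have := adInv_adInv_inv g⁻¹ A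
  rwa [inv_inv] at this

lemma killingForm_adInv (g : Spin33) (A B : conformal.alg) :
    killingForm ℝ conformal.alg (adInv g A) B = killingForm ℝ conformal.alg A (adInv g⁻¹ B) := by
  rw [killingForm_conformal, killingForm_conformal, coe_adInv, coe_adInv, inv_inv, mul_assoc,
    mul_assoc, Matrix.trace_mul_comm]
  simp only [mul_assoc]

lemma adInv_mem_parabolicAlg {p : Spin33} (hp : p ∈ conformal.parabolic) {A : conformal.alg}
    (hA : A ∈ conformal.parabolicAlg) : adInv p A ∈ conformal.parabolicAlg := by
  obtain ⟨a, ha⟩ := hA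
  obtain ⟨-, c', -, hc'⟩ := conformal.parabolic.inv_mem hp
  obtain ⟨-, c, -, hc⟩ := hp
  refine ⟨c * (a * c'), ?_⟩
  rw [coe_adInv, ← Matrix.mulVec_mulVec, ← Matrix.mulVec_mulVec, hc, Matrix.mulVec_smul, ha,
    Matrix.mulVec_smul, Matrix.mulVec_smul, hc', smul_smul, smul_smul, mul_assoc]

/-- The image of the standard frame under `Ad(p)` is a dual frame. -/
lemma isDualFrame_adInv {p : Spin33} (hp : p ∈ conformal.parabolic) :
    IsDualFrame conformal (fun i => adInv p⁻¹ (stdA i)) (fun i => adInv p⁻¹ (stdZ i)) := by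
  refine isDualFrame_of_quot (conformalQuot ∘ₗ adInv p) (fun A => ?_) (fun i j => ?_) fun A j => ?_
  · rw [LinearMap.comp_apply, ← mem_parabolicAlg_conformal]
    refine ⟨adInv_mem_parabolicAlg hp, fun h => ?_⟩
    rw [← adInv_inv_adInv p A]
    exact adInv_mem_parabolicAlg (conformal.parabolic.inv_mem hp) h
  · rw [LinearMap.comp_apply, adInv_adInv_inv, conformalQuot_apply, stdA_vTilde,
      hForm_frameB_frameA]
    simp [eq_comm]
  · rw [← killingForm_adInv, killingForm_stdZ]
    rfl

/-- The bilinear map `(A, Z) ↦ [κ(A, B), Z]`. -/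
def bracketMap (κ : conformal.alg →ₗ[ℝ] conformal.alg →ₗ[ℝ] Mat33) (B : conformal.alg) :
    conformal.alg →ₗ[ℝ] conformal.alg →ₗ[ℝ] Mat33 :=
  LinearMap.mk₂ ℝ (fun A Z => ⁅κ A B, (Z : Mat33)⁆) (by intros; simp) (by intros; simp)
    (by intros; simp) (by intros; simp)

lemma bracketMap_apply (κ : conformal.alg →ₗ[ℝ] conformal.alg →ₗ[ℝ] Mat33)
    (B A Z : conformal.alg) : bracketMap κ B A Z = ⁅κ A B, (Z : Mat33)⁆ := rfl

/-- For a horizontal skew two-cochain `κ`, the second term of the codifferential vanishes, and the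
first one may be computed in any frame. -/
lemma IsDualFrame.codifferential_eq {n : ℕ} {A Z : Fin n → conformal.alg}
    (h : IsDualFrame conformal A Z) {C : Fin 4 → conformal.alg}
    (hC : ∀ j, (C j : Mat33) *ᵥ vTilde = frameA j)
    {κ : conformal.alg →ₗ[ℝ] conformal.alg →ₗ[ℝ] Mat33} (hsw : ∀ A B, κ A B = -κ B A)
    (hκ : ∀ A ∈ conformal.parabolicAlg, ∀ B, κ A B = 0) (B : conformal.alg) :
    codifferential A Z (fun A B => κ A B) B =
      (2 : ℝ) • ∑ j, ⁅κ (C j) B, (stdZ j : Mat33)⁆ := by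
  let g : conformal.alg →ₗ[ℝ] conformal.alg →ₗ[ℝ] Mat33 :=
    LinearMap.mk₂ ℝ (fun A Z => κ A ⁅Z, B⁆) (by intros; simp) (by intros; simp)
      (by intros; simp) (by intros; simp)
  have h1 := h.sum_eq hC (bracketMap κ B) fun Y hY W => by
    rw [bracketMap_apply, hκ Y hY, zero_lie]
  have h2 := h.sum_eq hC g fun Y hY W => hκ Y hY _
  have h3 : ∀ j, g (C j) (stdZ j) = 0 := fun j => by
    change κ (C j) ⁅stdZ j, B⁆ = 0
    rw [hsw, hκ _ (lie_stdZ_mem j B), neg_zero]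
  rw [Finset.sum_eq_zero fun j _ => h3 j] at h2
  change (2 : ℝ) • ∑ i, bracketMap κ B (A i) (Z i) + ∑ i, g (A i) (Z i) = _
  rw [h1, h2, add_zero]
  rfl

variable {X M : Type*} [TopologicalSpace X] [ChartedSpace (Euc 15) X] [IsManifold (𝓡 15) ∞ X]
  [TopologicalSpace M] [ChartedSpace (Euc 4) M]
  {act : X → conformal.parabolic → X} {π : X → M} {θ : OneForm X 15 conformal.alg}

lemma IsCartanConnection.curv_of_mem_conformal
    (hP : IsPrincipalBundle (d := 15) (m := 4) conformal.parabolic act π)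
    (hθ : IsCartanConnection conformal act θ) (u : X) {A : conformal.alg}
    (hA : A ∈ conformal.parabolicAlg) (B : conformal.alg) : hθ.curv u A B = 0 :=
  hθ.curv_of_mem hP conformalQuot_surjective (fun _ => mem_parabolicAlg_conformal) u hA B

/-- Equivariance of the curvature function. -/
lemma IsCartanConnection.curv_act
    (hP : IsPrincipalBundle (d := 15) (m := 4) conformal.parabolic act π)
    (hθ : IsCartanConnection conformal act θ) (u : X) (p : conformal.parabolic)
    (A B : conformal.alg) : hθ.curv (act u p) (adInv p A) (adInv p B) =
      rho (p : Spin33)⁻¹ * hθ.curv u A B * rho (p : Spin33) := by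
  let T : Mat33 →ₗ[ℝ] Mat33 :=
    LinearMap.mulRight ℝ (rho (p : Spin33)) ∘ₗ LinearMap.mulLeft ℝ (rho (p : Spin33)⁻¹)
  have hT : ∀ Y, T Y = rho (p : Spin33)⁻¹ * Y * rho (p : Spin33) := fun Y => rfl
  have hs : ∀ A : conformal.alg, (hθ.equiv (act u p)).symm (adInv p A) =
      mD (Euc 15) (Euc 15) (fun x => act x p) u ((hθ.equiv u).symm A) := by
    intro A
    refine hθ.symm_eq ?_
    rw [coe_adInv, ← hθ.mat_symm u A]
    exact hθ.equivariant p u _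
  have hlie : ∀ Y W : Mat33, ⁅T Y, T W⁆ = T ⁅Y, W⁆ := by
    have e : ∀ Y W : Mat33, T Y * T W = T (Y * W) := by
      intro Y W
      simp only [hT, mul_assoc]
      rw [← mul_assoc (rho (p : Spin33)) (rho (p : Spin33)⁻¹), rho_mul_inv, one_mul]
    intro Y W
    rw [Ring.lie_def, Ring.lie_def, e, e, map_sub]
  rw [hθ.curv_apply, hs, hs, ← curvMat_pullback (hP.contMDiff_act_right p) hθ.smoothMatForm
    (Θ' := fun x => T ∘ₗ θ.mat x) (fun x v => (hθ.equivariant p x v).symm), curvMat,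
    dMat_linear hθ.smoothMatForm, ← hT, hθ.curv_apply, curvMat, map_add, ← hlie]
  rfl

/-- It suffices to check normality at one point of each fibre, in one frame. -/
lemma IsCartanConnection.isNormal_of_section
    (hP : IsPrincipalBundle (d := 15) (m := 4) conformal.parabolic act π)
    (hθ : IsCartanConnection conformal act θ)
    (h : ∀ x, ∃ (u : X) (p : conformal.parabolic), x = act u p ∧ ∃ C : Fin 4 → conformal.alg,
      (∀ j, (C j : Mat33) *ᵥ vTilde = frameA j) ∧
      ∀ B, ∑ j, ⁅hθ.curv u (C j) B, (stdZ j : Mat33)⁆ = 0) : IsNormal conformal θ := by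
  intro n A Z hAZ x B
  have hκ : curvatureFunction θ x = fun A B => hθ.curv x A B := by
    funext A B
    exact hθ.curvatureFunction_eq x A B
  rw [hκ, hAZ.codifferential_eq stdA_vTilde (hθ.curv_swap x)
    (fun A hA B => hθ.curv_of_mem_conformal hP x hA B)]
  obtain ⟨u, p, rfl, C, hC, h0⟩ := h x
  have h1 : ∀ j, ⁅hθ.curv (act u p) (stdA j) B, (stdZ j : Mat33)⁆ =
      rho (p : Spin33)⁻¹ * bracketMap (hθ.curv u) (adInv (p : Spin33)⁻¹ B)
        (adInv (p : Spin33)⁻¹ (stdA j)) (adInv (p : Spin33)⁻¹ (stdZ j)) * rho (p : Spin33) := by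
    intro j
    have e1 := hθ.curv_act hP u p (adInv (p : Spin33)⁻¹ (stdA j)) (adInv (p : Spin33)⁻¹ B)
    rw [adInv_adInv_inv, adInv_adInv_inv] at e1
    have e2 : (stdZ j : Mat33) =
        rho (p : Spin33)⁻¹ * (adInv (p : Spin33)⁻¹ (stdZ j) : Mat33) * rho (p : Spin33) := by
      rw [← coe_adInv, adInv_adInv_inv]
    rw [e1, e2, bracketMap_apply, Ring.lie_def, Ring.lie_def, mul_sub, sub_mul]
    have e3 : ∀ Y W : Mat33, rho (p : Spin33)⁻¹ * Y * rho (p : Spin33) *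
        (rho (p : Spin33)⁻¹ * W * rho (p : Spin33)) =
        rho (p : Spin33)⁻¹ * (Y * W) * rho (p : Spin33) := by
      intro Y W
      simp only [mul_assoc]
      rw [← mul_assoc (rho (p : Spin33)) (rho (p : Spin33)⁻¹), rho_mul_inv, one_mul]
    rw [e3, e3]
  simp only [h1, ← Finset.mul_sum, ← Finset.sum_mul]
  rw [(isDualFrame_adInv p.2).sum_eq hC _ fun Y hY W => by
    rw [bracketMap_apply, hθ.curv_of_mem_conformal hP u hY, zero_lie]]
  simp only [bracketMap_apply, h0, mul_zero, zero_mul, smul_zero]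

/-- Normality in terms of the standard frame. -/
lemma IsCartanConnection.sum_lie_curv_eq_zero
    (hP : IsPrincipalBundle (d := 15) (m := 4) conformal.parabolic act π)
    (hθ : IsCartanConnection conformal act θ) (hn : IsNormal conformal θ) (u : X)
    (B : conformal.alg) : ∑ j, ⁅hθ.curv u (stdA j) B, (stdZ j : Mat33)⁆ = 0 := by
  have h := hn 4 stdA stdZ isDualFrame_std u B
  have hκ : curvatureFunction θ u = fun A B => hθ.curv u A B := by
    funext A B
    exact hθ.curvatureFunction_eq u A B
  rw [hκ, isDualFrame_std.codifferential_eq stdA_vTilde (hθ.curv_swap u)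
    (fun A hA B => hθ.curv_of_mem_conformal hP u hA B)] at h
  exact (smul_eq_zero.1 h).resolve_left two_ne_zero

end ConformalNormal

/-! ### Normality of the extension -/

section ExtensionNormal

variable {M 𝒢 : Type*} [TopologicalSpace M] [ChartedSpace (Euc 2) M]
  [TopologicalSpace 𝒢] [ChartedSpace (Euc 8) 𝒢] [IsManifold (𝓡 8) ∞ 𝒢]
  {act : 𝒢 → projective.parabolic → 𝒢} {π : 𝒢 → M} {θ : OneForm 𝒢 8 projective.alg}

/-- The curvature of a normal projective Cartan connection has values in `𝔭₊`. -/
lemma IsCartanConnection.curv_projA_mulVec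
    (hπ : IsPrincipalBundle (d := 8) (m := 2) projective.parabolic act π)
    (hθ : IsCartanConnection projective act θ) (hn : IsNormal projective θ) (u : 𝒢) :
    hθ.curv u (projA 0) (projA 1) *ᵥ Sum.elim ![1, 0, 0] 0 = 0 ∧
    hθ.curv u (projA 0) (projA 1) *ᵥ Sum.elim 0 ![0, 1, 0] = 0 ∧
    hθ.curv u (projA 0) (projA 1) *ᵥ Sum.elim 0 ![0, 0, 1] = 0 := by
  have hκ : curvatureFunction θ u = fun A B => hθ.curv u A B := by
    funext A B
    exact hθ.curvatureFunction_eq u A B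
  have h0 : ∀ j, ∑ i, ⁅hθ.curv u (projA i) (projA j), (projZ i : Mat33)⁆ = 0 := by
    intro j
    have h := hn 2 projA projZ isDualFrame_proj u (projA j)
    rw [hκ, codifferential, Finset.sum_eq_zero (s := Finset.univ)
      (f := fun i => hθ.curv u (projA i) ⁅projZ i, projA j⁆) fun i _ => by
        rw [hθ.curv_swap, hθ.curv_of_mem hπ projectiveQuot_surjective
          (fun _ => mem_parabolicAlg_projective) u (lie_projZ_projA_mem i j), neg_zero],
      add_zero] at h
    exact (smul_eq_zero.1 h).resolve_left two_ne_zero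
  have h1 := h0 1
  have h2 := h0 0
  rw [Fin.sum_univ_two, hθ.curv_self, zero_lie, add_zero] at h1
  rw [Fin.sum_univ_two, hθ.curv_self, zero_lie, zero_add, hθ.curv_swap, neg_lie,
    neg_eq_zero] at h2
  refine mulVec_eq_zero_of_lie_projZ (hθ.curv_mem u _ _) fun i => ?_
  fin_cases i
  · exact h1
  · exact h2

variable [TopologicalSpace (FeffSpace act)] [ChartedSpace (Euc 4) (FeffSpace act)]
  [TopologicalSpace (FeffBundle act)] [ChartedSpace (Euc 15) (FeffBundle act)]
  [IsManifold (𝓡 15) ∞ (FeffBundle act)] {θ₁ : OneForm (FeffBundle act) 15 conformal.alg}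

/-- The inclusion of `sl(3)` into `so(3,3)`. -/
def slIncl : projective.alg →ₗ[ℝ] conformal.alg :=
  Submodule.inclusion (show projective.alg.toSubmodule ≤ conformal.alg.toSubmodule from
    projective_le_conformal)

lemma coe_slIncl (A : projective.alg) : (slIncl A : Mat33) = A := rfl

/-- Along `𝒢`, the curvature of the extension is that of `θ`. -/
lemma IsExtension.curv_slIncl (hcan : IsCanonicalStructure act)
    (hθ : IsCartanConnection projective act θ) (h₁ : IsExtension act θ θ₁) (u : 𝒢)
    (A B : projective.alg) :
    h₁.cartan.curv (feffIncl act u) (slIncl A) (slIncl B) = hθ.curv u A B := by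
  have hs : ∀ A : projective.alg, (h₁.cartan.equiv (feffIncl act u)).symm (slIncl A) =
      mD (Euc 8) (Euc 15) (feffIncl act) u ((hθ.equiv u).symm A) := by
    intro A
    refine h₁.cartan.symm_eq ?_
    rw [coe_slIncl, ← hθ.mat_symm u A]
    exact h₁.restrict u _
  rw [h₁.cartan.curv_apply, hs, hs, ← curvMat_pullback hcan.smooth_incl
    h₁.cartan.smoothMatForm (Θ' := θ.mat) (fun x v => (h₁.restrict x v).symm), hθ.curv_apply]

/-- The curvature `K` of `θ` at a point of `𝒢` vanishes on `𝔭` and has values in `𝔭₊`. In the frame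
`slC` only the entry with indices `0` and `3` remains, and `K` kills `ṽ₊`, `b₀` and `b₃`, so that it
commutes with the corresponding elements `ṽ₊ ∧ bᵢ` of `𝔭̃₊`. -/
lemma IsExtension.isNormal
    (hπ : IsPrincipalBundle (d := 8) (m := 2) projective.parabolic act π)
    (hθ : IsCartanConnection projective act θ) (hn : IsNormal projective θ)
    (hcan : IsCanonicalStructure act) (h₁ : IsExtension act θ θ₁) : IsNormal conformal θ₁ := by
  refine h₁.cartan.isNormal_of_section hcan.bundle fun x => ?_
  obtain ⟨u, p, hx⟩ := exists_eq_feffAct x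
  refine ⟨feffIncl act u, p, hx, fun j => slIncl (slC j), slC_vTilde, fun B => ?_⟩
  obtain ⟨k1, k2, k3⟩ := hθ.curv_projA_mulVec hπ hn u
  set K := hθ.curv u (projA 0) (projA 1) with hK
  have hKm : K ∈ conformal.alg := projective_le_conformal (hθ.curv_mem u _ _)
  have hl : K *ᵥ vTilde = 0 := by
    have : vTilde = (Sum.elim ![1, 0, 0] 0 : Vec33) + (Sum.elim 0 ![0, 0, 1] : Vec33) := by
      ext (i | i) <;> simp [vTilde]
    rw [this, Matrix.mulVec_add, k1, k3, add_zero]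
  have hb3 : K *ᵥ frameB 3 = 0 := by
    have : frameB 3 = (-1 / 2 : ℝ) • (Sum.elim ![1, 0, 0] 0 : Vec33) +
        (1 / 2 : ℝ) • (Sum.elim 0 ![0, 0, 1] : Vec33) := by
      ext (i | i) <;> fin_cases i <;> simp [frameB]
    rw [this, Matrix.mulVec_add, Matrix.mulVec_smul, Matrix.mulVec_smul, k1, k3]
    simp
  have hbr : ∀ j, K *ᵥ frameB j = 0 → ⁅K, (stdZ j : Mat33)⁆ = 0 := by
    intro j hj
    change ⁅K, (1 / 8 : ℝ) • wedge vTilde (frameB j)⁆ = 0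
    rw [lie_smul, lie_wedge hKm, hl, hj, wedge_zero_right, wedge_swap, wedge_zero_right]
    simp
  -- these two frame vectors are vertical for `𝒢 → M`
  have hp : ∀ j : Fin 4, j = 1 ∨ j = 2 → slC j ∈ projective.parabolicAlg := by
    intro j hj
    rw [mem_parabolicAlg_projective]
    ext i
    rcases hj with rfl | rfl <;> fin_cases i <;> simp [projectiveQuot, slC, slMat]
  have hz : ∀ j : Fin 4, j = 1 ∨ j = 2 → ∀ A, hθ.curv u (slC j) A = 0 := fun j hj A =>
    hθ.curv_of_mem hπ projectiveQuot_surjective (fun _ => mem_parabolicAlg_projective) u (hp j hj) A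
  have hjk : ∀ j k : Fin 4, ⁅hθ.curv u (slC j) (slC k), (stdZ j : Mat33)⁆ = 0 := by
    intro j k
    by_cases hj : j = 1 ∨ j = 2
    · rw [hz j hj, zero_lie]
    by_cases hk : k = 1 ∨ k = 2
    · rw [hθ.curv_swap, hz k hk, neg_zero, zero_lie]
    by_cases hjk : j = k
    · rw [hjk, hθ.curv_self, zero_lie]
    have h03 : (j = 0 ∧ k = 3) ∨ (j = 3 ∧ k = 0) := by omega
    rcases h03 with ⟨rfl, rfl⟩ | ⟨rfl, rfl⟩
    · exact hbr 0 k2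
    · rw [hθ.curv_swap, neg_lie, neg_eq_zero]
      exact hbr 3 hb3
  have hB := sub_sum_mem_parabolicAlg (C := fun j => slIncl (slC j)) slC_vTilde B
  refine Finset.sum_eq_zero fun j _ => ?_
  have h2 : h₁.cartan.curv (feffIncl act u) (slIncl (slC j)) B =
      ∑ k, conformalQuot B k • hθ.curv u (slC j) (slC k) := by
    have h3 := h₁.cartan.curv_of_mem_conformal hcan.bundle (feffIncl act u) hB (slIncl (slC j))
    rw [h₁.cartan.curv_swap, neg_eq_zero, map_sub, sub_eq_zero] at h3
    rw [h3, map_sum]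
    refine Finset.sum_congr rfl fun k _ => ?_
    rw [map_smul, h₁.curv_slIncl hcan hθ]
  rw [h2, LieRing.of_associative_ring_bracket, Finset.sum_mul, Finset.mul_sum,
    ← Finset.sum_sub_distrib]
  refine Finset.sum_eq_zero fun k _ => ?_
  rw [← Ring.lie_def, smul_lie, hjk, smul_zero]

end ExtensionNormal

/-! ### Uniqueness of normal conformal Cartan connections -/

section TensorAlgebra

/-- A family that is symmetric in one pair of indices and skew in another one vanishes. -/
lemma eq_zero_of_symm_of_skew {ι : Type*} {t : ι → ι → ι → ℝ} (h₁ : ∀ i j k, t i j k = t j i k)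
    (h₂ : ∀ i j k, t i j k = -t i k j) (i j k : ι) : t i j k = 0 := by
  linarith [h₁ i j k, h₂ j i k, h₁ j k i, h₂ k j i, h₁ k i j, h₂ i k j]

/-- The trace condition on the curvature forces the torsion to vanish. -/
lemma mulVec_vTilde_of_sum_lie_eq_zero {K : Fin 4 → Fin 4 → Mat33}
    (hK : ∀ i j, K i j ∈ conformal.alg) (hsw : ∀ i j, K i j = -K j i)
    (h0 : ∀ j, ∑ i, ⁅K i j, wedge vTilde (frameB i)⁆ = 0) (i j : Fin 4) :
    K i j *ᵥ vTilde = hForm vBar (K i j *ᵥ vTilde) • vTilde := by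
  have h1 : ∀ j k l, hForm (frameA l) (K k j *ᵥ vTilde) = hForm (frameA k) (K l j *ᵥ vTilde) := by
    intro j k l
    have h2 := congrArg (fun M : Mat33 => hForm (frameA l) (M *ᵥ frameA k)) (h0 j)
    simp only [lie_wedge (hK _ _), Matrix.sum_mulVec, Matrix.add_mulVec, wedge_mulVec,
      hForm_sum_right, hForm_add_right, hForm_sub_right, hForm_smul_right, Matrix.zero_mulVec,
      hForm_zero_right, hForm_vTilde_frameA, hForm_comm (frameA l) vTilde, mul_zero, sub_zero,
      add_zero, hForm_frameB_frameA, hForm_comm (frameA l) (frameB _), ite_mul, one_mul, zero_mul,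
      mul_ite, mul_one, Finset.sum_sub_distrib, Finset.sum_ite_eq', Finset.mem_univ, if_true] at h2
    rw [hForm_comm (frameA k)]
    linarith
  refine eq_smul_vTilde (skew_self (hK i j) _) fun l => ?_
  refine eq_zero_of_symm_of_skew (t := fun l i j => hForm (frameA l) (K i j *ᵥ vTilde))
    (fun a b c => h1 c b a) (fun a b c => ?_) l i j
  rw [hsw b c, Matrix.neg_mulVec, ← neg_one_smul ℝ, hForm_smul_right]
  ring

/-- The nilradical `𝔭̃₊`, in terms of the filtration `ℝ ṽ₊ ⊆ ṽ₊^⊥`. -/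
def nilradical : Submodule ℝ Mat33 where
  carrier := {X | X ∈ conformal.alg ∧ X *ᵥ vTilde = 0 ∧ ∀ i j, hForm (frameA i) (X *ᵥ frameA j) = 0}
  zero_mem' := ⟨conformal.alg.zero_mem, by simp, by simp [hForm_zero_right]⟩
  add_mem' := by
    rintro X Y ⟨h1, h2, h3⟩ ⟨k1, k2, k3⟩
    refine ⟨conformal.alg.add_mem h1 k1, by rw [Matrix.add_mulVec, h2, k2, add_zero], fun i j => ?_⟩
    rw [Matrix.add_mulVec, hForm_add_right, h3, k3, add_zero]
  smul_mem' := by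
    rintro c X ⟨h1, h2, h3⟩
    refine ⟨conformal.alg.smul_mem c h1, by rw [Matrix.smul_mulVec, h2, smul_zero], fun i j => ?_⟩
    rw [Matrix.smul_mulVec, hForm_smul_right, h3, mul_zero]

lemma exists_eq_wedge_of_mem_nilradical {X : Mat33} (hX : X ∈ nilradical) :
    ∃ d, hForm vTilde d = 0 ∧ X = wedge vTilde d := by
  obtain ⟨h1, h2, h3⟩ := hX
  have h4 : ∀ i, X *ᵥ frameA i = hForm vBar (X *ᵥ frameA i) • vTilde := by
    intro i
    refine eq_smul_vTilde ?_ fun j => h3 j i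
    have := mem_conformal_iff.1 h1 vTilde (frameA i)
    rw [h2, hForm_zero_left] at this
    linarith
  refine ⟨(1 / 2 : ℝ) • (∑ i, hForm vBar (X *ᵥ frameA i) • frameB i - X *ᵥ vBar), ?_, ?_⟩
  · have := mem_conformal_iff.1 h1 vTilde vBar
    rw [h2, hForm_zero_left] at this
    simp only [hForm_smul_right, hForm_sub_right, hForm_sum_right, hForm_vTilde_frameB, mul_zero,
      Finset.sum_const_zero]
    linarith
  · conv_lhs => rw [so_decomp h1, h2, wedge_swap 0, wedge_zero_right, wedge_swap (X *ᵥ vBar)]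
    rw [wedge_smul_right, wedge_sub_right, wedge_sum_right]
    congr 1
    have h5 : ∀ i, wedge (X *ᵥ frameA i) (frameB i) =
        wedge vTilde (hForm vBar (X *ᵥ frameA i) • frameB i) := by
      intro i
      rw [wedge_smul_right, ← wedge_smul_left, ← h4]
    simp only [h5]
    abel

lemma lie_wedge_vTilde {d b : Vec33} (hd : hForm vTilde d = 0) (hb : hForm vTilde b = 0) :
    ⁅wedge vTilde d, wedge vTilde b⁆ = 0 := by
  rw [lie_wedge (wedge_mem _ _), wedge_mulVec, wedge_mulVec, hForm_comm d, hd, hb,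
    hForm_vTilde_self, zero_smul, zero_smul, sub_zero, sub_zero, wedge_smul_right,
    wedge_self, smul_zero, wedge_swap, wedge_zero_right, neg_zero, add_zero]

lemma frameB_eq : frameB 0 = frameA 1 ∧ frameB 1 = frameA 0 ∧
    frameB 2 = (-1 / 2 : ℝ) • frameA 3 ∧ frameB 3 = (-1 / 2 : ℝ) • frameA 2 := by
  refine ⟨?_, ?_, ?_, ?_⟩ <;> ext (i | i) <;> fin_cases i <;> simp [frameA, frameB] <;> norm_num

/-- The Kostant Laplacian is injective on the `𝔭̃₊`-valued one-cochains. -/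
lemma wedge_eq_zero_of_sum_lie_eq_zero {A : Fin 4 → Mat33} (hA : ∀ i, A i ∈ conformal.alg)
    (hAl : ∀ i, A i *ᵥ vTilde = frameA i) {d : Fin 4 → Vec33} (hd : ∀ i, hForm vTilde (d i) = 0)
    (h0 : ∀ j, ∑ i, ⁅⁅A i, wedge vTilde (d j)⁆ - ⁅A j, wedge vTilde (d i)⁆,
      wedge vTilde (frameB i)⁆ = 0) (j : Fin 4) : wedge vTilde (d j) = 0 := by
  have hd' : ∀ i, hForm (d i) vTilde = 0 := fun i => by rw [hForm_comm, hd]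
  have hAd : ∀ i j, hForm (A i *ᵥ d j) vTilde = -hForm (frameA i) (d j) := by
    intro i j
    rw [mem_conformal_iff.1 (hA i), hAl, hForm_comm]
  have hal : ∀ i, hForm (frameA i) vTilde = 0 := fun i => by rw [hForm_comm, hForm_vTilde_frameA]
  set R : Fin 4 → Fin 4 → ℝ := fun i j => hForm (frameA i) (d j) with hR
  have h1 : ∀ i j, ⁅⁅A i, wedge vTilde (d j)⁆ - ⁅A j, wedge vTilde (d i)⁆,
      wedge vTilde (frameB i)⁆ = wedge vTilde ((R j i - R i j) • frameB i +
        (hForm (frameB i) (d j) • frameA i - d j - hForm (frameB i) (d i) • frameA j +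
          (if i = j then (1 : ℝ) else 0) • d i)) := by
    intro i j
    have hY : ⁅A i, wedge vTilde (d j)⁆ - ⁅A j, wedge vTilde (d i)⁆ ∈ conformal.alg :=
      conformal.alg.sub_mem (conformal.alg.lie_mem (hA i) (wedge_mem _ _))
        (conformal.alg.lie_mem (hA j) (wedge_mem _ _))
    have e : ∀ i j v, ⁅A i, wedge vTilde (d j)⁆ *ᵥ v = (hForm (d j) v • frameA i -
        hForm (frameA i) v • d j) +
        (hForm (A i *ᵥ d j) v • vTilde - hForm vTilde v • (A i *ᵥ d j)) := by
      intro i j v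
      rw [lie_wedge (hA i), hAl, Matrix.add_mulVec, wedge_mulVec, wedge_mulVec]
    have hYl : (⁅A i, wedge vTilde (d j)⁆ - ⁅A j, wedge vTilde (d i)⁆) *ᵥ vTilde =
        (R j i - R i j) • vTilde := by
      rw [Matrix.sub_mulVec, e, e, hd', hd', hal, hal, hAd, hAd, hForm_vTilde_self]
      module
    have hYb : (⁅A i, wedge vTilde (d j)⁆ - ⁅A j, wedge vTilde (d i)⁆) *ᵥ frameB i =
        (hForm (A i *ᵥ d j) (frameB i) - hForm (A j *ᵥ d i) (frameB i)) • vTilde +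
        (hForm (frameB i) (d j) • frameA i - d j - hForm (frameB i) (d i) • frameA j +
          (if i = j then (1 : ℝ) else 0) • d i) := by
      rw [Matrix.sub_mulVec, e, e, hForm_vTilde_frameB, hForm_comm (frameA i),
        hForm_comm (frameA j), hForm_frameB_frameA, hForm_frameB_frameA, if_pos rfl,
        hForm_comm (d j), hForm_comm (d i)]
      module
    rw [lie_wedge hY, hYl, hYb, wedge_add_right vTilde (_ • vTilde), wedge_smul_right, wedge_self,
      smul_zero, zero_add, wedge_smul_left, ← wedge_smul_right, ← wedge_add_right]
  set y : Fin 4 → Vec33 := fun j => ∑ i, ((R j i - R i j) • frameB i +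
        (hForm (frameB i) (d j) • frameA i - d j - hForm (frameB i) (d i) • frameA j +
          (if i = j then (1 : ℝ) else 0) • d i)) with hy
  have hyw : ∀ j, wedge vTilde (y j) = 0 := by
    intro j
    rw [hy, wedge_sum_right, ← h0 j]
    exact Finset.sum_congr rfl fun i _ => (h1 i j).symm
  have hyl : ∀ j k, hForm (frameA k) (y j) = 0 := by
    intro j k
    have h2 := congrArg (fun M => M *ᵥ vBar) (hyw j)
    simp only [wedge_mulVec, Matrix.zero_mulVec, hForm_vTilde_vBar, one_smul] at h2
    rw [← sub_eq_zero.1 h2, hForm_smul_right, hal, mul_zero]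
  set tr := ∑ i, hForm (frameB i) (d i) with htr
  -- the component of `y j` along `frameA k`, as `y j` is a multiple of `vTilde`
  have hRic : ∀ j k, R j k = 3 * R k j + tr * hForm (frameA k) (frameA j) := by
    intro j k
    have h2 := hyl j k
    have h3 : ∑ i, hForm (frameB i) (d j) * hForm (frameA k) (frameA i) = R k j := by
      have := congrArg (hForm (frameA k)) (vec_decomp_frameA (d j))
      rw [hForm_add_right, hForm_add_right, hForm_smul_right, hForm_smul_right, hal, hd,
        hForm_sum_right] at this
      simp only [hForm_smul_right] at this
      change R k j = _ at this
      linarith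
    have h4 : ∀ i, hForm (frameA k) (d i) = R k i := fun _ => rfl
    have h5 : ∀ c : ℝ, ∑ _i : Fin 4, c = 4 * c := fun c => by simp
    simp only [hy, hForm_sum_right, hForm_add_right, hForm_sub_right, hForm_smul_right, h4,
      hForm_comm (frameA k) (frameB _), hForm_frameB_frameA, Finset.sum_add_distrib,
      Finset.sum_sub_distrib, mul_ite, mul_one, mul_zero, ite_mul, one_mul, zero_mul, h3,
      Finset.sum_ite_eq', Finset.mem_univ, if_true, h5, ← Finset.sum_mul, ← htr] at h2
    linarith
  -- exchanging `j` and `k` shows that `R` is a multiple of the metric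
  have hR2 : ∀ j k, R j k = -(1 / 2) * (tr * hForm (frameA k) (frameA j)) := by
    intro j k
    have e1 := hRic j k
    have e2 := hRic k j
    rw [hForm_comm (frameA j)] at e2
    linarith
  -- in dimension `4` the trace of this equation is `tr = -2 tr`
  have htr0 : tr = 0 := by
    obtain ⟨b0, b1, b2, b3⟩ := frameB_eq
    have e1 : tr = R 1 0 + R 0 1 + (-1 / 2) * R 3 2 + (-1 / 2) * R 2 3 := by
      rw [htr, Fin.sum_univ_four, b0, b1, b2, b3, hForm_smul_left, hForm_smul_left]
    have g1 : hForm (frameA 1) (frameA 0) = 1 := by simp [hForm_def, frameA]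
    have g2 : hForm (frameA 3) (frameA 2) = -2 := by simp [hForm_def, frameA]; norm_num
    rw [hR2 1 0, hR2 0 1, hR2 3 2, hR2 2 3, hForm_comm (frameA 0), hForm_comm (frameA 2), g1,
      g2] at e1
    linarith
  have hd0 : d j = hForm vBar (d j) • vTilde := by
    refine eq_smul_vTilde (hd j) fun i => ?_
    have := hR2 i j
    rw [htr0] at this
    rw [show hForm (frameA i) (d j) = R i j from rfl, this]
    ring
  rw [hd0, wedge_smul_right, wedge_self, smul_zero]

end TensorAlgebra

section Uniqueness

variable {X M : Type*} [TopologicalSpace X] [ChartedSpace (Euc 15) X] [IsManifold (𝓡 15) ∞ X]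
  [TopologicalSpace M] [ChartedSpace (Euc 4) M]
  {act : X → conformal.parabolic → X} {π : X → M} {θ θ' : OneForm X 15 conformal.alg}

/-- The curvature only depends on the classes of its arguments modulo `𝔭̃`. -/
lemma IsCartanConnection.curv_congr
    (hP : IsPrincipalBundle (d := 15) (m := 4) conformal.parabolic act π)
    (hθ : IsCartanConnection conformal act θ) (u : X) {A B A' B' : conformal.alg}
    (hA : conformalQuot A = conformalQuot A') (hB : conformalQuot B = conformalQuot B') :
    hθ.curv u A B = hθ.curv u A' B' := by
  have h1 : ∀ {A A'}, conformalQuot A = conformalQuot A' → ∀ B,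
      hθ.curv u A B = hθ.curv u A' B := by
    intro A A' h B
    have := hθ.curv_of_mem_conformal hP u (A := A - A')
      (mem_parabolicAlg_conformal.2 (by rw [map_sub, h, sub_self])) B
    rwa [map_sub, LinearMap.sub_apply, sub_eq_zero] at this
  rw [h1 hA, hθ.curv_swap, h1 hB, ← hθ.curv_swap]

/-- A frame of the horizontal vectors. -/
def IsCartanConnection.frame (hθ : IsCartanConnection conformal act θ) (u : X) (i : Fin 4) :
    Euc 15 := (hθ.equiv u).symm (stdA i)

/-- Normality, in the frame of another Cartan connection with the same soldering form. -/
lemma IsCartanConnection.sum_lie_curvMat_eq_zero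
    (hP : IsPrincipalBundle (d := 15) (m := 4) conformal.parabolic act π)
    (hθ : IsCartanConnection conformal act θ) (hθ' : IsCartanConnection conformal act θ')
    (hn : IsNormal conformal θ') (h : ∀ x v, (θ'.mat x v - θ.mat x v) *ᵥ vTilde = 0)
    (u : X) (j : Fin 4) :
    ∑ i, ⁅curvMat θ'.mat u (hθ.frame u i) (hθ.frame u j), wedge vTilde (frameB i)⁆ = 0 := by
  have h0 := hθ'.sum_lie_curv_eq_zero hP hn u (stdA j)
  have hZ : ∀ i, (stdZ i : Mat33) = (1 / 8 : ℝ) • wedge vTilde (frameB i) := fun i => rfl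
  have hq : ∀ i, conformalQuot (hθ'.equiv u (hθ.frame u i)) = conformalQuot (stdA i) := by
    intro i
    funext k
    rw [conformalQuot_apply, conformalQuot_apply, hθ'.coe_equiv]
    have := h u (hθ.frame u i)
    rw [Matrix.sub_mulVec, sub_eq_zero] at this
    rw [this, IsCartanConnection.frame, hθ.mat_symm]
  have hc : ∀ i, curvMat θ'.mat u (hθ.frame u i) (hθ.frame u j) =
      hθ'.curv u (stdA i) (stdA j) := by
    intro i
    rw [← hθ'.curv_congr hP u (hq i) (hq j), hθ'.curv_apply]
    congr 1
    · exact ((hθ'.equiv u).symm_apply_apply _).symm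
    · exact ((hθ'.equiv u).symm_apply_apply _).symm
  simp only [hZ, lie_smul, ← Finset.smul_sum] at h0
  simp only [hc]
  exact (smul_eq_zero.1 h0).resolve_left (by norm_num)

/-- **Uniqueness of the normal conformal Cartan connection**: two normal connections on the same
bundle with the same soldering form coincide. -/
lemma IsCartanConnection.eq_of_isNormal
    (hP : IsPrincipalBundle (d := 15) (m := 4) conformal.parabolic act π)
    (hθ : IsCartanConnection conformal act θ) (hθ' : IsCartanConnection conformal act θ')
    (hn : IsNormal conformal θ) (hn' : IsNormal conformal θ')
    (h : ∀ x v, (θ'.mat x v - θ.mat x v) *ᵥ vTilde = 0) (x : X) (v : Euc 15) :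
    θ'.mat x v = θ.mat x v := by
  set D : X → Euc 15 →ₗ[ℝ] Mat33 := fun x => θ'.mat x - θ.mat x with hD
  have hDv : ∀ x v, D x v = θ'.mat x v - θ.mat x v := fun _ _ => rfl
  have hDm : ∀ x v, D x v ∈ conformal.alg := fun x v =>
    conformal.alg.sub_mem (θ' x v).2 (θ x v).2
  have hDl : ∀ x v, D x v *ᵥ vTilde = 0 := h
  have hsD : SmoothMatForm D := fun i j => (hθ'.smooth i j).sub (hθ.smooth i j)
  have hver : ∀ x (v : Euc 15), hθ.equiv x v ∈ conformal.parabolicAlg → D x v = 0 := by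
    intro x v hv
    rw [hDv, hθ.eq_on_vertical hP hθ' ((hθ.vertical_iff hP conformalQuot_surjective
      (fun _ => mem_parabolicAlg_conformal)).2 hv), sub_self]
  have hf : ∀ u i, θ.mat u (hθ.frame u i) = (stdA i : Mat33) := fun u i => hθ.mat_symm u _
  -- `D` is determined by its values on the frame
  have hframe : ∀ x (S : Submodule ℝ Mat33), (∀ i, D x (hθ.frame x i) ∈ S) → ∀ v, D x v ∈ S := by
    intro x S hS v
    have h1 := hver x (v - ∑ i, conformalQuot (hθ.equiv x v) i • hθ.frame x i) (by
      have h2 := sub_sum_mem_parabolicAlg stdA_vTilde (hθ.equiv x v)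
      rw [map_sub, map_sum]
      simp only [map_smul, IsCartanConnection.frame, LinearEquiv.apply_symm_apply]
      exact h2)
    rw [map_sub, sub_eq_zero] at h1
    rw [h1, map_sum]
    exact S.sum_mem fun i _ => by rw [map_smul]; exact S.smul_mem _ (hS i)
  have hK : ∀ u v w, curvMat θ'.mat u v w - curvMat θ.mat u v w = dMat D u v w +
      (⁅θ.mat u v, D u w⁆ - ⁅θ.mat u w, D u v⁆ + ⁅D u v, D u w⁆) := by
    intro u v w
    rw [curvMat, curvMat, dMat_sub hθ'.smoothMatForm hθ.smoothMatForm, hDv, hDv]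
    simp only [Ring.lie_def]
    noncomm_ring
  have hsum := hθ.sum_lie_curvMat_eq_zero hP hθ hn (by simp)
  have hsum' := hθ.sum_lie_curvMat_eq_zero hP hθ' hn' h
  have hnil : ∀ x v, D x v ∈ nilradical := by
    intro x
    refine hframe x _ fun k => ⟨hDm _ _, hDl _ _, fun i j => ?_⟩
    have ht := mulVec_vTilde_of_sum_lie_eq_zero (fun i j => hθ.curvMat_mem x _ _)
      (fun i j => curvMat_swap _ _ _ _) (hsum x)
    have ht' := mulVec_vTilde_of_sum_lie_eq_zero (fun i j => hθ'.curvMat_mem x _ _)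
      (fun i j => curvMat_swap _ _ _ _) (hsum' x)
    have hal : ∀ i, hForm (frameA i) vTilde = 0 := fun i => by
      rw [hForm_comm, hForm_vTilde_frameA]
    have hsym : ∀ i j k, hForm (frameA i) (D x (hθ.frame x k) *ᵥ frameA j) =
        hForm (frameA i) (D x (hθ.frame x j) *ᵥ frameA k) := by
      intro i j k
      have e := congrArg (fun M : Mat33 => hForm (frameA i) (M *ᵥ vTilde))
        (hK x (hθ.frame x k) (hθ.frame x j))
      have hd : dMat D x (hθ.frame x k) (hθ.frame x j) *ᵥ vTilde = 0 :=
        dMat_mem hsD (S := LinearMap.ker ((Matrix.mulVecBilin ℝ ℝ).flip vTilde))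
          (fun x v => hDl x v) x _ _
      simp only [Matrix.sub_mulVec, Matrix.add_mulVec, hd, Ring.lie_def, hf,
        ← Matrix.mulVec_mulVec, hDl, Matrix.mulVec_zero, stdA_vTilde] at e
      rw [ht, ht'] at e
      simp only [hForm_sub_right, hForm_add_right, hForm_smul_right, hal, hForm_zero_right] at e
      linarith
    refine eq_zero_of_symm_of_skew
      (t := fun k j i => hForm (frameA i) (D x (hθ.frame x k) *ᵥ frameA j))
      (fun k j i => hsym i j k) (fun k j i => ?_) k j i
    rw [hForm_comm, mem_conformal_iff.1 (hDm _ _)]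
  choose d hd hdw using fun i => exists_eq_wedge_of_mem_nilradical (hnil x (hθ.frame x i))
  have hz : ∀ i, wedge vTilde (d i) = 0 := by
    refine wedge_eq_zero_of_sum_lie_eq_zero (fun i => (stdA i).2) stdA_vTilde hd fun j => ?_
    have e : ∀ i, ⁅⁅(stdA i : Mat33), wedge vTilde (d j)⁆ - ⁅(stdA j : Mat33), wedge vTilde (d i)⁆,
        wedge vTilde (frameB i)⁆ = ⁅curvMat θ'.mat x (hθ.frame x i) (hθ.frame x j),
          wedge vTilde (frameB i)⁆ - ⁅curvMat θ.mat x (hθ.frame x i) (hθ.frame x j),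
          wedge vTilde (frameB i)⁆ := by
      intro i
      obtain ⟨b, hb, hbw⟩ := exists_eq_wedge_of_mem_nilradical
        (dMat_mem hsD hnil x (hθ.frame x i) (hθ.frame x j))
      rw [← sub_lie, hK, hbw, hf, hf, hdw i, hdw j, lie_wedge_vTilde (hd i) (hd j), add_zero,
        add_lie, lie_wedge_vTilde hb (hForm_vTilde_frameB i), zero_add]
    simp only [e, Finset.sum_sub_distrib, hsum, hsum', sub_self]
  have := hframe x ⊥ (fun i => by rw [hdw, hz]; exact Submodule.zero_mem _) v
  rw [Submodule.mem_bot, hDv, sub_eq_zero] at this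
  exact this

end Uniqueness

/-! ### The subgroup `1 + ṽ₊ w` of `P̃`, and frames of horizontal vectors -/

section Shears

/-- The element `1 + ṽ₊ w` of `P̃`, for `w ∈ ṽ₊^⊥`. It is the exponential of `ṽ₊ ∧ w`. -/
def shearP (w : Vec33) (hw : hForm vTilde w = 0) : conformal.parabolic :=
  ⟨⟨shear vTilde w, shear_vTilde_mem hw⟩, Subgroup.mem_top _, 1, one_pos, by
    change rho _ *ᵥ vTilde = (1 : ℝ) • vTilde
    rw [rho_of_shear rfl Q33_vTilde hw, wedge_mulVec, hForm_comm w, hw, hForm_vTilde_self]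
    simp⟩

lemma coe_shearP {w : Vec33} (hw : hForm vTilde w = 0) :
    ((shearP w hw : Spin33) : Cl33) = shear vTilde w := rfl

lemma rho_shearP_mulVec {w : Vec33} (hw : hForm vTilde w = 0) {v : Vec33}
    (hv : hForm vTilde v = 0) :
    rho (shearP w hw : Spin33) *ᵥ v = v + hForm w v • vTilde := by
  rw [rho_of_shear (coe_shearP hw) Q33_vTilde hw, wedge_mulVec, hv]
  simp

lemma rho_shearP_mulVec_vTilde {w : Vec33} (hw : hForm vTilde w = 0) :
    rho (shearP w hw : Spin33) *ᵥ vTilde = vTilde := by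
  rw [rho_shearP_mulVec hw hForm_vTilde_self, hForm_comm, hw, zero_smul, add_zero]

/-- Conjugation by elements of `P̃` on the shears. -/
lemma shearP_mul {w w' : Vec33} (hw : hForm vTilde w = 0) (hw' : hForm vTilde w' = 0)
    {p : conformal.parabolic} {c : ℝ} (hc : rho (p : Spin33)⁻¹ *ᵥ vTilde = c • vTilde)
    (h : ∀ i, hForm (frameA i) w' = c * hForm (frameA i) (rho (p : Spin33)⁻¹ *ᵥ w)) :
    shearP w hw * p = p * shearP w' hw' := by
  have hy0 : hForm vTilde (rho (p : Spin33)⁻¹ *ᵥ w) * c = 0 := by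
    have h1 := hForm_rho (p : Spin33)⁻¹ vTilde w
    rw [hc, hForm_smul_left, hw] at h1
    linarith
  have hy := eq_smul_vTilde (v := w' - c • (rho (p : Spin33)⁻¹ *ᵥ w))
    (by rw [hForm_sub_right, hForm_smul_right, hw']; linarith)
    (fun i => by rw [hForm_sub_right, hForm_smul_right, h, sub_self])
  set k := hForm vBar (w' - c • (rho (p : Spin33)⁻¹ *ᵥ w))
  apply Subtype.ext
  apply Subtype.ext
  have hpp : ((p : Spin33) : Cl33) * (((p : Spin33)⁻¹ : Spin33) : Cl33) = 1 :=
    congrArg Subtype.val (mul_inv_cancel (p : Spin33))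
  -- `p ι(ρ(p⁻¹) v) = ι(v) p`
  have hι : ∀ v : Vec33, ((p : Spin33) : Cl33) *
      CliffordAlgebra.ι Q33 (rho (p : Spin33)⁻¹ *ᵥ v) =
      CliffordAlgebra.ι Q33 v * ((p : Spin33) : Cl33) := by
    intro v
    rw [rho_mulVec, ι_vectorAct, inv_inv, ← mul_assoc, ← mul_assoc, hpp, one_mul]
  change shear vTilde w * ((p : Spin33) : Cl33) = ((p : Spin33) : Cl33) * shear vTilde w'
  have hw2 : w' = c • (rho (p : Spin33)⁻¹ *ᵥ w) + k • vTilde := by rw [← hy]; abel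
  have h1 : CliffordAlgebra.ι Q33 vTilde * CliffordAlgebra.ι Q33 w' =
      CliffordAlgebra.ι Q33 (rho (p : Spin33)⁻¹ *ᵥ vTilde) *
        CliffordAlgebra.ι Q33 (rho (p : Spin33)⁻¹ *ᵥ w) := by
    rw [hw2, hc, map_add, map_smul, map_smul, map_smul, mul_add, mul_smul_comm, mul_smul_comm,
      ι_mul_self, Q33_vTilde, map_zero, smul_zero, add_zero, smul_mul_assoc]
  rw [shear, shear, h1, add_mul, mul_add, ← mul_assoc ((p : Spin33) : Cl33), hι, mul_assoc,
    mul_assoc (CliffordAlgebra.ι Q33 vTilde) _ (CliffordAlgebra.ι Q33 _), hι, one_mul, mul_one]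

end Shears

section Frame

variable {X M : Type*} [TopologicalSpace X] [ChartedSpace (Euc 15) X] [IsManifold (𝓡 15) ∞ X]
  [TopologicalSpace M] [ChartedSpace (Euc 4) M]
  {act : X → conformal.parabolic → X} {π : X → M} {θ θ' : OneForm X 15 conformal.alg}

/-- The vector fields that a Cartan connection maps to constants are smooth: so are the values of
other smooth one-forms on them. -/
lemma IsCartanConnection.contMDiff_apply_frame (hθ : IsCartanConnection conformal act θ)
    {α : X → Euc 15 →ₗ[ℝ] ℝ} (hα : SmoothForm α) (i : Fin 4) :
    ContMDiff (𝓡 15) 𝓘(ℝ, ℝ) ∞ (fun x => α x (hθ.frame x i)) := by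
  intro x₀
  set φ := extChartAt (𝓡 15) x₀ with hφ
  -- in the chart at `x₀`, the connection as a family of endomorphisms that is `1` at `x₀`
  obtain ⟨g, hg⟩ := LinearMap.exists_extend (p := conformal.alg.toSubmodule)
    (hθ.equiv x₀).symm.toLinearMap
  have hg' : ∀ A : conformal.alg, g (A : Mat33) = (hθ.equiv x₀).symm A := fun A =>
    LinearMap.congr_fun hg A
  let T : Euc 15 → Euc 15 →L[ℝ] Euc 15 := fun y => LinearMap.toContinuousLinearMap
    (g ∘ₗ θ.mat (φ.symm y) ∘ₗ (mD (Euc 15) (Euc 15) φ.symm y : Euc 15 →ₗ[ℝ] Euc 15))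
  have hTv : ∀ y z, T y z = g (θ.mat (φ.symm y) (mD (Euc 15) (Euc 15) φ.symm y z)) :=
    fun _ _ => rfl
  have hmem : φ.target ∈ nhds (φ x₀) := (isOpen_extChartAt_target x₀).mem_nhds
    (mem_extChartAt_target x₀)
  have hpair : ∀ {β : X → Euc 15 →ₗ[ℝ] ℝ}, SmoothForm β → ∀ {z : Euc 15 → Euc 15},
      ContDiffAt ℝ ∞ z (φ x₀) →
      ContDiffAt ℝ ∞ (fun y => coordForm β x₀ y (z y)) (φ x₀) := by
    intro β hβ z hz
    have h1 := (hβ.contDiffOn_coordForm x₀).contDiffAt (IsOpen.mem_nhds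
      ((isOpen_extChartAt_target x₀).prod isOpen_univ) (x := (φ x₀, z (φ x₀)))
      ⟨mem_extChartAt_target x₀, Set.mem_univ _⟩)
    exact h1.comp (φ x₀) (f := fun y => (y, z y)) (contDiffAt_id.prodMk hz)
  have hT : ContDiffAt ℝ ∞ T (φ x₀) := by
    refine ContDiffOn.contDiffAt (contDiffOn_clm_apply.2 fun z => ?_) hmem
    have h1 : ∀ y, T y z = ∑ k, ∑ l,
        coordForm (functionalForm (entry k l) θ.mat) x₀ y z • g (Matrix.single k l 1) := by
      intro y
      rw [hTv]
      conv_lhs => rw [Matrix.matrix_eq_sum_single (θ.mat (φ.symm y) _)]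
      simp only [map_sum]
      refine Finset.sum_congr rfl fun k _ => Finset.sum_congr rfl fun l _ => ?_
      rw [← map_smul, Matrix.smul_single, smul_eq_mul, mul_one]
      rfl
    simp only [h1]
    exact ContDiffOn.sum fun k _ => ContDiffOn.sum fun l _ =>
      (((hθ.smoothMatForm k l).contDiffOn_coordForm x₀).comp (f := fun y => (y, z))
        (contDiffOn_id.prodMk contDiffOn_const) fun y hy => ⟨hy, Set.mem_univ _⟩).smul
        contDiffOn_const
  have hT0 : T (φ x₀) = ContinuousLinearEquiv.refl ℝ (Euc 15) := by
    ext1 z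
    rw [hTv, hφ, extChartAt_to_inv, mD_chart_symm]
    exact (hg' (hθ.equiv x₀ z)).trans ((hθ.equiv x₀).symm_apply_apply z)
  have hinv : ContDiffAt ℝ ∞ (fun y => (T y).inverse) (φ x₀) := by
    refine ContDiffAt.comp (φ x₀) (g := ContinuousLinearMap.inverse) ?_ hT
    rw [hT0]
    exact contDiffAt_map_inverse _
  have hev : ∀ᶠ y in nhds (φ x₀), (T y).IsInvertible := by
    have h1 : Set.range ((↑) : (Euc 15 ≃L[ℝ] Euc 15) → Euc 15 →L[ℝ] Euc 15) ∈ nhds (T (φ x₀)) := by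
      rw [hT0]
      exact ContinuousLinearEquiv.nhds _
    exact hT.continuousAt h1
  let z : Euc 15 → Euc 15 := fun y => (T y).inverse ((hθ.equiv x₀).symm (stdA i))
  have hz : ContDiffAt ℝ ∞ z (φ x₀) := hinv.clm_apply contDiffAt_const
  have hF := hpair hα hz
  have hx : ∀ᶠ x in nhds x₀, α x (hθ.frame x i) = coordForm α x₀ (φ x) (z (φ x)) := by
    filter_upwards [(continuousAt_extChartAt (I := 𝓡 15) x₀).eventually hev,
      extChartAt_source_mem_nhds (I := 𝓡 15) x₀] with x h1 h2
    have h3 : φ.symm (φ x) = x := φ.left_inv h2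
    have h4 : T (φ x) (z (φ x)) = (hθ.equiv x₀).symm (stdA i) := h1.self_apply_inverse _
    rw [hTv, h3] at h4
    have h5 : hθ.frame x i = mD (Euc 15) (Euc 15) φ.symm (φ x) (z (φ x)) := by
      refine hθ.symm_eq ?_
      have h6 := (hg' (hθ.equiv x (mD (Euc 15) (Euc 15) φ.symm (φ x) (z (φ x))))).symm.trans h4
      exact congrArg Subtype.val ((hθ.equiv x₀).symm.injective h6)
    rw [h5]
    change _ = α (φ.symm (φ x)) _
    rw [h3]
    rfl
  have hcomp : ContMDiffAt (𝓡 15) 𝓘(ℝ, ℝ) ∞ (fun x => coordForm α x₀ (φ x) (z (φ x))) x₀ :=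
    hF.contMDiffAt.comp x₀ (g := fun y => coordForm α x₀ y (z y)) (f := φ) contMDiffAt_extChartAt
  exact hcomp.congr_of_eventuallyEq hx

end Frame

/-! ### Tractor connections under gauge transformations -/

section Pullback

variable {X : Type*} [TopologicalSpace X] [ChartedSpace (Euc 15) X]
  {θ θ' : OneForm X 15 conformal.alg}

/-- The pullback of a one-form. -/
def OneForm.pullback (θ' : OneForm X 15 conformal.alg) (Φ : X → X) : OneForm X 15 conformal.alg :=
  fun x => θ' (Φ x) ∘ₗ (mD (Euc 15) (Euc 15) Φ x : Euc 15 →ₗ[ℝ] Euc 15)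

lemma OneForm.pullback_mat (θ' : OneForm X 15 conformal.alg) (Φ : X → X) (x : X) (v : Euc 15) :
    (θ'.pullback Φ).mat x v = θ'.mat (Φ x) (mD (Euc 15) (Euc 15) Φ x v) := rfl

/-- A gauge transformation that relates two Cartan connections relates their tractor
connections. -/
lemma tractorConnection_gauge {V : Type*} [NormedAddCommGroup V] [NormedSpace ℝ V]
    {τ : SmoothRep V} {s : X → V} (hs : ContMDiff (𝓡 15) 𝓘(ℝ, V) ∞ s) {Φ : X → X}
    (hΦ : ContMDiff (𝓡 15) (𝓡 15) ∞ Φ)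
    (h : ∀ x v, θ' (Φ x) (mfderiv (𝓡 15) (𝓡 15) Φ x v) = θ x v) (x : X)
    (v : TangentSpace (𝓡 15) x) :
    tractorConnection τ θ' s (Φ x) (mfderiv (𝓡 15) (𝓡 15) Φ x v) =
      tractorConnection τ θ (s ∘ Φ) x v := by
  simp only [tractorConnection]
  rw [h, mfderiv_comp x (hs.mdifferentiableAt (by simp)) (hΦ.mdifferentiableAt (by simp))]
  rfl

end Pullback

/-! ### Gauge equivalence of normal conformal Cartan connections -/

section Gauge

variable {X M : Type*} [TopologicalSpace X] [ChartedSpace (Euc 15) X] [IsManifold (𝓡 15) ∞ X]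
  [TopologicalSpace M] [ChartedSpace (Euc 4) M]
  {act : X → conformal.parabolic → X} {π : X → M} {θ θ' : OneForm X 15 conformal.alg}

/-- The vector `w` of `ṽ₊^⊥` with `(θ' - θ)(v) ṽ₊ = h(w, θ(v) ṽ₊) ṽ₊` for all `v`. It is unique up
to multiples of `ṽ₊`; here it is chosen in the span of `frameB`. -/
def IsCartanConnection.gaugeVec (hθ : IsCartanConnection conformal act θ)
    (θ' : OneForm X 15 conformal.alg) (x : X) : Vec33 :=
  ∑ i, hForm vBar (θ'.mat x (hθ.frame x i) *ᵥ vTilde) • frameB i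

lemma IsCartanConnection.hForm_gaugeVec (hθ : IsCartanConnection conformal act θ)
    (θ' : OneForm X 15 conformal.alg) (x : X) : hForm vTilde (hθ.gaugeVec θ' x) = 0 := by
  simp only [gaugeVec, hForm_sum_right, hForm_smul_right, hForm_vTilde_frameB, mul_zero,
    Finset.sum_const_zero]

/-- The soldering forms differ by a multiple of `ṽ₊`, given by `gaugeVec`. -/
lemma IsCartanConnection.mulVec_eq_add_gaugeVec
    (hP : IsPrincipalBundle (d := 15) (m := 4) conformal.parabolic act π)
    (hθ : IsCartanConnection conformal act θ) (hθ' : IsCartanConnection conformal act θ')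
    (h : ∀ x v, θ' x v - θ x v ∈ conformal.parabolicAlg) (x : X) (v : Euc 15) :
    θ'.mat x v *ᵥ vTilde = θ.mat x v *ᵥ vTilde +
      hForm (hθ.gaugeVec θ' x) (θ.mat x v *ᵥ vTilde) • vTilde := by
  have hf : ∀ i, θ.mat x (hθ.frame x i) = (stdA i : Mat33) := fun i => hθ.mat_symm x _
  have hfr : ∀ i, θ'.mat x (hθ.frame x i) *ᵥ vTilde = frameA i +
      hForm vBar (θ'.mat x (hθ.frame x i) *ᵥ vTilde) • vTilde := by
    intro i
    obtain ⟨c, hc⟩ := h x (hθ.frame x i)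
    change (θ'.mat x (hθ.frame x i) - θ.mat x (hθ.frame x i)) *ᵥ vTilde = c • vTilde at hc
    rw [Matrix.sub_mulVec, hf, stdA_vTilde, sub_eq_iff_eq_add'] at hc
    rw [hc, hForm_add_right, hForm_smul_right, hForm_vBar_frameA, hForm_comm vBar,
      hForm_vTilde_vBar, mul_one, zero_add]
  have h2 := sub_sum_mem_parabolicAlg stdA_vTilde (hθ.equiv x v)
  set q := conformalQuot (hθ.equiv x v) with hq
  have hvert : θ'.mat x (v - ∑ i, q i • hθ.frame x i) = θ.mat x (v - ∑ i, q i • hθ.frame x i) := by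
    refine hθ'.eq_on_vertical hP hθ ((hθ.vertical_iff hP conformalQuot_surjective
      (fun _ => mem_parabolicAlg_conformal)).2 ?_)
    rw [map_sub, map_sum]
    simp only [map_smul, IsCartanConnection.frame, LinearEquiv.apply_symm_apply]
    exact h2
  have hqi : ∀ i, hForm (frameB i) (θ.mat x v *ᵥ vTilde) = q i := fun i => rfl
  have h3 := congrArg (fun Y : Mat33 => Y *ᵥ vTilde) hvert
  simp only [map_sub, map_sum, map_smul, Matrix.sub_mulVec, Matrix.sum_mulVec, Matrix.smul_mulVec,
    hf, stdA_vTilde] at h3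
  rw [sub_eq_iff_eq_add] at h3
  rw [h3, gaugeVec, hForm_sum_left, Finset.sum_smul, sub_add, sub_eq_add_neg]
  congr 1
  rw [← Finset.sum_sub_distrib, ← Finset.sum_neg_distrib]
  refine Finset.sum_congr rfl fun i _ => ?_
  rw [hForm_smul_left, hqi]
  conv_lhs => rw [hfr i]
  module

/-- The `P̃`-valued function whose action normalises the soldering form of `θ'`. -/
def IsCartanConnection.gaugeFun (hθ : IsCartanConnection conformal act θ)
    (θ' : OneForm X 15 conformal.alg) (x : X) : conformal.parabolic :=
  shearP (hθ.gaugeVec θ' x) (hθ.hForm_gaugeVec θ' x)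

lemma IsCartanConnection.smooth_gaugeFun (hθ : IsCartanConnection conformal act θ)
    (hθ' : IsCartanConnection conformal act θ') :
    SmoothIntoSpinOn (𝓡 15) (fun x => (hθ.gaugeFun θ' x : Spin33)) Set.univ := by
  intro φ
  rw [contMDiffOn_univ]
  have h1 : ∀ x, φ ((hθ.gaugeFun θ' x : Spin33) : Cl33) = φ 1 +
      ∑ i, (∑ k, flat vBar k * ∑ l, θ'.mat x (hθ.frame x i) k l * vTilde l) *
        φ (CliffordAlgebra.ι Q33 vTilde * CliffordAlgebra.ι Q33 (frameB i)) := by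
    intro x
    rw [gaugeFun, coe_shearP, shear, gaugeVec, map_add, map_sum, Finset.mul_sum, map_sum]
    congr 1
    refine Finset.sum_congr rfl fun i _ => ?_
    rw [map_smul, mul_smul_comm, map_smul, smul_eq_mul, ← flat_dotProduct]
    rfl
  simp only [h1]
  exact contMDiff_const.add (contMDiff_finsetSum fun i _ => ContMDiff.mul
    (contMDiff_finsetSum fun k _ => contMDiff_const.mul (contMDiff_finsetSum fun l _ =>
      (hθ.contMDiff_apply_frame (hθ'.smoothMatForm k l) i).mul contMDiff_const)) contMDiff_const)

lemma IsCartanConnection.gaugeFun_act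
    (hP : IsPrincipalBundle (d := 15) (m := 4) conformal.parabolic act π)
    (hθ : IsCartanConnection conformal act θ) (hθ' : IsCartanConnection conformal act θ')
    (h : ∀ x v, θ' x v - θ x v ∈ conformal.parabolicAlg) (x : X) (p : conformal.parabolic) :
    hθ.gaugeFun θ' x * p = p * hθ.gaugeFun θ' (act x p) := by
  obtain ⟨-, c, hc0, hc⟩ := p.2
  change rho (p : Spin33) *ᵥ vTilde = c • vTilde at hc
  have hci : rho (p : Spin33)⁻¹ *ᵥ vTilde = c⁻¹ • vTilde := by
    have h1 := rho_inv_mulVec_mulVec (p : Spin33) vTilde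
    rw [hc, Matrix.mulVec_smul] at h1
    rw [← h1, smul_smul, inv_mul_cancel₀ hc0.ne', one_smul, h1]
  refine shearP_mul _ _ hci fun i => ?_
  -- the vector that the translation by `p` maps to the `i`-th frame vector at `act x p`
  set v : Euc 15 := (hθ.equiv x).symm (adInv (p : Spin33)⁻¹ (stdA i)) with hv
  set v' : Euc 15 := mD (Euc 15) (Euc 15) (fun y => act y p) x v with hv'
  have h1 : θ.mat (act x p) v' = (stdA i : Mat33) := by
    have h2 := hθ.equivariant p x v
    change θ.mat (act x p) v' = rho (p : Spin33)⁻¹ * θ.mat x v * rho (p : Spin33) at h2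
    rw [h2, hv, hθ.mat_symm, ← coe_adInv, adInv_adInv_inv]
  have h3 : θ'.mat (act x p) v' = rho (p : Spin33)⁻¹ * θ'.mat x v * rho (p : Spin33) :=
    hθ'.equivariant p x v
  have h4 : θ.mat x v *ᵥ vTilde = c⁻¹ • (rho (p : Spin33) *ᵥ frameA i) := by
    rw [hv, hθ.mat_symm, coe_adInv, inv_inv, ← Matrix.mulVec_mulVec, ← Matrix.mulVec_mulVec, hci,
      Matrix.mulVec_smul, Matrix.mulVec_smul, stdA_vTilde]
  have h5 := hθ.mulVec_eq_add_gaugeVec hP hθ' h (act x p) v'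
  rw [h1, h3, stdA_vTilde, ← Matrix.mulVec_mulVec, ← Matrix.mulVec_mulVec, hc, Matrix.mulVec_smul,
    Matrix.mulVec_smul, hθ.mulVec_eq_add_gaugeVec hP hθ' h x v, h4, Matrix.mulVec_add,
    Matrix.mulVec_smul, Matrix.mulVec_smul, rho_inv_mulVec_mulVec, hci, smul_add, smul_smul,
    mul_inv_cancel₀ hc0.ne', one_smul, add_right_inj, smul_smul, smul_smul, hForm_smul_right] at h5
  have h6 := congrArg (hForm vBar) h5
  rw [hForm_smul_right, hForm_smul_right, hForm_comm vBar, hForm_vTilde_vBar, mul_one,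
    mul_one] at h6
  rw [hForm_comm, ← h6, hForm_comm (frameA i), hForm_rho_inv]
  field_simp

/-- The pullback of a Cartan connection along an invertible gauge transformation. -/
lemma IsCartanConnection.pullback
    (hP : IsPrincipalBundle (d := 15) (m := 4) conformal.parabolic act π)
    (hθ' : IsCartanConnection conformal act θ') {Φ Ψ : X → X} (hΦ : ContMDiff (𝓡 15) (𝓡 15) ∞ Φ)
    (hΨ : ContMDiff (𝓡 15) (𝓡 15) ∞ Ψ) (hΨΦ : ∀ x, Ψ (Φ x) = x)
    (hact : ∀ x p, Φ (act x p) = act (Φ x) p) :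
    IsCartanConnection conformal act (θ'.pullback Φ) where
  smooth i j := (hθ'.smoothMatForm i j).pullback hΦ
  equivariant p u (v : Euc 15) := by
    change (θ'.pullback Φ).mat (act u p) (mD (Euc 15) (Euc 15) (fun x => act x p) u v) =
      rho (p : Spin33)⁻¹ * (θ'.pullback Φ).mat u v * rho (p : Spin33)
    have hr := hP.contMDiff_act_right p
    rw [OneForm.pullback_mat, OneForm.pullback_mat,
      ← mD_comp (f := fun x => act x p) (hΦ.mdifferentiableAt (by simp))
        (hr.mdifferentiableAt (by simp))]
    simp only [hact]
    rw [mD_comp (g := fun x => act x p) (hr.mdifferentiableAt (by simp))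
      (hΦ.mdifferentiableAt (by simp))]
    exact hθ'.equivariant p (Φ u) _
  fundamental γ hγ hγ0 u i j := by
    have hc : ContMDiff 𝓘(ℝ, ℝ) (𝓡 15) ∞ (fun t => act u (γ t)) := by
      rw [← contMDiffOn_univ]
      exact hP.contMDiffOn_act isOpen_univ (c := fun _ => u) contMDiffOn_const hγ
    have e : (θ'.pullback Φ).mat (act u (γ 0))
        (mD ℝ (Euc 15) (fun t => act u (γ t)) 0 (1 : ℝ)) =
        θ'.mat (act (Φ u) (γ 0)) (mD ℝ (Euc 15) (fun t => act (Φ u) (γ t)) 0 (1 : ℝ)) := by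
      rw [OneForm.pullback_mat, ← mD_comp (f := fun t => act u (γ t))
        (hΦ.mdifferentiableAt (by simp)) (hc.mdifferentiableAt (by simp))]
      simp only [hact]
    have h := hθ'.fundamental γ hγ hγ0 (Φ u) i j
    change HasDerivAt _ (θ'.mat (act (Φ u) (γ 0))
      (mD ℝ (Euc 15) (fun t => act (Φ u) (γ t)) 0 (1 : ℝ)) i j) 0 at h
    rw [← e] at h
    exact h
  bijective u := by
    let f : Euc 15 →ₗ[ℝ] Euc 15 := mD (Euc 15) (Euc 15) Φ u
    have hinj : Function.Injective f := by
      refine Function.LeftInverse.injective (g := mD (Euc 15) (Euc 15) Ψ (Φ u)) fun v => ?_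
      change mD (Euc 15) (Euc 15) Ψ (Φ u) (mD (Euc 15) (Euc 15) Φ u v) = v
      rw [← mD_comp (hΨ.mdifferentiableAt (by simp)) (hΦ.mdifferentiableAt (by simp))]
      simp only [hΨΦ]
      exact mD_id u v
    exact (hθ'.bijective (Φ u)).comp ⟨hinj, (LinearMap.injective_iff_surjective (f := f)).1 hinj⟩

lemma IsNormal.pullback (hθ' : IsCartanConnection conformal act θ') (hn : IsNormal conformal θ')
    {Φ : X → X} (hΦ : ContMDiff (𝓡 15) (𝓡 15) ∞ Φ)
    (h : IsCartanConnection conformal act (θ'.pullback Φ)) :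
    IsNormal conformal (θ'.pullback Φ) := by
  have hκ : ∀ x, curvatureFunction (θ'.pullback Φ) x = curvatureFunction θ' (Φ x) := by
    intro x
    funext A B
    have hs : ∀ A, mD (Euc 15) (Euc 15) Φ x ((h.equiv x).symm A) = (hθ'.equiv (Φ x)).symm A :=
      fun A => (hθ'.symm_eq (h.mat_symm x A)).symm
    rw [h.curvatureFunction_eq, hθ'.curvatureFunction_eq, h.curv_apply, hθ'.curv_apply, ← hs, ← hs]
    exact curvMat_pullback hΦ hθ'.smoothMatForm (fun _ _ => rfl) x _ _
  intro n A Z hAZ x B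
  rw [hκ]
  exact hn n A Z hAZ (Φ x) B

/-- Two normal conformal Cartan connections that induce the same conformal structure are related
by a gauge transformation. -/
lemma IsCartanConnection.exists_gaugeTransformation
    (hP : IsPrincipalBundle (d := 15) (m := 4) conformal.parabolic act π)
    (hθ : IsCartanConnection conformal act θ) (hθ' : IsCartanConnection conformal act θ')
    (hn : IsNormal conformal θ) (hn' : IsNormal conformal θ')
    (h : ∀ x v, θ' x v - θ x v ∈ conformal.parabolicAlg) :
    ∃ Φ : X → X, IsGaugeTransformation (d := 15) act π Φ ∧
      ∀ x v, θ'.mat (Φ x) (mD (Euc 15) (Euc 15) Φ x v) = θ.mat x v := by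
  set g := hθ.gaugeFun θ' with hg
  have hgs : SmoothIntoSpinOn (𝓡 15) (fun x => (g x : Spin33)) Set.univ := hθ.smooth_gaugeFun hθ'
  have hga : ∀ x p, g x * p = p * g (act x p) := hθ.gaugeFun_act hP hθ' h
  let Φ : X → X := fun x => act x (g x)
  let Ψ : X → X := fun x => act x (g x)⁻¹
  have hΦ : ContMDiff (𝓡 15) (𝓡 15) ∞ Φ := by
    rw [← contMDiffOn_univ]
    exact hP.contMDiffOn_act isOpen_univ (c := fun x => x) contMDiffOn_id hgs
  have hΨ : ContMDiff (𝓡 15) (𝓡 15) ∞ Ψ := by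
    rw [← contMDiffOn_univ]
    exact hP.contMDiffOn_act isOpen_univ (c := fun x => x) (h := fun x => (g x)⁻¹) contMDiffOn_id
      hgs.inv
  have hΨΦ : ∀ x, Ψ (Φ x) = x := by
    intro x
    have h1 : g (act x (g x)) = g x := (mul_left_cancel (hga x (g x))).symm
    change act (act x (g x)) (g (act x (g x)))⁻¹ = x
    rw [h1, ← hP.act_mul, mul_inv_cancel, hP.act_one]
  have hact : ∀ x p, Φ (act x p) = act (Φ x) p := by
    intro x p
    change act (act x p) (g (act x p)) = act (act x (g x)) p
    rw [← hP.act_mul, ← hP.act_mul, hga]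
  have h3 := hθ'.pullback hP hΦ hΨ hΨΦ hact
  refine ⟨Φ, ⟨hΦ, hact, fun x => hP.proj_act x _⟩, fun x v => ?_⟩
  refine hθ.eq_of_isNormal hP h3 hn (hn'.pullback hθ' hΦ h3) (fun x v => ?_) x v
  have hl := hθ'.leibniz hP isOpen_univ (Set.mem_univ x) (c := fun x => x) (h := g)
    contMDiffOn_id hgs v
  rw [mD_id] at hl
  have hd : DiffMatAt (Euc 15) (fun y => rho (g y : Spin33)) x :=
    (smoothIntoSpinOn_rho hgs).diffMatAt isOpen_univ (Set.mem_univ x)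
  have hgl : ∀ y, rho (g y : Spin33) *ᵥ vTilde = vTilde := fun y =>
    rho_shearP_mulVec_vTilde (hθ.hForm_gaugeVec θ' y)
  have hdl : mDMat (Euc 15) (fun y => rho (g y : Spin33)) x v *ᵥ vTilde = 0 := by
    ext i
    rw [mDMat_mulVec hd]
    simp only [hgl]
    exact mD_const x _ v
  have hv : hForm vTilde (θ.mat x v *ᵥ vTilde) = 0 := skew_self (θ x v).2 _
  rw [OneForm.pullback_mat, Matrix.sub_mulVec, sub_eq_zero]
  change θ'.mat (act x (g x)) (mD (Euc 15) (Euc 15) (fun y => act y (g y)) x v) *ᵥ vTilde = _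
  rw [hl, Matrix.add_mulVec, ← Matrix.mulVec_mulVec, ← Matrix.mulVec_mulVec, hgl,
    ← Matrix.mulVec_mulVec, hdl, Matrix.mulVec_zero, add_zero,
    hθ.mulVec_eq_add_gaugeVec hP hθ' h, ← rho_shearP_mulVec (hθ.hForm_gaugeVec θ' x) hv]
  exact rho_inv_mulVec_mulVec _ _

end Gauge

end Fefferman

open Fefferman in
theorem mainTheorem6 {M 𝒢 : Type*}
    [TopologicalSpace M] [ChartedSpace (EuclideanSpace ℝ (Fin 2)) M] [IsManifold (𝓡 2) ∞ M]
    [TopologicalSpace 𝒢] [ChartedSpace (EuclideanSpace ℝ (Fin 8)) 𝒢] [IsManifold (𝓡 8) ∞ 𝒢]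
    (act : 𝒢 → projective.parabolic → 𝒢) (π : 𝒢 → M)
    (hπ : IsPrincipalBundle (d := 8) (m := 2) projective.parabolic act π)
    (θ : OneForm 𝒢 8 projective.alg)
    (hθ : IsCartanConnection projective act θ)
    (hnormal : IsNormal projective θ)
    [TopologicalSpace (FeffSpace act)] [ChartedSpace (EuclideanSpace ℝ (Fin 4)) (FeffSpace act)]
    [IsManifold (𝓡 4) ∞ (FeffSpace act)]
    [TopologicalSpace (FeffBundle act)]
    [ChartedSpace (EuclideanSpace ℝ (Fin 15)) (FeffBundle act)]
    [IsManifold (𝓡 15) ∞ (FeffBundle act)]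
    (hcan : IsCanonicalStructure act) :
    (∃! θ₁ : OneForm (FeffBundle act) 15 conformal.alg, IsExtension act θ θ₁) ∧
    ∀ θ₁ : OneForm (FeffBundle act) 15 conformal.alg, IsExtension act θ θ₁ →
      IsNormal conformal θ₁ ∧
      ∀ θ₂ : OneForm (FeffBundle act) 15 conformal.alg,
        IsCartanConnection conformal (feffAct act) θ₂ →
        (∀ x v, θ₂ x v - θ₁ x v ∈ conformal.parabolicAlg) →
        IsNormal conformal θ₂ →
        ∃ Φ : FeffBundle act → FeffBundle act,
          IsGaugeTransformation (d := 15) (feffAct act) (feffProj act) Φ ∧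
          (∀ x v, θ₂ (Φ x) (mfderiv (𝓡 15) (𝓡 15) Φ x v) = θ₁ x v) ∧
          ∀ (V : Type*) [NormedAddCommGroup V] [NormedSpace ℝ V] [FiniteDimensional ℝ V]
            (τ : SmoothRep V) (s : FeffBundle act → V), IsTractorSection (d := 15) (feffAct act) τ s →
            ∀ x v, tractorConnection τ θ₂ s (Φ x) (mfderiv (𝓡 15) (𝓡 15) Φ x v) =
              tractorConnection τ θ₁ (s ∘ Φ) x v := by
  refine ⟨?_, fun θ₁ h₁ => ⟨h₁.isNormal hπ hθ hnormal hcan, fun θ₂ hθ₂ h₂ hn₂ => ?_⟩⟩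
  · obtain ⟨θ₁, h₁⟩ := exists_isLiftForm hπ hθ hcan
    exact ⟨θ₁, h₁.isExtension hπ hθ hcan, fun θ₂ h₂ => (h₂.isLiftForm hcan).unique hcan h₁⟩
  · obtain ⟨Φ, hΦ, h⟩ := h₁.cartan.exists_gaugeTransformation hcan.bundle hθ₂
      (h₁.isNormal hπ hθ hnormal hcan) hn₂ h₂
    have h' : ∀ x v, θ₂ (Φ x) (mfderiv (𝓡 15) (𝓡 15) Φ x v) = θ₁ x v := fun x v =>
      Subtype.ext (h x v)
    exact ⟨Φ, hΦ, h', fun V _ _ _ τ s hs x v =>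
      tractorConnection_gauge hs.smooth hΦ.smooth h' x v⟩
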